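/- Let $K$ be a field and let $\Sigma$ be a connected orientable surface of negative Euler characteristic: either a compact surface $\Sigma_{g,r}$ of genus $g$ with $r$ boundary components, $2-2g-r<0$, or a non-compact surface (possibly of infinite type) in which every compact set lies in the interior of an essential compact subsurface of negative Euler characteristic. Here a compact subsurface $\Sigma'\subset\Sigma$ is called essential if the inclusion induces an injection $\pi_1(\Sigma')\to\pi_1(\Sigma)$; its image, well defined up to conjugation, is called a subsurface group. The level of $\Sigma_{g,r}$ is $3g+r-3$, so the compact surfaces of negative Euler characteristic and level $0$ or $1$ are the 3-holed sphere $\Sigma_{0,3}$ (level $0$) and the 1-holed torus $\Sigma_{1,1}$ and the 4-holed sphere $\Sigma_{0,4}$ (level $1$). A representation $\rho$ of a group to $SL(2,K)$ is reducible if some 1-dimensional linear subspace of $K^2$ is invariant under it. Theorem. Let $\rho:\pi_1(\Sigma)\to SL(2,K)$ be a representation. (1) Suppose that $\Sigma$ has level at least $1$ (in the non-compact case: the compact subsurfaces exhausting $\Sigma$ can be chosen of level at least $1$). Then $\rho$ is reducible if and only if its restriction to the group of each essential level-1 subsurface of $\Sigma$ is reducible. (2) For every $\Sigma$ as above (of any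 level), $\rho$ is reducible if and only if its restriction to the group of each essential 3-holed sphere and of each essential 1-holed torus in $\Sigma$ is reducible. -/

import Mathlib

noncomputable section

namespace SurfaceRep

/-- The number of glued sides in the standard planar model of the compact orientable surface of
genus `g` with `r` boundary components: `4 * g` if `r = 0`, and `4 * g + 2 * (r - 1)` if `r ≥ 1`. -/
def numSides (g r : ℕ) : ℕ := 4 * g + 2 * (r - 1)

/-- Which side is glued to which. In cyclic order the sides spell the word
`a₁ b₁ a₁⁻¹ b₁⁻¹ ⋯ a_g b_g a_g⁻¹ b_g⁻¹ c₁ c₁⁻¹ ⋯ c_{r-1} c_{r-1}⁻¹`. -/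
def partner (g k : ℕ) : ℕ :=
  if k < 4 * g then (if k % 4 < 2 then k + 2 else k - 2)
  else (if k % 2 = 0 then k + 1 else k - 1)

/-- With `m = numSides g r`, the `k`-th side is the arc of the unit circle that starts at
`exp (2πi k/m)` and has length `2π/m` if `r = 0` (the sides then fill the circle), and `π/m` if
`r ≥ 1` (consecutive sides are then separated by free arcs, which form the boundary of the
surface). It is parametrised counterclockwise by `s ∈ [0, 1]`. -/
def sidePoint (g r k : ℕ) (s : ℝ) : ℂ :=
  Complex.exp (2 * Real.pi * Complex.I *
    (((k + (if r = 0 then (1 : ℝ) else 1 / 2) * s) / (numSides g r : ℝ) : ℝ) : ℂ))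

/-- The gluing relation on the closed unit disc: each side is glued to its partner, with reversed
direction (so that the result is orientable). -/
def glue (g r : ℕ) (x y : Metric.closedBall (0 : ℂ) 1) : Prop :=
  ∃ k < numSides g r, ∃ s ∈ Set.Icc (0 : ℝ) 1,
    (x : ℂ) = sidePoint g r k s ∧ (y : ℂ) = sidePoint g r (partner g k) (1 - s)

/-- The standard compact connected orientable surface `Σ_{g,r}` of genus `g` with `r` boundary
components, as a disc with sides glued, with the quotient topology (by the equivalence relation
generated by `glue`). If `r = 0` this is the usual quotient of the `4g`-gon; if `r ≥ 1` it is a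
disc with `2g + r - 1` bands. (For `g = r = 0` the polygon degenerates; this pair is never used,
since only surfaces of negative Euler characteristic occur below.) -/
def Model (g r : ℕ) : Type := Quot (glue g r)

instance (g r : ℕ) : TopologicalSpace (Model g r) :=
  inferInstanceAs (TopologicalSpace (Quot (glue g r)))

/-- The Euler characteristic of `Σ_{g,r}`. -/
def eulerChar (g r : ℕ) : ℤ := 2 - 2 * g - r

/-- The level of `Σ_{g,r}`. -/
def level (g r : ℕ) : ℤ := 3 * g + r - 3

/-- An essential embedding: a topological embedding that is injective on fundamental groups. -/
def IsEssential {S X : Type*} [TopologicalSpace S] [TopologicalSpace X] (e : C(S, X)) : Prop :=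
  Topology.IsEmbedding e ∧ ∀ s : S, Function.Injective (FundamentalGroup.map e s)

/-- `X` is a connected orientable surface of level at least `l`: either compact, of some genus `g`
with `r` boundary components, negative Euler characteristic and level at least `l`, or noncompact
(possibly of infinite type) and exhausted by essential compact subsurfaces of this kind. -/
def IsSurfaceOfLevelGE (l : ℤ) (X : Type*) [TopologicalSpace X] : Prop :=
  (∃ g r : ℕ, eulerChar g r < 0 ∧ l ≤ level g r ∧ Nonempty (X ≃ₜ Model g r)) ∨
  (NoncompactSpace X ∧ ∀ C : Set X, IsCompact C →
    ∃ g r : ℕ, eulerChar g r < 0 ∧ l ≤ level g r ∧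
      ∃ e : C(Model g r, X), IsEssential e ∧ C ⊆ interior (Set.range e))

/-- The homomorphism `π₁(S, s) → π₁(X, x₀)` induced by a map `e : S → X` and a path from `e s`
to the base point `x₀`. -/
def inducedHom {S X : Type*} [TopologicalSpace S] [TopologicalSpace X] (e : C(S, X)) (s : S)
    {x₀ : X} (p : Path (e s) x₀) : FundamentalGroup S s →* FundamentalGroup X x₀ :=
  (FundamentalGroup.fundamentalGroupMulEquivOfPath p).toMonoidHom.comp (FundamentalGroup.map e s)

/-- `H ≤ π₁(X, x₀)` is the group of an essential subsurface of `X` of genus `g` with `r` boundary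
components (for some choice of base point in the subsurface and of a path from it to `x₀`). -/
def IsSubsurfaceGroup (g r : ℕ) {X : Type*} [TopologicalSpace X] {x₀ : X}
    (H : Subgroup (FundamentalGroup X x₀)) : Prop :=
  ∃ e : C(Model g r, X), IsEssential e ∧
    ∃ (s : Model g r) (p : Path (e s) x₀), H = (inducedHom e s p).range

/-- `H ≤ π₁(X, x₀)` is the group of an essential level-1 subsurface of `X`. -/
def IsLevelOneSubsurfaceGroup {X : Type*} [TopologicalSpace X] {x₀ : X}
    (H : Subgroup (FundamentalGroup X x₀)) : Prop :=
  ∃ g r : ℕ, eulerChar g r < 0 ∧ level g r = 1 ∧ IsSubsurfaceGroup g r H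

/-- A representation to `SL(2, K)` is reducible if it leaves a line in `K²` invariant. -/
def IsReducible {K G : Type*} [Field K] [Group G]
    (ρ : G →* Matrix.SpecialLinearGroup (Fin 2) K) : Prop :=
  ∃ L : Submodule K (Fin 2 → K), Module.finrank K L = 1 ∧
    ∀ γ : G, ∀ v ∈ L, (ρ γ : Matrix (Fin 2) (Fin 2) K).mulVec v ∈ L

end SurfaceRep

end

/-! A restriction of a reducible representation is reducible, so only the converses need work. The
algebra rests on one fact: a vector x is an eigenvector of a 2 × 2 matrix A exactly when the
quadratic form x ∧ Ax vanishes at it, so a matrix with three eigenlines has every line as an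
eigenline (`mem_eigenStab_of_three`). This gives a Helly property: a set of matrices has a common
eigenvector as soon as any three of its elements have one (`HasCommonEigenvector.of_triples`). The
property is used twice. Three loops always lie in one essential compact subsurface, which reduces
the question to the models `Model g r`; and on a model only triples of generators have to be
considered.

A disc with glued sides yields one generator for each pair of sides. The generators fall into
blocks: a handle contributes two of them, a and b, and every other pair contributes one. Three
generators from different blocks are carried by an essential four-holed sphere. For a handle a, b
and a generator c of another block, three subsurfaces suffice (`hasCommonEigenvector_of_handle`):
the one-holed torus ⟨a, b⟩, the four-holed sphere ⟨b a⁻¹ b⁻¹, c, a⟩ obtained by cutting the handle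
open, and the one-holed torus ⟨b, c⁻¹ a⁻¹⟩ obtained by sliding the handle over c. This proves (1).
For (2), a four-holed sphere with group ⟨a, b, c⟩ is controlled by the four pairs of pants ⟨a, b⟩,
⟨b, c⟩, ⟨a, c⟩ and ⟨ba, c⟩ (`hasCommonEigenvector_of_pairs`).

The topological task is to produce these subsurfaces and to show that they are essential. The
embeddings come from combinatorial data, a `Routing`, which says how legs of a thickened disc run to
the sides of the target polygon and perhaps continue beyond them. Two facts about the fundamental
group of a quotient of a simply connected space replace a presentation: loops crossing the glued
pairs generate it (`eq_top_of_hop_mem`), and homomorphisms with prescribed values on these loops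
arise as monodromy of an explicit covering (`exists_hom_hop`). Injectivity follows without computing
any group: the source is generated by finitely many loops, and it is enough that their images become
free generators under some homomorphism out of the target (`injective_of_free`). If the target is
closed, that homomorphism must respect the surface relation; a nontrivial contribution of one handle
is then cancelled by another handle, for the four-holed sphere in a cut handle inside the group F₃ ⋊
Aut F₃. -/

noncomputable section

namespace SurfaceRep

open Set Topology unitInterval

/-! ### Generators of the fundamental group of a quotient of a simply connected space -/

section QuotientPaths

variable {X Y : Type*} [TopologicalSpace X] [TopologicalSpace Y] [SimplyConnectedSpace Y]

/-- The image in `X` of the unique homotopy class of paths from `x` to `y` in the simply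
connected space `Y`. -/
def seg (q : C(Y, X)) (x y : Y) : Path.Homotopic.Quotient (q x) (q y) :=
  (Path.Homotopic.Quotient.mk (PathConnectedSpace.somePath x y)).map q

lemma map_eq_seg (q : C(Y, X)) {x y : Y} (γ : Path.Homotopic.Quotient x y) :
    γ.map q = seg q x y :=
  congrArg (fun δ => Path.Homotopic.Quotient.map δ q) (Subsingleton.elim _ _)

lemma seg_self (q : C(Y, X)) (x : Y) : seg q x x = .refl (q x) := by
  rw [← map_eq_seg q (.refl x)]; rfl

lemma seg_trans (q : C(Y, X)) (x y z : Y) : (seg q x y).trans (seg q y z) = seg q x z := by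
  rw [← map_eq_seg q ((Path.Homotopic.Quotient.mk (PathConnectedSpace.somePath x y)).trans
    (Path.Homotopic.Quotient.mk (PathConnectedSpace.somePath y z)))]
  exact ((FundamentalGroupoid.map q).map_comp (X := ⟨x⟩) (Y := ⟨y⟩) (Z := ⟨z⟩)
    (Path.Homotopic.Quotient.mk (PathConnectedSpace.somePath x y))
    (Path.Homotopic.Quotient.mk (PathConnectedSpace.somePath y z))).symm

lemma seg_symm (q : C(Y, X)) (x y : Y) : (seg q x y).symm = seg q y x := by
  rw [← map_eq_seg q (Path.Homotopic.Quotient.mk (PathConnectedSpace.somePath x y)).symm]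
  rfl

/-- The loop that runs from `b` to `x` and back from `y` to `b`, where `x` and `y` have the same
image. -/
def hop (q : C(Y, X)) (b x y : Y) (h : q x = q y) : FundamentalGroup X (q b) :=
  FundamentalGroup.fromPath ((seg q b x).trans ((seg q y b).cast h rfl))

/-- The loop obtained from a path class in `X` by joining its ends to `b` through lifts. -/
def closeUp (q : C(Y, X)) (b : Y) {x y : X} (γ : Path.Homotopic.Quotient x y) (d d' : Y)
    (hd : q d = x) (hd' : q d' = y) : FundamentalGroup X (q b) :=
  FundamentalGroup.fromPath ((seg q b d).trans ((γ.cast hd hd').trans (seg q d' b)))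

/-- Multiplication in `FundamentalGroup` follows composition of morphisms, so the loop traversed
first is the right factor. The two inner connecting arcs end and begin at the same lift `d'` and
cancel because `Y` is simply connected. -/
lemma closeUp_trans (q : C(Y, X)) (b : Y) {x y z : X} (γ : Path.Homotopic.Quotient x y)
    (γ' : Path.Homotopic.Quotient y z) (d d' d'' : Y) (hd : q d = x) (hd' : q d' = y)
    (hd'' : q d'' = z) :
    closeUp q b (γ.trans γ') d d'' hd hd'' = closeUp q b γ' d' d'' hd' hd'' *
      closeUp q b γ d d' hd hd' := by
  subst hd hd' hd''
  rw [FundamentalGroup.mul_def]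
  simp only [closeUp, Path.Homotopic.Quotient.cast_rfl_rfl, FundamentalGroup.fromPath,
    FundamentalGroup.fromArrow, Path.Homotopic.Quotient.trans_assoc]
  rw [← Path.Homotopic.Quotient.trans_assoc (seg q d' b), seg_trans, seg_self,
    Path.Homotopic.Quotient.refl_trans]

lemma closeUp_refl (q : C(Y, X)) (b : Y) {x : X} (d d' : Y) (hd : q d = x) (hd' : q d' = x) :
    closeUp q b (.refl x) d d' hd hd' = hop q b d d' (hd.trans hd'.symm) := by
  subst hd
  have : ∀ (x : X) (hd' : x = q d) (δ : Path.Homotopic.Quotient x (q b)),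
    ((Path.Homotopic.Quotient.refl (q d)).cast rfl hd').trans δ = δ.cast hd'.symm rfl := by
    rintro x rfl δ; simp
  simp only [closeUp, hop]
  rw [this]

lemma closeUp_symm (q : C(Y, X)) (b : Y) {x y : X} (γ : Path.Homotopic.Quotient x y)
    (d d' : Y) (hd : q d = x) (hd' : q d' = y) :
    closeUp q b γ.symm d' d hd' hd = (closeUp q b γ d d' hd hd')⁻¹ := by
  rw [eq_inv_iff_mul_eq_one, ← closeUp_trans, Path.Homotopic.Quotient.trans_symm, closeUp_refl]
  subst hd
  simp [hop, seg_trans, seg_self]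
  rfl

lemma closeUp_seg (q : C(Y, X)) (b d d' : Y) : closeUp q b (seg q d d') d d' rfl rfl = 1 := by
  simp only [closeUp, Path.Homotopic.Quotient.cast_rfl_rfl, seg_trans, seg_self]; rfl

lemma hop_self (q : C(Y, X)) (b d : Y) : hop q b d d rfl = 1 := by
  simp only [hop, Path.Homotopic.Quotient.cast_rfl_rfl, seg_trans, seg_self]; rfl

lemma hop_symm (q : C(Y, X)) (b x y : Y) (h : q x = q y) :
    hop q b y x h.symm = (hop q b x y h)⁻¹ := by
  rw [← closeUp_refl q b (x := q y) x y h rfl, ← closeUp_symm, ← closeUp_refl q b (x := q y) y x rfl h]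
  rfl

lemma hop_mul (q : C(Y, X)) (b x y z : Y) (h : q x = q y) (h' : q y = q z) :
    hop q b y z h' * hop q b x y h = hop q b x z (h.trans h') := by
  rw [← closeUp_refl q b (x := q y) x y h rfl, ← closeUp_refl q b (x := q y) y z rfl h'.symm,
    ← closeUp_trans, Path.Homotopic.Quotient.refl_trans, closeUp_refl]

/-- A path in `X` which lifts to `Y` piecewise from `x` to `x'` and from `y` to `y'`, the two lifts
having the same image, gives the same loop. -/
lemma hop_congr (q : C(Y, X)) (b : Y) {x x' y y' : Y} (γ : Path x x') (δ : Path y y')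
    (h : ∀ t, q (γ t) = q (δ t)) :
    hop q b x y (by simpa using h 0) = hop q b x' y' (by simpa using h 1) := by
  have h0 : q x = q y := by simpa using h 0
  have h1 : q x' = q y' := by simpa using h 1
  -- The two lifted paths have the same projection, so the corresponding segments agree in `X` and
  -- cancel in the loop. This allows a crossing point to be moved along a side.
  have key : seg q x x' = (seg q y y').cast h0 h1 := by
    rw [← map_eq_seg q (.mk γ), ← map_eq_seg q (.mk δ), ← Path.Homotopic.Quotient.mk_map,
      ← Path.Homotopic.Quotient.mk_map, ← Path.Homotopic.Quotient.mk_cast]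
    congr 1
    ext t
    exact h t
  have : ∀ (u v : X) (hu : u = q y) (hv : v = q y') (ε : Path.Homotopic.Quotient (q b) u),
      (ε.trans ((seg q y y').cast hu hv)).trans ((seg q y' b).cast hv rfl) =
      ε.trans ((seg q y b).cast hu rfl) := by
    rintro _ _ rfl rfl ε
    simp [seg_trans]
  simp only [hop]
  rw [← seg_trans q b x x', key, this]

variable {R : Y → Y → Prop}

/-- The loops `hop x y`, for `x` and `y` related, generate the fundamental group of the quotient
by the relation generated by `R`, provided that the quotient is covered by open sets that contract
along paths that lift. -/
theorem eq_top_of_hop_mem {q : C(Y, X)} (hq : IsQuotientMap q)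
    (hqR : ∀ x y, q x = q y → Relation.EqvGen R x y) (hRq : ∀ x y, R x y → q x = q y) (b : Y)
    (N : Subgroup (FundamentalGroup X (q b))) (hN : ∀ x y (h : R x y), hop q b x y (hRq x y h) ∈ N)
    (hcov : ∀ y : Y, ∃ (U : Set Y) (h : Y → I → Y), y ∈ U ∧ IsOpen U ∧
      (∀ x y, R x y → (x ∈ U ↔ y ∈ U)) ∧
      ContinuousOn (Function.uncurry h) (U ×ˢ univ) ∧ (∀ x ∈ U, h x 0 = x) ∧
      (∀ x y, R x y → x ∈ U → ∀ t, q (h x t) = q (h y t)) ∧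
      ∀ x ∈ U, ∀ y ∈ U, q (h x 1) = q (h y 1)) : N = ⊤ := by
  have hopN : ∀ x y (h : q x = q y), hop q b x y h ∈ N := by
    intro x y h
    have := hqR x y h
    induction this with
    | rel x y hxy => exact hN x y hxy
    | refl x => rw [hop_self]; exact N.one_mem
    | symm x y _ ih => rw [hop_symm q b x y h.symm]; exact N.inv_mem (ih h.symm)
    | trans x y z h1 h2 ih1 ih2 =>
      have : ∀ x y, Relation.EqvGen R x y → q x = q y := by
        intro x y h
        induction h with
        | rel x y h => exact hRq x y h
        | refl => rfl
        | symm _ _ _ ih => exact ih.symm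
        | trans _ _ _ _ _ ih ih' => exact ih.trans ih'
      rw [← hop_mul q b x y z (this _ _ h1) (this _ _ h2)]
      exact N.mul_mem (ih2 _) (ih1 _)
  -- Good classes are those that give elements of `N` however their ends are joined to the base
  -- point. Different lifts of one point differ by an element of `N`, so goodness is inherited by
  -- composites, inverses and all classes that lift to `Y`.
  let Good : ∀ {x y : X}, Path.Homotopic.Quotient x y → Prop := fun {x y} γ =>
    ∀ d d' (hd : q d = x) (hd' : q d' = y), closeUp q b γ d d' hd hd' ∈ N
  have good_refl : ∀ x, Good (.refl x) := fun x d d' hd hd' => by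
    rw [closeUp_refl]; exact hopN _ _ _
  have good_trans : ∀ {x y z : X} (γ : Path.Homotopic.Quotient x y)
      (γ' : Path.Homotopic.Quotient y z), Good γ → Good γ' → Good (γ.trans γ') := by
    intro x y z γ γ' h h' d d'' hd hd''
    obtain ⟨d', hd'⟩ := hq.surjective y
    rw [closeUp_trans q b γ γ' d d' d'' hd hd' hd'']
    exact N.mul_mem (h' _ _ _ _) (h _ _ _ _)
  have good_symm : ∀ {x y : X} (γ : Path.Homotopic.Quotient x y), Good γ → Good γ.symm := by
    intro x y γ h d d' hd hd'
    rw [closeUp_symm]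
    exact N.inv_mem (h _ _ _ _)
  have good_seg : ∀ d d', Good (seg q d d') := by
    intro d d' e e' he he'
    have h1 := closeUp_trans q b (.refl (q d)) (seg q d d') e d d' he rfl rfl
    have h2 := closeUp_trans q b (seg q d d') (.refl (q d')) e d' e' he rfl he'
    rw [Path.Homotopic.Quotient.refl_trans] at h1
    rw [Path.Homotopic.Quotient.trans_refl] at h2
    rw [h2, h1, closeUp_refl, closeUp_refl, closeUp_seg, one_mul]
    exact N.mul_mem (hopN _ _ _) (hopN _ _ _)
  have good_cast : ∀ {x y x' y' : X} (γ : Path.Homotopic.Quotient x y) (hx : x' = x) (hy : y' = y),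
      Good γ → Good (γ.cast hx hy) := by
    rintro x y _ _ γ rfl rfl h; rwa [Path.Homotopic.Quotient.cast_rfl_rfl]
  -- paths in a contracting patch
  have local_good : ∀ y : X, ∃ V : Set X, IsOpen V ∧ y ∈ V ∧
      ∀ {a c : X} (δ : Path a c), (∀ t, δ t ∈ V) → Good (.mk δ) := by
    intro y
    obtain ⟨y, rfl⟩ := hq.surjective y
    obtain ⟨U, h, hyU, hU, hsat, hcont, h0, hR, h1⟩ := hcov y
    have hsat' : ∀ x y, Relation.EqvGen R x y → (x ∈ U ↔ y ∈ U) := by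
      intro x y h
      induction h with
      | rel x y h => exact hsat x y h
      | refl => rfl
      | symm _ _ _ ih => exact ih.symm
      | trans _ _ _ _ _ ih ih' => exact ih.trans ih'
    have hR' : ∀ x y, Relation.EqvGen R x y → x ∈ U → ∀ t, q (h x t) = q (h y t) := by
      intro x y h
      induction h with
      | rel x y h => exact hR x y h
      | refl => intros; rfl
      | symm x y hxy ih => exact fun hy t => (ih ((hsat' _ _ hxy).2 hy) t).symm
      | trans x y z hxy _ ih ih' =>
        exact fun hx t => (ih hx t).trans (ih' ((hsat' _ _ hxy).1 hx) t)
    set V : Set X := q '' U with hV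
    have hpre : q ⁻¹' V = U := by
      ext z
      constructor
      · rintro ⟨w, hw, hwz⟩
        exact (hsat' _ _ (hqR _ _ hwz)).1 hw
      · exact fun hz => ⟨z, hz, rfl⟩
    have hVo : IsOpen V := by rw [← hq.isOpen_preimage, hpre]; exact hU
    have hqV : IsQuotientMap (V.restrictPreimage q) := hq.restrictPreimage_isOpen hVo
    have hUpre : ∀ z : q ⁻¹' V, (z : Y) ∈ U := fun z => by rw [← hpre]; exact z.2
    let F : C((q ⁻¹' V) × I, X) :=
      ⟨fun p => q (h p.1 p.2), q.continuous.comp (hcont.comp_continuous (f := fun p : (q ⁻¹' V) × I =>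
        ((p.1 : Y), p.2)) (by fun_prop) (fun p => ⟨hUpre _, mem_univ _⟩))⟩
    -- After currying, the contraction descends along the quotient map onto the open set `V` alone,
    -- and no quotient map on a product with the interval is needed.
    let F' : C(q ⁻¹' V, C(I, X)) := F.curry
    have hF' : ∀ a b : q ⁻¹' V, V.restrictPreimage q a = V.restrictPreimage q b → F' a = F' b := by
      intro a c hac
      ext t
      exact hR' _ _ (hqR _ _ (congrArg Subtype.val hac)) (hUpre a) t
    let qV : C(q ⁻¹' V, V) := ⟨V.restrictPreimage q, hqV.continuous⟩
    have hqV' : IsQuotientMap qV := hqV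
    let H : C(V, C(I, X)) := hqV'.lift F' hF'
    have hH : ∀ z : q ⁻¹' V, H (qV z) = F' z := fun z =>
      congrArg (fun f : C(q ⁻¹' V, C(I, X)) => f z) (hqV'.lift_comp F' hF')
    have hlift : ∀ v : V, ∃ z : q ⁻¹' V, qV z = v := hqV'.surjective
    let f0 : C(V, X) := ⟨Subtype.val, continuous_subtype_val⟩
    let f1 : C(V, X) := ContinuousMap.const V (q (h y 1))
    let HH : f0.Homotopy f1 :=
      { toFun := fun p => H p.2 p.1
        continuous_toFun := by
          have : Continuous fun p : V × I => H p.1 p.2 := (H.uncurry).continuous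
          exact this.comp continuous_swap
        map_zero_left := by
          intro v
          obtain ⟨z, rfl⟩ := hlift v
          rw [hH]
          change q (h z 0) = q z
          rw [h0 _ (hUpre z)]
        map_one_left := by
          intro v
          obtain ⟨z, rfl⟩ := hlift v
          rw [hH]
          exact h1 _ (hUpre z) _ hyU }
    -- The track of a point under the contraction is the image of a path in `Y`, hence good.
    have track : ∀ v : V, Good (.mk (HH.evalAt v)) := by
      intro v
      obtain ⟨z, rfl⟩ := hlift v
      have hz : h z 0 = z := h0 _ (hUpre z)
      let p : Path (h z 0) (h z 1) :=
        { toFun := fun t => h z t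
          continuous_toFun := hcont.comp_continuous (f := fun t : I => ((z : Y), t)) (by fun_prop)
            (fun p => ⟨hUpre _, mem_univ _⟩)
          source' := rfl
          target' := rfl }
      have e1 : q (h z 0) = f0 (qV z) := by rw [hz]; rfl
      have e2 : f1 (qV z) = q (h z 1) := (h1 _ (hUpre z) _ hyU).symm
      have : Path.Homotopic.Quotient.mk (HH.evalAt (qV z)) =
          (seg q (h z 0) (h z 1)).cast e1.symm e2 := by
        rw [← map_eq_seg q (.mk p), ← Path.Homotopic.Quotient.mk_map,
          ← Path.Homotopic.Quotient.mk_cast]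
        congr 1
        ext t
        change H (qV z) t = q (h z t)
        rw [hH]; rfl
      rw [this]
      exact good_cast _ _ _ (good_seg _ _)
    refine ⟨V, hVo, ⟨y, hyU, rfl⟩, ?_⟩
    intro a c δ hδ
    let δ' : Path (⟨a, by simpa using hδ 0⟩ : V) ⟨c, by simpa using hδ 1⟩ :=
      { toFun := fun t => ⟨δ t, hδ t⟩
        continuous_toFun := by fun_prop
        source' := by simp
        target' := by simp }
    let T : ∀ v : V, Path.Homotopic.Quotient (v : X) (q (h y 1)) := fun v => .mk (HH.evalAt v)
    -- Naturality of the homotopy from the inclusion to a constant: a path in the patch is the track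
    -- of its initial point followed by the reversed track of its end point.
    have hom := Path.Homotopic.map_trans_evalAt HH δ'
    have hom' : (Path.Homotopic.Quotient.mk δ).trans (T ⟨c, by simpa using hδ 1⟩) =
        (T ⟨a, by simpa using hδ 0⟩).trans (.refl _) :=
      Path.Homotopic.Quotient.eq.2 hom
    have hδeq : Path.Homotopic.Quotient.mk δ =
        (T ⟨a, by simpa using hδ 0⟩).trans (T ⟨c, by simpa using hδ 1⟩).symm := by
      have := congrArg (fun ε => Path.Homotopic.Quotient.trans ε
        (T ⟨c, by simpa using hδ 1⟩).symm) hom'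
      simpa only [Path.Homotopic.Quotient.trans_assoc, Path.Homotopic.Quotient.trans_symm,
        Path.Homotopic.Quotient.trans_refl] using this
    rw [hδeq]
    exact good_trans _ _ (track ⟨a, by simpa using hδ 0⟩)
      (good_symm _ (track ⟨c, by simpa using hδ 1⟩))
  choose V hVo hyV hVgood using local_good
  have all_good : ∀ {a c : X} (δ : Path a c), Good (.mk δ) := by
    intro a c δ
    obtain ⟨t, ht0, htm, ⟨n, hn⟩, hsub⟩ := exists_monotone_Icc_subset_open_cover_unitInterval
      (c := fun y : X => δ ⁻¹' V y) (fun y => (hVo y).preimage δ.continuous)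
      (fun s _ => mem_iUnion.2 ⟨δ s, hyV (δ s)⟩)
    have step : ∀ k, Good (.mk (δ.subpath (t 0) (t k))) := by
      intro k
      induction k with
      | zero => rw [Path.subpath_self]; exact good_refl _
      | succ k ih =>
        rw [← Path.Homotopic.Quotient.eq.2 ⟨Path.Homotopy.subpathTransSubpath δ (t 0) (t k) (t (k+1))⟩,
          Path.Homotopic.Quotient.mk_trans]
        refine good_trans _ _ ih ?_
        obtain ⟨y, hy⟩ := hsub k
        refine hVgood y _ (fun s => ?_)
        have : δ.subpath (t k) (t (k+1)) s ∈ range (δ.subpath (t k) (t (k+1))) := ⟨s, rfl⟩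
        rw [Path.range_subpath_of_le _ _ _ (htm (Nat.le_succ k))] at this
        obtain ⟨u, hu, hu'⟩ := this
        rw [← hu']
        exact hy hu
    have := step n
    rw [ht0, hn n le_rfl, Path.subpath_zero_one, Path.Homotopic.Quotient.mk_cast] at this
    have h2 := good_cast _ δ.source.symm δ.target.symm this
    rwa [Path.Homotopic.Quotient.cast_cast, Path.Homotopic.Quotient.cast_rfl_rfl] at h2
  rw [eq_top_iff]
  intro γ _
  obtain ⟨δ, hδ⟩ := Path.Homotopic.Quotient.mk_surjective (FundamentalGroup.toPath γ)
  have := all_good δ b b rfl rfl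
  rw [closeUp, hδ, seg_self, Path.Homotopic.Quotient.cast_rfl_rfl,
    Path.Homotopic.Quotient.refl_trans, Path.Homotopic.Quotient.trans_refl] at this
  exact this

end QuotientPaths

/-! ### Homomorphisms out of the fundamental group, from an explicit covering -/

section Monodromy

variable {Y L G : Type*} [Group G]

/-- The relation on `G × Y` which shifts the first coordinate by `c k` along the relation `R k`. -/
def twistRel (R : L → Y → Y → Prop) (c : L → G) (u v : Σ _ : G, Y) : Prop :=
  ∃ k, R k u.2 v.2 ∧ v.1 = u.1 * c k

/-- The covering space of the quotient of `Y` with deck group `G` and transition elements `c k`. -/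
def TwistedCover (R : L → Y → Y → Prop) (c : L → G) : Type _ := Quot (twistRel R c)

variable (R : L → Y → Y → Prop) (c : L → G)

instance [TopologicalSpace Y] : TopologicalSpace (TwistedCover R c) :=
  inferInstanceAs (TopologicalSpace (Quot (twistRel R c)))

instance : MulAction G (TwistedCover R c) where
  smul g := Quot.map (fun u => ⟨g * u.1, u.2⟩) (fun u v ⟨k, h, h'⟩ => ⟨k, h, by
    simp only [h', mul_assoc]⟩)
  one_smul := by
    rintro ⟨⟨h, y⟩⟩
    change Quot.mk _ _ = Quot.mk _ _
    simp
  mul_smul := by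
    rintro g g' ⟨⟨h, y⟩⟩
    change Quot.mk _ _ = Quot.mk _ _
    simp [mul_assoc]

/-- The class of `(g, y)` in the covering space. -/
def TwistedCover.mk (g : G) (y : Y) : TwistedCover R c := Quot.mk _ ⟨g, y⟩

lemma TwistedCover.smul_mk (g g' : G) (y : Y) :
    g • TwistedCover.mk R c g' y = TwistedCover.mk R c (g * g') y := rfl

lemma TwistedCover.mk_eq_mk {k : L} {x y : Y} (h : R k x y) (g : G) :
    TwistedCover.mk R c g x = TwistedCover.mk R c (g * c k) y :=
  Quot.sound ⟨k, h, rfl⟩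

variable [TopologicalSpace Y] {X : Type*} [TopologicalSpace X] {R c}

/-- The covering projection. -/
def TwistedCover.proj (q : Y → X) (hRq : ∀ k x y, R k x y → q x = q y) : TwistedCover R c → X :=
  Quot.lift (fun u => q u.2) (fun _ _ ⟨k, h, _⟩ => hRq k _ _ h)

/-- The deck group acts on the left, while the gluing shifts the group coordinate on the right, so
the two commute. The function `κ` is a local potential for the transition elements: over the
saturated set `U` the quantity `g * (κ y)⁻¹` is invariant under the gluing and locally constant,
hence labels the sheets. -/
theorem TwistedCover.isQuotientCoveringMap {q : C(Y, X)} (hq : IsQuotientMap q)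
    (hqR : ∀ x y, q x = q y → Relation.EqvGen (fun x y => ∃ k, R k x y) x y)
    (hRq : ∀ k x y, R k x y → q x = q y)
    (hloc : ∀ y : Y, ∃ (U : Set Y) (κ : Y → G), y ∈ U ∧ IsOpen U ∧
      (∀ k x y, R k x y → (x ∈ U ↔ y ∈ U)) ∧ (∀ x ∈ U, ∀ᶠ z in 𝓝 x, κ z = κ x) ∧
      ∀ k x y, R k x y → x ∈ U → κ y = κ x * c k) :
    IsQuotientCoveringMap (TwistedCover.proj (R := R) (c := c) q hRq) G := by
  have hproj : Continuous (TwistedCover.proj (R := R) (c := c) q hRq) :=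
    continuous_quot_lift _ (by
      exact q.continuous.comp (continuous_sigma (fun _ => continuous_id)))
  refine
    { toIsQuotientMap := ?_
      continuous_const_smul := ?_
      apply_eq_iff_mem_orbit := ?_
      disjoint := ?_ }
  · have h1 : IsQuotientMap ((TwistedCover.proj (R := R) (c := c) q hRq) ∘
        (TwistedCover.mk R c (1 : G))) := hq
    refine IsQuotientMap.of_comp ?_ hproj h1
    exact continuous_quot_mk.comp continuous_sigmaMk
  · intro g
    refine continuous_quot_lift _ ?_
    refine continuous_quot_mk.comp (continuous_sigma (fun h => ?_))
    exact @continuous_sigmaMk _ (fun _ : G => Y) _ (g * h)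
  · rintro ⟨⟨g, x⟩⟩ ⟨⟨g', y⟩⟩
    constructor
    · intro h
      change q x = q y at h
      have key : ∀ x y, Relation.EqvGen (fun x y => ∃ k, R k x y) x y → ∀ g' : G,
          ∃ g, TwistedCover.mk R c g x = TwistedCover.mk R c g' y := by
        intro x y h
        induction h with
        | rel x y h =>
          intro g'
          obtain ⟨k, hk⟩ := h
          exact ⟨g' * (c k)⁻¹, by rw [TwistedCover.mk_eq_mk R c hk]; simp⟩
        | refl => exact fun g' => ⟨g', rfl⟩
        | symm x y _ ih =>
          intro g'
          obtain ⟨g, hg⟩ := ih 1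
          refine ⟨g' * g⁻¹, ?_⟩
          rw [← mul_one (g' * g⁻¹), ← TwistedCover.smul_mk, ← hg, TwistedCover.smul_mk]
          simp
        | trans x y z _ _ ih ih' =>
          intro g'
          obtain ⟨g, hg⟩ := ih' g'
          obtain ⟨g2, hg2⟩ := ih g
          exact ⟨g2, hg2.trans hg⟩
      obtain ⟨g2, hg2⟩ := key x y (hqR x y h) g'
      refine ⟨g * g2⁻¹, ?_⟩
      change (g * g2⁻¹) • TwistedCover.mk R c g' y = TwistedCover.mk R c g x
      rw [← hg2, TwistedCover.smul_mk]
      simp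
    · rintro ⟨h, hh⟩
      have : TwistedCover.proj q hRq (h • TwistedCover.mk R c g' y) =
        TwistedCover.proj q hRq (TwistedCover.mk R c g x) :=
          congrArg (TwistedCover.proj q hRq) hh
      exact this.symm
  · rintro ⟨⟨g, y⟩⟩
    obtain ⟨U, κ, hyU, hU, hsat, hκ, hκc⟩ := hloc y
    -- The sheet through the given point is a level set of the invariant. Translation by `h`
    -- multiplies the invariant by `h` on the left, so a translate that meets the sheet has `h = 1`.
    let W : Set (TwistedCover R c) := fun e => Quot.lift
      (fun u : Σ _ : G, Y => u.2 ∈ U ∧ u.1 * (κ u.2)⁻¹ = g * (κ y)⁻¹) (by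
        rintro ⟨g1, y1⟩ ⟨g2, y2⟩ ⟨k, h, h'⟩
        simp only at h h'
        refine propext ⟨fun ⟨a, b⟩ => ⟨(hsat _ _ _ h).1 a, ?_⟩,
          fun ⟨a, b⟩ => ⟨(hsat _ _ _ h).2 a, ?_⟩⟩
        · simp only at b ⊢
          rw [← b, h', hκc k _ _ h a]; group
        · simp only at b ⊢
          rw [← b, h', hκc k _ _ h ((hsat _ _ _ h).2 a)]; group) e
    refine ⟨W, IsOpen.mem_nhds ?_ ⟨hyU, rfl⟩, ?_⟩
    · change IsOpen ((Quot.mk _) ⁻¹' W)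
      rw [isOpen_sigma_iff]
      intro h
      rw [isOpen_iff_mem_nhds]
      rintro x ⟨hx, hx'⟩
      filter_upwards [hU.mem_nhds hx, hκ x hx] with z hz hz'
      exact ⟨hz, by simp only at hx' ⊢; rw [hz', hx']⟩
    · rintro h ⟨_, ⟨⟨⟨g', x⟩⟩, ⟨hx, hx'⟩, rfl⟩, ⟨hx2, hx3⟩⟩
      simp only at hx' hx3
      rw [mul_assoc, hx'] at hx3
      simpa using hx3

open MulOpposite in
/-- A homomorphism from the fundamental group of a quotient of a simply connected space, prescribed
on the generating loops. -/
theorem exists_hom_hop [SimplyConnectedSpace Y] {q : C(Y, X)} (hq : IsQuotientMap q)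
    (hqR : ∀ x y, q x = q y → Relation.EqvGen (fun x y => ∃ k, R k x y) x y)
    (hRq : ∀ k x y, R k x y → q x = q y) (b : Y)
    (hloc : ∀ y : Y, ∃ (U : Set Y) (κ : Y → G), y ∈ U ∧ IsOpen U ∧
      (∀ k x y, R k x y → (x ∈ U ↔ y ∈ U)) ∧ (∀ x ∈ U, ∀ᶠ z in 𝓝 x, κ z = κ x) ∧
      ∀ k x y, R k x y → x ∈ U → κ y = κ x * c k) :
    ∃ F : FundamentalGroup X (q b) →* Gᵐᵒᵖ, ∀ k x y (h : R k x y),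
      F (hop q b x y (hRq k x y h)) = op (c k) := by
  have hp := TwistedCover.isQuotientCoveringMap hq hqR hRq hloc
  set p := TwistedCover.proj (R := R) (c := c) q hRq with hpdef
  set cov := hp.isCoveringMap
  -- A segment lifts with constant group coordinate; only the passage between two glued points
  -- changes the sheet.
  have mono_seg : ∀ (g : G) (x y : Y), cov.monodromy (seg q x y) ⟨TwistedCover.mk R c g x, rfl⟩ =
      ⟨TwistedCover.mk R c g y, rfl⟩ := by
    intro g x y
    let sec : C(Y, TwistedCover R c) :=
      ⟨TwistedCover.mk R c g, continuous_quot_mk.comp continuous_sigmaMk⟩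
    exact cov.monodromy_map
      ((Path.Homotopic.Quotient.mk (PathConnectedSpace.somePath x y)).map sec)
  have mono_cast : ∀ (x x' y : X) (hx : x' = x) (γ : Path.Homotopic.Quotient x y)
      (e : p ⁻¹' {x'}), cov.monodromy (γ.cast hx rfl) e =
        cov.monodromy γ ⟨e.1, e.2.trans hx⟩ := by
    rintro x _ y rfl γ e
    rw [Path.Homotopic.Quotient.cast_rfl_rfl]
  let e0 : p ⁻¹' {q b} := ⟨TwistedCover.mk R c 1 b, rfl⟩
  -- Monodromy commutes with the left action. Reading it off as a left translation of the base sheet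
  -- therefore reverses products, which explains the opposite group.
  refine ⟨hp.fundamentalGroupToMulOpposite e0, fun k x y h => ?_⟩
  rw [hp.fundamentalGroupToMulOpposite_apply_eq_Iff]
  have e1 : cov.monodromy (hop q b x y (hRq k x y h)) e0 =
      ⟨TwistedCover.mk R c (c k) b, rfl⟩ := by
    have : cov.monodromy (hop q b x y (hRq k x y h)) e0 =
        cov.monodromy ((seg q y b).cast (hRq k x y h) rfl) (cov.monodromy (seg q b x) e0) :=
      cov.monodromy_trans_apply _ _ _
    rw [this, mono_seg, mono_cast, ← mono_seg _ y b]
    congr 1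
    refine Subtype.ext ?_
    simpa using TwistedCover.mk_eq_mk R c h 1
  rw [e1]
  simp [e0, TwistedCover.smul_mk]

end Monodromy

/-! ### Polar coordinates in full turns, and contraction of sectors -/

section Turn

/-- The point of the unit circle at angle `t`, measured in full turns. -/
def turn (t : ℝ) : ℂ := Complex.exp (2 * Real.pi * Complex.I * (t : ℂ))

lemma turn_add (a b : ℝ) : turn (a + b) = turn a * turn b := by
  rw [turn, turn, turn, ← Complex.exp_add]; push_cast; ring_nf

@[simp] lemma norm_turn (a : ℝ) : ‖turn a‖ = 1 := by
  have : (2 * Real.pi * Complex.I * (a : ℂ)) = ((2 * Real.pi * a : ℝ) : ℂ) * Complex.I := by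
    push_cast; ring
  rw [turn, this, Complex.norm_exp_ofReal_mul_I]

lemma turn_ne_zero (a : ℝ) : turn a ≠ 0 := Complex.exp_ne_zero _

@[fun_prop] lemma continuous_turn : Continuous turn := by unfold turn; fun_prop

lemma turn_eq_turn_iff {a b : ℝ} : turn a = turn b ↔ ∃ n : ℤ, a = b + n := by
  rw [turn, turn, Complex.exp_eq_exp_iff_exists_int]
  have h2 : (2 * Real.pi * Complex.I : ℂ) ≠ 0 := by
    simp [Real.pi_ne_zero, Complex.I_ne_zero]
  refine exists_congr fun n => ?_
  rw [show (2 * Real.pi * Complex.I * (b : ℂ) + n * (2 * Real.pi * Complex.I) : ℂ) =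
    2 * Real.pi * Complex.I * ((b + n : ℝ) : ℂ) by push_cast; ring, mul_right_inj' h2]
  exact_mod_cast Iff.rfl

lemma turn_add_int (a : ℝ) (n : ℤ) : turn (a + n) = turn a :=
  turn_eq_turn_iff.2 ⟨n, rfl⟩

/-- Every complex number in polar coordinates, with the angle in a given fundamental interval. -/
lemma exists_polar (z : ℂ) (a : ℝ) : ∃ t ∈ Ico a (a + 1), z = ‖z‖ * turn t := by
  have h0 : z = ‖z‖ * turn (z.arg / (2 * Real.pi)) := by
    conv_lhs => rw [← Complex.norm_mul_exp_arg_mul_I z]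
    rw [turn]
    congr 2
    have : (Real.pi : ℂ) ≠ 0 := by exact_mod_cast Real.pi_ne_zero
    push_cast
    field_simp
  obtain ⟨n, hn, -⟩ := existsUnique_add_zsmul_mem_Ico (one_pos : (0 : ℝ) < 1)
    (z.arg / (2 * Real.pi)) a
  refine ⟨_, hn, ?_⟩
  rw [zsmul_eq_mul, mul_one, turn_add_int]
  exact h0

lemma polar_eq {ρ ρ' a a' : ℝ} (hρ : 0 < ρ) (hρ' : 0 ≤ ρ') (h : (ρ : ℂ) * turn a = ρ' * turn a') :
    ρ = ρ' ∧ ∃ n : ℤ, a = a' + n := by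
  have h1 : ρ = ρ' := by
    have := congrArg norm h
    simpa [abs_of_pos hρ, abs_of_nonneg hρ'] using this
  subst h1
  refine ⟨rfl, turn_eq_turn_iff.1 (mul_left_cancel₀ ?_ h)⟩
  exact_mod_cast hρ.ne'

lemma arg_turn {ρ a : ℝ} (hρ : 0 < ρ) (ha : |a| < 1 / 2) :
    ((ρ : ℂ) * turn a).arg = 2 * Real.pi * a := by
  rw [Complex.arg_real_mul _ hρ]
  have : turn a = Complex.exp ((2 * Real.pi * a : ℝ) * Complex.I) := by
    rw [turn]; push_cast; ring_nf
  rw [this, Complex.arg_exp_mul_I, toIocMod_eq_self]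
  have := Real.pi_pos
  rw [abs_lt] at ha
  constructor <;> nlinarith [ha.1, ha.2]

/-- The power-law contraction onto `turn u` in the sector around it. -/
def sectorContract (u : ℝ) (z : ℂ) (t : ℝ) : ℂ :=
  turn u * Complex.exp ((1 - t : ℝ) * Complex.log (z / turn u))

lemma norm_sectorContract_le (u : ℝ) {z : ℂ} (hz : ‖z‖ ≤ 1) {t : ℝ} (ht : t ≤ 1) :
    ‖sectorContract u z t‖ ≤ 1 := by
  rw [sectorContract, norm_mul, norm_turn, one_mul, Complex.norm_exp]
  simp only [Complex.re_ofReal_mul, Complex.log_re, norm_div, norm_turn, div_one]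
  rw [Real.exp_le_one_iff]
  exact mul_nonpos_of_nonneg_of_nonpos (by linarith) (Real.log_nonpos (norm_nonneg _) hz)

/-- In logarithmic polar coordinates about the direction `u` the contraction is multiplication by `1
- t`. It preserves the unit circle and shrinks angles linearly there, which makes it compatible with
affine gluings of arcs. -/
lemma sectorContract_polar {u ρ a : ℝ} (hρ : 0 < ρ) (ha : |a| < 1 / 2) (t : ℝ) :
    sectorContract u (ρ * turn (u + a)) t = (ρ ^ (1 - t) : ℝ) * turn (u + (1 - t) * a) := by
  have hne : (ρ : ℂ) * turn a ≠ 0 := mul_ne_zero (by exact_mod_cast hρ.ne') (turn_ne_zero _)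
  have h1 : (ρ : ℂ) * turn (u + a) / turn u = ρ * turn a := by
    rw [turn_add]; field_simp [turn_ne_zero u]
  rw [sectorContract, h1, Complex.log, arg_turn hρ ha]
  simp only [norm_mul, norm_turn, mul_one, Complex.norm_real, Real.norm_eq_abs, abs_of_pos hρ]
  rw [turn_add, mul_add, Complex.exp_add, Real.rpow_def_of_pos hρ]
  rw [turn, turn]
  push_cast
  ring_nf

lemma mem_slitPlane_of_polar {u ρ a : ℝ} (hρ : 0 < ρ) (ha : |a| < 1 / 2) :
    (ρ : ℂ) * turn (u + a) / turn u ∈ Complex.slitPlane := by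
  have hne : (ρ : ℂ) * turn a ≠ 0 := mul_ne_zero (by exact_mod_cast hρ.ne') (turn_ne_zero _)
  have h1 : (ρ : ℂ) * turn (u + a) / turn u = ρ * turn a := by
    rw [turn_add]; field_simp [turn_ne_zero u]
  rw [h1, Complex.mem_slitPlane_iff_arg, arg_turn hρ ha]
  refine ⟨?_, hne⟩
  have := Real.pi_pos
  rw [abs_lt] at ha
  nlinarith [ha.2]

/-- The open sector of half-width `ω` about the direction `u`. -/
def sector (u ω : ℝ) : Set ℂ := {z | ∃ ρ a : ℝ, 0 < ρ ∧ |a| < ω ∧ z = ρ * turn (u + a)}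

lemma isOpen_sector {u ω : ℝ} (hω : ω ≤ 1 / 2) : IsOpen (sector u ω) := by
  have : sector u ω = (fun z => z / turn u) ⁻¹'
      {w | w ∈ Complex.slitPlane ∧ |w.arg| < 2 * Real.pi * ω} := by
    have hpi := Real.pi_pos
    ext z
    constructor
    · rintro ⟨ρ, a, hρ, ha, rfl⟩
      refine ⟨mem_slitPlane_of_polar hρ (ha.trans_le hω), ?_⟩
      have h1 : (ρ : ℂ) * turn (u + a) / turn u = ρ * turn a := by
        rw [turn_add]; field_simp [turn_ne_zero u]
      change |((ρ : ℂ) * turn (u + a) / turn u).arg| < 2 * Real.pi * ω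
      rw [h1, arg_turn hρ (ha.trans_le hω), abs_mul, abs_of_pos (by positivity)]
      gcongr
    · rintro ⟨hs, ha⟩
      have hz : z ≠ 0 := by
        rintro rfl
        simp at hs
      obtain ⟨t, ht, hzt⟩ := exists_polar z (u - 1 / 2)
      refine ⟨‖z‖, t - u, norm_pos_iff.2 hz, ?_, by rw [add_sub_cancel]; exact hzt⟩
      have h1 : z / turn u = ‖z‖ * turn (t - u) := by
        rw [div_eq_iff (turn_ne_zero u), mul_assoc, ← turn_add, sub_add_cancel]
        exact hzt
      have hlt : |t - u| < 1 / 2 := by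
        rw [abs_lt]
        refine ⟨lt_of_le_of_ne (by linarith [ht.1]) ?_, by linarith [ht.2]⟩
        intro h
        simp only at hs
        rw [h1, ← h] at hs
        have : turn (-(1 / 2)) = -1 := by
          rw [turn, ← Complex.exp_neg_pi_mul_I]
          push_cast; ring_nf
        rw [this, Complex.mem_slitPlane_iff] at hs
        simp at hs
        linarith [norm_nonneg z]
      simp only at ha
      rw [h1, arg_turn (norm_pos_iff.2 hz) hlt, abs_mul, abs_of_pos (by positivity)] at ha
      exact lt_of_mul_lt_mul_left ha (by positivity)
  rw [this]
  refine IsOpen.preimage (continuous_id.div_const _) ?_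
  rw [isOpen_iff_mem_nhds]
  rintro w ⟨hw, hwa⟩
  filter_upwards [Complex.isOpen_slitPlane.mem_nhds hw,
    ((Complex.continuousAt_arg hw).abs.eventually_lt continuousAt_const hwa)] with v hv hv'
  exact ⟨hv, hv'⟩

lemma continuousOn_sectorContract {u ω : ℝ} (hω : ω ≤ 1 / 2) :
    ContinuousOn (fun p : ℂ × ℝ => sectorContract u p.1 p.2) (sector u ω ×ˢ univ) := by
  rintro ⟨z, t⟩ ⟨⟨ρ, a, hρ, ha, rfl⟩, -⟩
  refine ContinuousAt.continuousWithinAt ?_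
  have hs := mem_slitPlane_of_polar (u := u) hρ (ha.trans_le hω)
  unfold sectorContract
  refine continuousAt_const.mul (Complex.continuous_exp.continuousAt.comp (ContinuousAt.mul ?_ ?_))
  · fun_prop
  · exact ContinuousAt.clog (by fun_prop) hs

end Turn

/-! ### The disc, its sides and the quotient surface -/

section Model

/-- The closed unit disc. -/
abbrev Disc : Type := Metric.closedBall (0 : ℂ) 1

instance : ContractibleSpace Disc :=
  (convex_closedBall (0 : ℂ) 1).contractibleSpace ⟨0, by simp⟩

lemma Disc.norm_le (x : Disc) : ‖(x : ℂ)‖ ≤ 1 := mem_closedBall_zero_iff.1 x.2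

/-- The centre of the disc. -/
def Disc.zero : Disc := ⟨0, by simp⟩

/-- The point of the boundary circle of the disc at angle `t`, measured in full turns. -/
def Disc.turn (t : ℝ) : Disc := ⟨SurfaceRep.turn t, by simp⟩

lemma Disc.continuous_turn : Continuous Disc.turn := by unfold Disc.turn; fun_prop

lemma Disc.turn_eq_turn_iff {a b : ℝ} : Disc.turn a = Disc.turn b ↔ ∃ n : ℤ, a = b + n := by
  rw [Disc.turn, Disc.turn, Subtype.mk.injEq, SurfaceRep.turn_eq_turn_iff]

/-- The ratio of the length of a side to the distance of the initial points of consecutive sides. -/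
def sideLen (r : ℕ) : ℝ := if r = 0 then 1 else 1 / 2

lemma sideLen_pos (r : ℕ) : 0 < sideLen r := by unfold sideLen; split_ifs <;> norm_num

lemma sideLen_le (r : ℕ) : sideLen r ≤ 1 := by unfold sideLen; split_ifs <;> norm_num

/-- The point with parameter `s` on the `k`-th side. -/
def side (g r k : ℕ) (s : ℝ) : Disc := Disc.turn ((k + sideLen r * s) / numSides g r)

lemma coe_side (g r k : ℕ) (s : ℝ) : (side g r k s : ℂ) = sidePoint g r k s := rfl

lemma continuous_side (g r k : ℕ) : Continuous (side g r k) :=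
  Disc.continuous_turn.comp (by fun_prop)

lemma partner_lt {g r k : ℕ} (h : k < numSides g r) : partner g k < numSides g r := by
  unfold partner numSides at *
  split_ifs <;> omega

lemma partner_partner {g r k : ℕ} (_h : k < numSides g r) : partner g (partner g k) = k := by
  unfold partner numSides at *
  split_ifs <;> omega

lemma partner_ne {g r k : ℕ} (_h : k < numSides g r) : partner g k ≠ k := by
  unfold partner numSides at *
  split_ifs <;> omega

/-- The part of the gluing relation that glues the `k`-th side. -/
def glueAt (g r k : ℕ) (x y : Disc) : Prop :=
  k < numSides g r ∧ ∃ s ∈ Icc (0 : ℝ) 1, x = side g r k s ∧ y = side g r (partner g k) (1 - s)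

lemma glue_iff {g r : ℕ} {x y : Disc} : glue g r x y ↔ ∃ k, glueAt g r k x y := by
  simp only [glue, glueAt, Subtype.ext_iff, coe_side]

lemma glueAt_symm {g r k : ℕ} {x y : Disc} (h : glueAt g r k x y) :
    glueAt g r (partner g k) y x := by
  obtain ⟨hk, s, hs, rfl, rfl⟩ := h
  exact ⟨partner_lt hk, 1 - s, ⟨by linarith [hs.2], by linarith [hs.1]⟩, rfl, by
    rw [partner_partner hk]; congr 1; ring⟩

/-- The quotient map from the disc onto the surface. -/
def proj (g r : ℕ) : C(Disc, Model g r) := ⟨Quot.mk _, continuous_quot_mk⟩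

lemma isQuotientMap_proj (g r : ℕ) : IsQuotientMap (proj g r) := isQuotientMap_quot_mk

lemma proj_eq_of_glueAt {g r k : ℕ} {x y : Disc} (h : glueAt g r k x y) :
    proj g r x = proj g r y := Quot.sound (glue_iff.2 ⟨k, h⟩)

lemma proj_eq_iff {g r : ℕ} {x y : Disc} (h : proj g r x = proj g r y) :
    Relation.EqvGen (fun x y => ∃ k, glueAt g r k x y) x y := by
  have := Quot.eqvGen_exact h
  convert this using 2
  ext x
  exact glue_iff.symm

lemma proj_side {g r k : ℕ} (hk : k < numSides g r) {s : ℝ} (hs : s ∈ Icc (0 : ℝ) 1) :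
    proj g r (side g r k s) = proj g r (side g r (partner g k) (1 - s)) :=
  proj_eq_of_glueAt ⟨hk, s, hs, rfl, rfl⟩

instance (g r : ℕ) : PathConnectedSpace (Model g r) :=
  (isQuotientMap_proj g r).surjective.pathConnectedSpace (proj g r).continuous

/-- The base point of the surface. -/
abbrev base (g r : ℕ) : Model g r := proj g r Disc.zero

/-- The loop that leaves the disc through the `k`-th side at parameter `s`. -/
def sideLoopAt (g r : ℕ) {k : ℕ} (hk : k < numSides g r) {s : ℝ} (hs : s ∈ Icc (0 : ℝ) 1) :
    FundamentalGroup (Model g r) (base g r) :=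
  hop (proj g r) Disc.zero _ _ (proj_side hk hs)

/-- The loop that leaves the disc through the middle of the `k`-th side. -/
def sideLoop (g r k : ℕ) : FundamentalGroup (Model g r) (base g r) :=
  if hk : k < numSides g r then sideLoopAt g r hk (s := 1 / 2) (by norm_num) else 1

lemma sideLoopAt_eq {g r k : ℕ} (hk : k < numSides g r) {s : ℝ} (hs : s ∈ Icc (0 : ℝ) 1) :
    sideLoopAt g r hk hs = sideLoop g r k := by
  rw [sideLoop, dif_pos hk]
  let f : I → ℝ := fun t => (1 - t) * s + t * (1 / 2)
  have hf : Continuous f := by fun_prop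
  have hfm : ∀ t, f t ∈ Icc (0 : ℝ) 1 := fun t =>
    (convex_Icc (0 : ℝ) 1) hs (by norm_num : (1 / 2 : ℝ) ∈ Icc (0 : ℝ) 1)
      (by linarith [t.2.2]) t.2.1 (by ring)
  have h0 : f 0 = s := by simp [f]
  have h1 : f 1 = 1 / 2 := by simp [f]
  let γ : Path (side g r k s) (side g r k (1 / 2)) :=
    { toFun := fun t => side g r k (f t)
      continuous_toFun := (continuous_side g r k).comp hf
      source' := by rw [h0]
      target' := by rw [h1] }
  let δ : Path (side g r (partner g k) (1 - s)) (side g r (partner g k) (1 - 1 / 2)) :=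
    { toFun := fun t => side g r (partner g k) (1 - f t)
      continuous_toFun := (continuous_side g r _).comp (by fun_prop)
      source' := by rw [h0]
      target' := by rw [h1] }
  exact hop_congr (proj g r) Disc.zero γ δ (fun t => proj_side hk (hfm t))

lemma sideLoop_partner {g r k : ℕ} (hk : k < numSides g r) :
    sideLoop g r (partner g k) = (sideLoop g r k)⁻¹ := by
  have h12 : (1 - 1 / 2 : ℝ) ∈ Icc (0 : ℝ) 1 := by norm_num
  rw [← sideLoopAt_eq (partner_lt hk) h12, sideLoop, dif_pos hk]
  refine Eq.trans ?_ (hop_symm (proj g r) Disc.zero _ _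
    (proj_side hk (s := 1 / 2) (by norm_num)))
  have : side g r (partner g (partner g k)) (1 - (1 - 1 / 2)) = side g r k (1 / 2) := by
    rw [partner_partner hk]; norm_num
  have key : ∀ z (hz : z = side g r k (1 / 2))
      (h : proj g r (side g r (partner g k) (1 - 1 / 2)) = proj g r z)
      (h' : proj g r (side g r (partner g k) (1 - 1 / 2)) = proj g r (side g r k (1 / 2))),
      hop (proj g r) Disc.zero _ z h = hop (proj g r) Disc.zero _ (side g r k (1 / 2)) h' := by
    rintro _ rfl _ _; rfl
  exact key _ this _ _

lemma numSides_even_zero {g : ℕ} : numSides g 0 = 4 * g := by simp [numSides]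

/-- The union of the sides is closed. -/
lemma isClosed_sides (g r : ℕ) :
    IsClosed {x : Disc | ∃ k < numSides g r, ∃ s ∈ Icc (0 : ℝ) 1, x = side g r k s} := by
  have : {x : Disc | ∃ k < numSides g r, ∃ s ∈ Icc (0 : ℝ) 1, x = side g r k s} =
      ⋃ k ∈ Finset.range (numSides g r), side g r k '' Icc (0 : ℝ) 1 := by
    ext x
    simp only [Finset.mem_range, mem_iUnion, mem_image, exists_prop]
    exact exists_congr fun k => and_congr_right fun _ => exists_congr fun s =>
      and_congr_right fun _ => eq_comm
  rw [this]
  exact (Finset.isCompact_biUnion _ fun k _ =>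
    isCompact_Icc.image (continuous_side g r k)).isClosed

/-- The sector of half-width `1/2` about position `j + γ`, positions being counted in units of
`1 / numSides g r` full turns. -/
def discSector (g r : ℕ) (γ : ℝ) (j : ℕ) : Set Disc :=
  Subtype.val ⁻¹' sector ((j + γ) / numSides g r) (1 / 2 / numSides g r)

lemma half_div_le {m : ℕ} (hm : 0 < m) : (1 / 2 / m : ℝ) ≤ 1 / 2 := by
  have : (1 : ℝ) ≤ m := by exact_mod_cast hm
  rw [div_le_iff₀ (by linarith)]
  linarith

lemma isOpen_discSector {g r : ℕ} (hm : 0 < numSides g r) (γ : ℝ) (j : ℕ) :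
    IsOpen (discSector g r γ j) :=
  (isOpen_sector (half_div_le hm)).preimage continuous_subtype_val

/-- The point of `discSector` in polar coordinates. -/
lemma mem_discSector {g r : ℕ} (hm : 0 < numSides g r) {γ : ℝ} {j : ℕ} {x : Disc} :
    x ∈ discSector g r γ j ↔
      ∃ ρ a : ℝ, 0 < ρ ∧ |a| < 1 / 2 ∧ (x : ℂ) = ρ * turn ((j + γ + a) / numSides g r) := by
  have hm' : (0 : ℝ) < numSides g r := by exact_mod_cast hm
  constructor
  · rintro ⟨ρ, a, hρ, ha, hx⟩
    refine ⟨ρ, a * numSides g r, hρ, ?_, ?_⟩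
    · rw [abs_mul, abs_of_pos hm']
      rwa [lt_div_iff₀ hm'] at ha
    · rw [hx]; congr 2; field_simp
  · rintro ⟨ρ, a, hρ, ha, hx⟩
    refine ⟨ρ, a / numSides g r, hρ, ?_, ?_⟩
    · rw [abs_div, abs_of_pos hm']
      gcongr
    · rw [hx]; congr 2; field_simp

/-- Two boundary positions at the same point differ by a multiple of the number of sides. -/
lemma turn_div_eq {m : ℕ} (hm : 0 < m) {a b : ℝ} (h : turn (a / m) = turn (b / m)) :
    ∃ n : ℤ, a = b + n * m := by
  have hm' : (0 : ℝ) < m := by exact_mod_cast hm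
  obtain ⟨n, hn⟩ := turn_eq_turn_iff.1 h
  refine ⟨n, ?_⟩
  field_simp at hn
  linarith

lemma turn_div_add {m : ℕ} (hm : 0 < m) (a : ℝ) (n : ℤ) :
    turn ((a + n * m) / m) = turn (a / m) := by
  have hm' : (0 : ℝ) < m := by exact_mod_cast hm
  rw [add_div, mul_div_assoc, div_self hm'.ne', mul_one, turn_add_int]

/-- An integer of absolute value below one is zero, and two indices below `m` are congruent modulo
`m` only if they are equal. -/
lemma int_mul_eq_zero_of_abs_lt {i j m : ℕ} (hi : i < m) (hj : j < m) {n : ℤ}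
    (h : |(i : ℝ) - j - n * m| < 1) : i = j := by
  have h' : |(i : ℤ) - j - n * m| < 1 := by exact_mod_cast h
  rw [Int.abs_lt_one_iff] at h'
  have : n = 0 := by
    by_contra hn
    rcases lt_or_gt_of_ne hn with hn | hn
    · have : n ≤ -1 := by omega
      nlinarith
    · have : 1 ≤ n := by omega
      nlinarith
  subst this
  omega

lemma discSector_disjoint {g r : ℕ} (hm : 0 < numSides g r) {γ : ℝ} {i j : ℕ}
    (hi : i < numSides g r) (hj : j < numSides g r) {x : Disc}
    (hxi : x ∈ discSector g r γ i) (hxj : x ∈ discSector g r γ j) : i = j := by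
  rw [mem_discSector hm] at hxi hxj
  obtain ⟨ρ, a, hρ, ha, hx⟩ := hxi
  obtain ⟨ρ', a', hρ', ha', hx'⟩ := hxj
  rw [hx] at hx'
  obtain ⟨n, hn⟩ := (polar_eq hρ hρ'.le hx').2
  obtain ⟨n, hn⟩ := turn_div_eq hm (turn_eq_turn_iff.2 ⟨n, hn⟩)
  refine int_mul_eq_zero_of_abs_lt hi hj (n := n) ?_
  have : (i : ℝ) - j - n * numSides g r = a' - a := by linarith
  rw [this, abs_lt]
  rw [abs_lt] at ha ha'
  constructor <;> linarith [ha.1, ha.2, ha'.1, ha'.2]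

/-- The contraction of sectors as a map of the disc. -/
def discContract (u : ℝ) (x : Disc) (t : I) : Disc :=
  ⟨sectorContract u x t, by simpa using norm_sectorContract_le u x.norm_le t.2.2⟩

open Classical in
/-- A union of sectors about positions `j + γ`, where `P j`, with its index function. -/
def sectorIdx (g r : ℕ) (γ : ℝ) (P : ℕ → Prop) (x : Disc) : ℕ :=
  if h : ∃ j, P j ∧ x ∈ discSector g r γ j then h.choose else 0

lemma sectorIdx_eq {g r : ℕ} (hm : 0 < numSides g r) {γ : ℝ} {P : ℕ → Prop}
    (hP : ∀ j, P j → j < numSides g r) {x : Disc} {j : ℕ} (hj : P j)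
    (hx : x ∈ discSector g r γ j) : sectorIdx g r γ P x = j := by
  have h : ∃ j, P j ∧ x ∈ discSector g r γ j := ⟨j, hj, hx⟩
  rw [sectorIdx, dif_pos h]
  exact discSector_disjoint hm (hP _ h.choose_spec.1) (hP _ hj) h.choose_spec.2 hx

end Model

/-! ### Contractible patches around sides and corners -/

section Charts

variable {g r : ℕ}

lemma turn_mem_discSector (hm : 0 < numSides g r) {γ a : ℝ} {j : ℕ} (ha : |a| < 1 / 2) :
    Disc.turn ((j + γ + a) / numSides g r) ∈ discSector g r γ j :=
  (mem_discSector hm).2 ⟨1, a, one_pos, ha, by simp [Disc.turn]⟩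

lemma exists_of_turn_mem_discSector (hm : 0 < numSides g r) {γ b : ℝ} {j : ℕ}
    (h : Disc.turn (b / numSides g r) ∈ discSector g r γ j) :
    ∃ (a : ℝ) (n : ℤ), |a| < 1 / 2 ∧ b = j + γ + a + n * numSides g r := by
  obtain ⟨ρ, a, hρ, ha, hx⟩ := (mem_discSector hm).1 h
  have hx' : ((1 : ℝ) : ℂ) * turn (b / numSides g r) = ρ * turn ((j + γ + a) / numSides g r) := by
    simpa [Disc.turn] using hx
  obtain ⟨n, hn⟩ := turn_div_eq hm (turn_eq_turn_iff.2 (polar_eq one_pos hρ.le hx').2)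
  exact ⟨a, n, ha, hn⟩

lemma discContract_turn (hm : 0 < numSides g r) {γ a : ℝ} {j : ℕ} (ha : |a| < 1 / 2) (t : I) :
    discContract ((j + γ) / numSides g r) (Disc.turn ((j + γ + a) / numSides g r)) t =
      Disc.turn ((j + γ + (1 - t) * a) / numSides g r) := by
  have hm' : (1 : ℝ) ≤ numSides g r := by exact_mod_cast hm
  have ha' : |a / numSides g r| < 1 / 2 := by
    rw [abs_div, abs_of_pos (by linarith : (0 : ℝ) < numSides g r)]
    exact (div_le_self (abs_nonneg _) hm').trans_lt ha
  have := sectorContract_polar (u := (j + γ) / numSides g r) one_pos ha' t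
  refine Subtype.ext ?_
  simp only [discContract, Disc.turn]
  rw [Complex.ofReal_one, one_mul, Real.one_rpow, Complex.ofReal_one, one_mul] at this
  rw [show ((j : ℝ) + γ + a) / numSides g r = (j + γ) / numSides g r + a / numSides g r by ring,
    this]
  congr 1
  ring

lemma discContract_zero (hm : 0 < numSides g r) {γ : ℝ} {j : ℕ} {x : Disc}
    (hx : x ∈ discSector g r γ j) : discContract ((j + γ) / numSides g r) x 0 = x := by
  obtain ⟨ρ, a, hρ, ha, hx⟩ := hx
  have := sectorContract_polar (u := (j + γ) / numSides g r) hρ (ha.trans_le (half_div_le hm)) 0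
  refine Subtype.ext ?_
  simp only [discContract]
  rw [hx]
  simpa using this

lemma discContract_one (hm : 0 < numSides g r) {γ : ℝ} {j : ℕ} {x : Disc}
    (hx : x ∈ discSector g r γ j) : discContract ((j + γ) / numSides g r) x 1 =
      Disc.turn ((j + γ) / numSides g r) := by
  obtain ⟨ρ, a, hρ, ha, hx⟩ := hx
  have := sectorContract_polar (u := (j + γ) / numSides g r) hρ (ha.trans_le (half_div_le hm)) 1
  refine Subtype.ext ?_
  simp only [discContract, Disc.turn]
  rw [hx]
  simpa using this

/-- A family of sectors that is compatible with the gluing. -/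
structure SectorChart (g r : ℕ) where
  /-- The offset of the centres of the sectors. -/
  γ : ℝ
  /-- The sectors that belong to the chart. -/
  P : ℕ → Prop
  lt : ∀ j, P j → j < numSides g r
  compat : ∀ k x y, glueAt g r k x y → ∀ i, P i → x ∈ discSector g r γ i →
    ∃ j, P j ∧ y ∈ discSector g r γ j ∧ ∀ t,
      proj g r (discContract ((i + γ) / numSides g r) x t) =
        proj g r (discContract ((j + γ) / numSides g r) y t)
  center : ∀ i j, P i → P j → proj g r (Disc.turn ((i + γ) / numSides g r)) =
    proj g r (Disc.turn ((j + γ) / numSides g r))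

namespace SectorChart

variable (C : SectorChart g r)

/-- The union of the sectors of a chart. -/
def domain : Set Disc := ⋃ j ∈ {j | C.P j}, discSector g r C.γ j

/-- The index of the sector that contains a point. -/
def idx : Disc → ℕ := sectorIdx g r C.γ C.P

/-- The contraction of the chart. -/
def contract (x : Disc) (t : I) : Disc :=
  discContract ((C.idx x + C.γ) / numSides g r) x t

lemma mem_domain {x : Disc} : x ∈ C.domain ↔ ∃ j, C.P j ∧ x ∈ discSector g r C.γ j := by
  simp only [domain, mem_iUnion, exists_prop]
  exact Iff.rfl

lemma isOpen_domain (hm : 0 < numSides g r) : IsOpen C.domain :=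
  isOpen_biUnion fun _ _ => isOpen_discSector hm _ _

lemma idx_eq (hm : 0 < numSides g r) {x : Disc} {j : ℕ} (hj : C.P j)
    (hx : x ∈ discSector g r C.γ j) : C.idx x = j := sectorIdx_eq hm C.lt hj hx

lemma mem_domain_iff {k : ℕ} {x y : Disc} (h : glueAt g r k x y) :
    x ∈ C.domain ↔ y ∈ C.domain := by
  constructor
  · rw [mem_domain, mem_domain]
    rintro ⟨i, hi, hx⟩
    obtain ⟨j, hj, hy, -⟩ := C.compat k x y h i hi hx
    exact ⟨j, hj, hy⟩
  · rw [mem_domain, mem_domain]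
    rintro ⟨i, hi, hx⟩
    obtain ⟨j, hj, hy, -⟩ := C.compat _ y x (glueAt_symm h) i hi hx
    exact ⟨j, hj, hy⟩

lemma eventually_idx (hm : 0 < numSides g r) {x : Disc} (hx : x ∈ C.domain) :
    ∀ᶠ z in 𝓝 x, C.idx z = C.idx x := by
  obtain ⟨i, hi, hx⟩ := C.mem_domain.1 hx
  filter_upwards [(isOpen_discSector hm C.γ i).mem_nhds hx] with z hz
  rw [C.idx_eq hm hi hz, C.idx_eq hm hi hx]

lemma continuousOn_contract (hm : 0 < numSides g r) :
    ContinuousOn (Function.uncurry C.contract) (C.domain ×ˢ univ) := by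
  rintro ⟨x, t⟩ ⟨hx, -⟩
  obtain ⟨i, hi, hx⟩ := C.mem_domain.1 hx
  refine ContinuousAt.continuousWithinAt ?_
  have hopen := isOpen_discSector hm C.γ i
  have h1 : ContinuousAt (fun p : Disc × I => discContract ((i + C.γ) / numSides g r) p.1 p.2)
      (x, t) := by
    rw [Topology.IsInducing.subtypeVal.continuousAt_iff]
    have h2 := (continuousOn_sectorContract (u := (i + C.γ) / numSides g r)
      (half_div_le hm)).continuousAt (x := ((x : ℂ), (t : ℝ)))
      (((isOpen_sector (half_div_le hm)).prod isOpen_univ).mem_nhds ⟨hx, mem_univ _⟩)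
    have h3 : Continuous (fun p : Disc × I => ((p.1 : ℂ), (p.2 : ℝ))) := by fun_prop
    exact ContinuousAt.comp (f := fun p : Disc × I => ((p.1 : ℂ), (p.2 : ℝ))) (x := (x, t)) h2
      h3.continuousAt
  refine h1.congr ?_
  filter_upwards [(hopen.prod isOpen_univ).mem_nhds ⟨hx, mem_univ t⟩] with p hp
  simp only [Function.uncurry, contract]
  rw [C.idx_eq hm hi hp.1]

lemma contract_zero (hm : 0 < numSides g r) {x : Disc} (hx : x ∈ C.domain) :
    C.contract x 0 = x := by
  obtain ⟨i, hi, hx⟩ := C.mem_domain.1 hx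
  rw [contract, C.idx_eq hm hi hx, discContract_zero hm hx]

lemma proj_contract (hm : 0 < numSides g r) {k : ℕ} {x y : Disc} (h : glueAt g r k x y)
    (hx : x ∈ C.domain) (t : I) : proj g r (C.contract x t) = proj g r (C.contract y t) := by
  obtain ⟨i, hi, hx⟩ := C.mem_domain.1 hx
  obtain ⟨j, hj, hy, hc⟩ := C.compat k x y h i hi hx
  rw [contract, contract, C.idx_eq hm hi hx, C.idx_eq hm hj hy, hc]

lemma proj_contract_one (hm : 0 < numSides g r) {x y : Disc}
    (hx : x ∈ C.domain) (hy : y ∈ C.domain) :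
    proj g r (C.contract x 1) = proj g r (C.contract y 1) := by
  obtain ⟨i, hi, hx⟩ := C.mem_domain.1 hx
  obtain ⟨j, hj, hy⟩ := C.mem_domain.1 hy
  rw [contract, contract, C.idx_eq hm hi hx, C.idx_eq hm hj hy, discContract_one hm hx,
    discContract_one hm hy, C.center i j hi hj]

end SectorChart

lemma side_eq_turn (k : ℕ) (s : ℝ) : side g r k s =
    Disc.turn ((k + sideLen r / 2 + sideLen r * (s - 1 / 2)) / numSides g r) := by
  rw [side]; congr 2; ring

lemma abs_sideLen_mul_le {s : ℝ} (hs : s ∈ Icc (0 : ℝ) 1) : |sideLen r * (s - 1 / 2)| ≤ 1 / 2 := by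
  have h1 := sideLen_pos r
  have h2 := sideLen_le r
  rw [abs_le]
  constructor <;> nlinarith [hs.1, hs.2]

/-- The side through a point of a sector about the middle of a side. -/
lemma eq_of_side_mem_discSector (hm : 0 < numSides g r) {i k : ℕ} (hi : i < numSides g r)
    (hk : k < numSides g r) {s : ℝ} (hs : s ∈ Icc (0 : ℝ) 1)
    (h : side g r k s ∈ discSector g r (sideLen r / 2) i) :
    k = i ∧ |sideLen r * (s - 1 / 2)| < 1 / 2 := by
  rw [side_eq_turn] at h
  obtain ⟨a, n, ha, hn⟩ := exists_of_turn_mem_discSector hm h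
  have h1 := abs_sideLen_mul_le (r := r) hs
  have : k = i := by
    refine int_mul_eq_zero_of_abs_lt hk hi (n := n) ?_
    have : (k : ℝ) - i - n * numSides g r = a - sideLen r * (s - 1 / 2) := by linarith
    rw [this]
    rw [abs_le] at h1
    rw [abs_lt] at ha ⊢
    constructor <;> linarith [ha.1, ha.2, h1.1, h1.2]
  subst this
  refine ⟨rfl, ?_⟩
  have h2 : sideLen r * (s - 1 / 2) = a + n * numSides g r := by linarith
  have hn0 : n = 0 := by
    have h3 : |(n : ℝ) * numSides g r| < 1 := by
      have : (n : ℝ) * numSides g r = sideLen r * (s - 1 / 2) - a := by linarith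
      rw [this]
      rw [abs_le] at h1
      rw [abs_lt] at ha ⊢
      constructor <;> linarith [ha.1, ha.2, h1.1, h1.2]
    have h4 : |n * (numSides g r : ℤ)| < 1 := by exact_mod_cast h3
    rw [Int.abs_lt_one_iff, mul_eq_zero] at h4
    exact h4.resolve_right (by exact_mod_cast hm.ne')
  rw [h2, hn0]
  simpa using ha

/-- The chart around the `k`-th side and its partner. -/
def sideChart (g r : ℕ) {k₀ : ℕ} (hk₀ : k₀ < numSides g r) : SectorChart g r where
  γ := sideLen r / 2
  P j := j = k₀ ∨ j = partner g k₀
  lt := by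
    rintro j (rfl | rfl)
    exacts [hk₀, partner_lt hk₀]
  compat := by
    have hm : 0 < numSides g r := by omega
    rintro k x y ⟨hk, s, hs, rfl, rfl⟩ i hi hx
    have hilt : i < numSides g r := by
      rcases hi with rfl | rfl
      exacts [hk₀, partner_lt hk₀]
    obtain ⟨rfl, ha⟩ := eq_of_side_mem_discSector hm hilt hk hs hx
    -- Passing to the partner side negates the offset from the middle, and the contraction scales
    -- offsets, so glued points stay glued.
    have ha' : |sideLen r * ((1 - s) - 1 / 2)| < 1 / 2 := by
      rw [show sideLen r * ((1 - s) - 1 / 2) = -(sideLen r * (s - 1 / 2)) by ring, abs_neg]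
      exact ha
    refine ⟨partner g k, ?_, ?_, fun t => ?_⟩
    · rcases hi with rfl | rfl
      · exact Or.inr rfl
      · exact Or.inl (partner_partner hk₀)
    · rw [side_eq_turn]
      exact turn_mem_discSector hm ha'
    · rw [side_eq_turn, side_eq_turn, discContract_turn hm ha, discContract_turn hm ha']
      have h1 : ∀ (k : ℕ) (s : ℝ), Disc.turn ((k + sideLen r / 2 +
          (1 - t) * (sideLen r * (s - 1 / 2))) / numSides g r) =
          side g r k (1 / 2 + (1 - t) * (s - 1 / 2)) := by
        intro k s; rw [side]; congr 2; ring
      rw [h1, h1]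
      have h2 : 1 / 2 + (1 - (t : ℝ)) * (1 - s - 1 / 2) =
          1 - (1 / 2 + (1 - (t : ℝ)) * (s - 1 / 2)) := by ring
      rw [h2]
      refine proj_side hk ?_
      have h3 : |(1 - (t : ℝ)) * (s - 1 / 2)| ≤ 1 * (1 / 2) := by
        rw [abs_mul]
        refine mul_le_mul ?_ ?_ (abs_nonneg _) zero_le_one
        · rw [abs_le]; constructor <;> linarith [t.2.1, t.2.2]
        · rw [abs_le]; constructor <;> linarith [hs.1, hs.2]
      rw [abs_le] at h3
      constructor <;> linarith [h3.1, h3.2]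
  center := by
    have key : proj g r (Disc.turn ((k₀ + sideLen r / 2) / numSides g r)) =
        proj g r (Disc.turn ((partner g k₀ + sideLen r / 2) / numSides g r)) := by
      have := proj_side hk₀ (s := 1 / 2) (by norm_num)
      rw [side, side, mul_one_div, show (1 - 1 / 2 : ℝ) = 1 / 2 by norm_num, mul_one_div] at this
      exact this
    rintro i j (rfl | rfl) (rfl | rfl)
    exacts [rfl, key, key.symm, rfl]

/-- The corners of the polygon are identified. -/
lemma proj_corner_succ {g k : ℕ} (hk : k < numSides g 0) :
    proj g 0 (Disc.turn (k / numSides g 0)) =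
      proj g 0 (Disc.turn (((partner g k + 1 : ℕ) : ℝ) / numSides g 0)) := by
  have := proj_side hk (s := 0) (by norm_num)
  rw [side, side] at this
  convert this using 4 <;> simp [sideLen]

/-- The initial corner of a side is glued to the final corner of its partner. Within a handle this
links the corners `4i`, `4i+3`, `4i+2`, `4i+1`, `4(i+1)` in this order, so consecutive handles share
one vertex. -/
lemma proj_corner {g : ℕ} {k : ℕ} (hk : k < numSides g 0) :
    proj g 0 (Disc.turn (k / numSides g 0)) = proj g 0 (Disc.turn 0) := by
  have hn : numSides g 0 = 4 * g := numSides_even_zero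
  have h3 : ∀ i < g, proj g 0 (Disc.turn ((4 * i : ℕ) / numSides g 0)) =
      proj g 0 (Disc.turn ((4 * i + 3 : ℕ) / numSides g 0)) := by
    intro i hi
    have := proj_corner_succ (g := g) (k := 4 * i) (by omega)
    rwa [show partner g (4 * i) = 4 * i + 2 by unfold partner; split_ifs <;> omega] at this
  have h2 : ∀ i < g, proj g 0 (Disc.turn ((4 * i + 3 : ℕ) / numSides g 0)) =
      proj g 0 (Disc.turn ((4 * i + 2 : ℕ) / numSides g 0)) := by
    intro i hi
    have := proj_corner_succ (g := g) (k := 4 * i + 3) (by omega)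
    rwa [show partner g (4 * i + 3) = 4 * i + 1 by unfold partner; split_ifs <;> omega] at this
  have h1 : ∀ i < g, proj g 0 (Disc.turn ((4 * i + 2 : ℕ) / numSides g 0)) =
      proj g 0 (Disc.turn ((4 * i + 1 : ℕ) / numSides g 0)) := by
    intro i hi
    have := proj_corner_succ (g := g) (k := 4 * i + 2) (by omega)
    rwa [show partner g (4 * i + 2) = 4 * i by unfold partner; split_ifs <;> omega] at this
  have h4 : ∀ i < g, proj g 0 (Disc.turn ((4 * i + 1 : ℕ) / numSides g 0)) =
      proj g 0 (Disc.turn ((4 * (i + 1) : ℕ) / numSides g 0)) := by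
    intro i hi
    have := proj_corner_succ (g := g) (k := 4 * i + 1) (by omega)
    rwa [show partner g (4 * i + 1) = 4 * i + 3 by unfold partner; split_ifs <;> omega] at this
  have h0 : ∀ i < g, proj g 0 (Disc.turn ((4 * i : ℕ) / numSides g 0)) =
      proj g 0 (Disc.turn 0) := by
    intro i
    induction i with
    | zero => intro _; simp
    | succ i ih =>
      intro hi
      have hi' : i < g := by omega
      rw [← h4 i hi', ← h1 i hi', ← h2 i hi', ← h3 i hi', ih hi']
  have hi : k / 4 < g := by omega
  rcases (by omega : k = 4 * (k / 4) ∨ k = 4 * (k / 4) + 1 ∨ k = 4 * (k / 4) + 2 ∨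
    k = 4 * (k / 4) + 3) with h | h | h | h <;> rw [h]
  · exact h0 _ hi
  · rw [← h1 _ hi, ← h2 _ hi, ← h3 _ hi, h0 _ hi]
  · rw [← h2 _ hi, ← h3 _ hi, h0 _ hi]
  · rw [← h3 _ hi, h0 _ hi]

lemma turn_mod {m : ℕ} (hm : 0 < m) (k : ℕ) (a : ℝ) :
    Disc.turn (((k % m : ℕ) + a) / m) = Disc.turn ((k + a) / m) := by
  have hm' : (m : ℝ) ≠ 0 := by exact_mod_cast hm.ne'
  rw [Disc.turn_eq_turn_iff]
  refine ⟨-((k / m : ℕ) : ℤ), ?_⟩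
  have : ((k % m : ℕ) : ℝ) + m * (k / m : ℕ) = k := by exact_mod_cast Nat.mod_add_div k m
  rw [← this, Int.cast_neg, Int.cast_natCast]
  field_simp
  ring

/-- A point of a side of the closed surface in a sector about a corner. -/
lemma corner_cases {g : ℕ} {i k : ℕ} (hi : i < numSides g 0)
    (hk : k < numSides g 0) {s : ℝ} (hs : s ∈ Icc (0 : ℝ) 1)
    (h : side g 0 k s ∈ discSector g 0 0 i) :
    (i = k ∧ s < 1 / 2) ∨ (i = (k + 1) % numSides g 0 ∧ 1 / 2 < s) := by
  have hm : 0 < numSides g 0 := by omega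
  rw [side, sideLen, if_pos rfl, one_mul] at h
  obtain ⟨a, n, ha, hn⟩ := exists_of_turn_mem_discSector hm h
  rw [abs_lt] at ha
  by_cases hs2 : s < 1 / 2
  · refine Or.inl ⟨?_, hs2⟩
    refine (int_mul_eq_zero_of_abs_lt hk hi (n := n) ?_).symm
    rw [show (k : ℝ) - i - n * numSides g 0 = a - s by linarith, abs_lt]
    constructor <;> linarith [ha.1, ha.2, hs.1, hs.2]
  · have h1 : |((k : ℤ) + 1 - i - n * numSides g 0 : ℤ)| < 1 := by
      have : |(k : ℝ) + 1 - i - n * numSides g 0| < 1 := by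
        rw [show (k : ℝ) + 1 - i - n * numSides g 0 = a + (1 - s) by linarith, abs_lt]
        constructor <;> linarith [ha.1, ha.2, hs.1, hs.2]
      exact_mod_cast this
    rw [Int.abs_lt_one_iff] at h1
    have hik : i = (k + 1) % numSides g 0 := by
      have h2 : ((k + 1 : ℕ) : ℤ) = i + numSides g 0 * n := by push_cast; linarith
      have h3 : (((k + 1) % numSides g 0 : ℕ) : ℤ) = i := by
        rw [Int.natCast_mod, h2, Int.add_mul_emod_self_left]
        exact_mod_cast Nat.mod_eq_of_lt hi
      exact_mod_cast h3.symm
    refine Or.inr ⟨hik, ?_⟩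
    have h5 : (k : ℝ) + 1 - i - n * numSides g 0 = 0 := by exact_mod_cast h1
    have : a = s - 1 := by linarith
    linarith [ha.1]

lemma side_zero_eq {g : ℕ} (k : ℕ) (s : ℝ) :
    side g 0 k s = Disc.turn ((k + 0 + s) / numSides g 0) := by
  rw [side, sideLen, if_pos rfl]; congr 2; ring

lemma side_zero_eq' {g : ℕ} (hm : 0 < numSides g 0) (k : ℕ) (s : ℝ) :
    side g 0 k s = Disc.turn ((((k + 1) % numSides g 0 : ℕ) + 0 + (s - 1)) / numSides g 0) := by
  rw [add_zero, turn_mod hm, side, sideLen, if_pos rfl]; congr 2; push_cast; ring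

/-- The chart around the corners of the polygon of the closed surface. -/
def cornerChart (g : ℕ) : SectorChart g 0 where
  γ := 0
  P j := j < numSides g 0
  lt := fun _ h => h
  compat := by
    rintro k x y ⟨hk, s, hs, rfl, rfl⟩ i hi hx
    have hm : 0 < numSides g 0 := by omega
    have hp := partner_lt hk
    -- The first half of side `k` lies in the sector of corner `k`, the second half in that of
    -- corner `k + 1` modulo the number of sides. The gluing reverses direction and so exchanges
    -- these two cases.
    rcases corner_cases hi hk hs hx with ⟨rfl, hs2⟩ | ⟨rfl, hs2⟩
    · have h1 : |s| < 1 / 2 := by rw [abs_lt]; constructor <;> linarith [hs.1]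
      have h2 : |(1 - s) - 1| < 1 / 2 := by rw [abs_lt]; constructor <;> linarith [hs.1]
      refine ⟨(partner g i + 1) % numSides g 0, Nat.mod_lt _ hm, ?_, fun t => ?_⟩
      · rw [side_zero_eq' hm]; exact turn_mem_discSector hm h2
      · rw [side_zero_eq, side_zero_eq' hm, discContract_turn hm h1, discContract_turn hm h2,
          ← side_zero_eq]
        rw [show (1 - (t : ℝ)) * (1 - s - 1) = (1 - (1 - t) * s) - 1 by ring, ← side_zero_eq' hm]
        refine proj_side hk ⟨?_, ?_⟩ <;> nlinarith [t.2.1, t.2.2, hs.1, hs.2]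
    · have h1 : |s - 1| < 1 / 2 := by rw [abs_lt]; constructor <;> linarith [hs.2]
      have h2 : |1 - s| < 1 / 2 := by rw [abs_lt]; constructor <;> linarith [hs.2]
      refine ⟨partner g k, hp, ?_, fun t => ?_⟩
      · rw [side_zero_eq]; exact turn_mem_discSector hm h2
      · rw [side_zero_eq' hm, side_zero_eq (partner g k), discContract_turn hm h1,
          discContract_turn hm h2, ← side_zero_eq (partner g k)]
        rw [show (1 - (t : ℝ)) * (s - 1) = (1 - (1 - t) * (1 - s)) - 1 by ring,
          ← side_zero_eq' hm]
        rw [proj_side hk (s := 1 - (1 - t) * (1 - s))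
          ⟨by nlinarith [t.2.1, t.2.2, hs.1, hs.2], by nlinarith [t.2.1, t.2.2, hs.1, hs.2]⟩]
        rw [sub_sub_cancel]
  center := by
    intro i j hi hj
    rw [add_zero, add_zero, proj_corner hi, proj_corner hj]

end Charts

/-! ### Generators of the surface group and homomorphisms with given values on them -/

section FundamentalGroupOfModel

variable {g r : ℕ}

/-- The points of the disc that lie on no side. -/
def offSides (g r : ℕ) : Set Disc :=
  {x : Disc | ∃ k < numSides g r, ∃ s ∈ Icc (0 : ℝ) 1, x = side g r k s}ᶜ

lemma isOpen_offSides (g r : ℕ) : IsOpen (offSides g r) := (isClosed_sides g r).isOpen_compl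

lemma notMem_offSides {k : ℕ} {x y : Disc} (h : glueAt g r k x y) : x ∉ offSides g r := by
  obtain ⟨hk, s, hs, rfl, rfl⟩ := h
  exact fun h => h ⟨k, hk, s, hs, rfl⟩

/-- The radial contraction of the disc. -/
def radialContract (x : Disc) (t : I) : Disc :=
  ⟨((1 - t : ℝ) : ℂ) * x, by
    rw [mem_closedBall_zero_iff, norm_mul, Complex.norm_real, Real.norm_eq_abs]
    have h1 : |1 - (t : ℝ)| ≤ 1 := by rw [abs_le]; constructor <;> linarith [t.2.1, t.2.2]
    exact mul_le_one₀ h1 (norm_nonneg _) x.norm_le⟩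

lemma continuous_radialContract : Continuous (Function.uncurry radialContract) := by
  unfold radialContract Function.uncurry
  fun_prop

/-- Every point on a side lies in a side chart, or in the corner chart of a closed surface. -/
lemma side_mem_chart {k : ℕ} (hk : k < numSides g r) {s : ℝ} (hs : s ∈ Icc (0 : ℝ) 1) :
    side g r k s ∈ (sideChart g r hk).domain ∨
      ∃ h : r = 0, side g r k s ∈ (h ▸ cornerChart g : SectorChart g r).domain := by
  have hm : 0 < numSides g r := by omega
  -- If there is boundary, a side has length `1/2` and the sector about its middle covers all of it.
  -- On a closed surface exactly the two ends are missed, and these are corners.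
  by_cases h : |sideLen r * (s - 1 / 2)| < 1 / 2
  · left
    rw [SectorChart.mem_domain]
    refine ⟨k, Or.inl rfl, ?_⟩
    rw [side_eq_turn]
    exact turn_mem_discSector hm h
  · right
    by_cases hr : r = 0
    · refine ⟨hr, ?_⟩
      subst hr
      rw [show sideLen 0 = 1 from if_pos rfl, one_mul] at h
      rw [SectorChart.mem_domain]
      by_cases hs2 : s < 1 / 2
      · refine ⟨k, hk, ?_⟩
        have h0 : s = 0 := by
          by_contra h0
          have := lt_of_le_of_ne hs.1 (Ne.symm h0)
          exact h (abs_lt.2 ⟨by linarith, by linarith⟩)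
        rw [side_zero_eq]
        exact turn_mem_discSector hm (by rw [h0]; norm_num)
      · refine ⟨(k + 1) % numSides g 0, Nat.mod_lt _ hm, ?_⟩
        have h0 : s = 1 := by
          by_contra h0
          have := lt_of_le_of_ne hs.2 h0
          exact h (abs_lt.2 ⟨by linarith, by linarith⟩)
        rw [side_zero_eq' hm]
        exact turn_mem_discSector hm (by rw [h0]; norm_num)
    · exfalso
      apply h
      rw [sideLen, if_neg hr, abs_lt]
      constructor <;> linarith [hs.1, hs.2]

/-- The loops through the sides generate the fundamental group. -/
theorem closure_sideLoop (hm : 0 < numSides g r) :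
    Subgroup.closure {x | ∃ k < numSides g r, x = sideLoop g r k} = ⊤ := by
  refine eq_top_of_hop_mem (R := fun x y => ∃ k, glueAt g r k x y) (isQuotientMap_proj g r)
    (fun x y h => proj_eq_iff h) (fun x y ⟨k, h⟩ => proj_eq_of_glueAt h) Disc.zero _ ?_ ?_
  · rintro x y ⟨k, hk, s, hs, rfl, rfl⟩
    exact Subgroup.subset_closure ⟨k, hk, sideLoopAt_eq hk hs⟩
  · intro y
    have hchart : ∀ C : SectorChart g r, y ∈ C.domain →
        ∃ (U : Set Disc) (h : Disc → I → Disc), y ∈ U ∧ IsOpen U ∧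
        (∀ x y, (∃ k, glueAt g r k x y) → (x ∈ U ↔ y ∈ U)) ∧
        ContinuousOn (Function.uncurry h) (U ×ˢ univ) ∧ (∀ x ∈ U, h x 0 = x) ∧
        (∀ x y, (∃ k, glueAt g r k x y) → x ∈ U → ∀ t, proj g r (h x t) = proj g r (h y t)) ∧
        ∀ x ∈ U, ∀ y ∈ U, proj g r (h x 1) = proj g r (h y 1) := fun C hy =>
      ⟨C.domain, C.contract, hy, C.isOpen_domain hm, fun x y ⟨k, h⟩ => C.mem_domain_iff h,
        C.continuousOn_contract hm, fun x hx => C.contract_zero hm hx,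
        fun x y ⟨k, h⟩ hx t => C.proj_contract hm h hx t,
        fun x hx y hy => C.proj_contract_one hm hx hy⟩
    by_cases hy : y ∈ offSides g r
    · refine ⟨offSides g r, radialContract, hy, isOpen_offSides g r, ?_,
        continuous_radialContract.continuousOn, ?_, ?_, ?_⟩
      · rintro x y ⟨k, h⟩
        exact iff_of_false (notMem_offSides h) (notMem_offSides (glueAt_symm h))
      · intro x _
        simp [radialContract]
      · rintro x y ⟨k, h⟩ hx
        exact absurd hx (notMem_offSides h)
      · intro x _ y _
        simp [radialContract]
    · obtain ⟨k, hk, s, hs, rfl⟩ : ∃ k < numSides g r, ∃ s ∈ Icc (0 : ℝ) 1, y = side g r k s := by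
        by_contra h
        exact hy h
      rcases side_mem_chart hk hs with h | ⟨hr, h⟩
      · exact hchart _ h
      · exact hchart _ h

open MulOpposite in
/-- Homomorphisms from the fundamental group with prescribed values on the loops through the sides.
For closed surfaces the values have to multiply to one around the vertex, as witnessed by `κ`. -/
theorem exists_hom_sideLoop (hm : 0 < numSides g r) {G : Type*} [Group G] (c : ℕ → G)
    (hc : ∀ k < numSides g r, c (partner g k) = (c k)⁻¹)
    (hcorner : r = 0 → ∃ κ : ℕ → G, ∀ k < numSides g r,
      κ ((partner g k + 1) % numSides g r) = κ k * c k) :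
    ∃ F : FundamentalGroup (Model g r) (base g r) →* Gᵐᵒᵖ, ∀ k < numSides g r,
      F (sideLoop g r k) = op (c k) := by
  obtain ⟨F, hF⟩ := exists_hom_hop (R := fun k x y => glueAt g r k x y) (c := c)
    (isQuotientMap_proj g r) (fun x y h => proj_eq_iff h) (fun k x y h => proj_eq_of_glueAt h)
    Disc.zero (by
    intro y
    have hchart : ∀ (C : SectorChart g r) (κ : ℕ → G), (∀ k < numSides g r, ∀ s ∈ Icc (0 : ℝ) 1,
        ∀ i j, C.P i → C.P j →
        side g r k s ∈ discSector g r C.γ i → side g r (partner g k) (1 - s) ∈ discSector g r C.γ j →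
        κ j = κ i * c k) → y ∈ C.domain →
        ∃ (U : Set Disc) (κ : Disc → G), y ∈ U ∧ IsOpen U ∧
        (∀ k x y, glueAt g r k x y → (x ∈ U ↔ y ∈ U)) ∧ (∀ x ∈ U, ∀ᶠ z in 𝓝 x, κ z = κ x) ∧
        ∀ k x y, glueAt g r k x y → x ∈ U → κ y = κ x * c k := by
      intro C κ hκ hy
      refine ⟨C.domain, fun x => κ (C.idx x), hy, C.isOpen_domain hm,
        fun k x y h => C.mem_domain_iff h, ?_, ?_⟩
      · intro x hx
        filter_upwards [C.eventually_idx hm hx] with z hz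
        rw [hz]
      · intro k x y h hx
        obtain ⟨j, hj, hyj⟩ := C.mem_domain.1 ((C.mem_domain_iff h).1 hx)
        obtain ⟨i, hi, hxi⟩ := C.mem_domain.1 hx
        obtain ⟨hk, s, hs, rfl, rfl⟩ := h
        simp only
        rw [C.idx_eq hm hi hxi, C.idx_eq hm hj hyj]
        exact hκ k hk s hs i j hi hj hxi hyj
    by_cases hy : y ∈ offSides g r
    · refine ⟨offSides g r, fun _ => 1, hy, isOpen_offSides g r, ?_, fun _ _ => by simp, ?_⟩
      · rintro k x y h
        exact iff_of_false (notMem_offSides h) (notMem_offSides (glueAt_symm h))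
      · rintro k x y h hx
        exact absurd hx (notMem_offSides h)
    · obtain ⟨k₀, hk₀, s, hs, rfl⟩ : ∃ k < numSides g r, ∃ s ∈ Icc (0 : ℝ) 1,
          y = side g r k s := by
        by_contra h
        exact hy h
      rcases side_mem_chart hk₀ hs with h | ⟨hr, h⟩
      · refine hchart _ (fun j => if j = k₀ then 1 else c k₀) ?_ h
        intro k hk s hs i j hi hj hxi hyj
        have hs' : 1 - s ∈ Icc (0 : ℝ) 1 := ⟨by linarith [hs.2], by linarith [hs.1]⟩
        have hilt := (sideChart g r hk₀).lt i hi
        have hjlt := (sideChart g r hk₀).lt j hj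
        obtain ⟨rfl, -⟩ := eq_of_side_mem_discSector hm hilt hk hs hxi
        obtain ⟨rfl, -⟩ := eq_of_side_mem_discSector hm hjlt (partner_lt hk) hs' hyj
        rcases hi with rfl | rfl
        · rw [if_neg (partner_ne hk), if_pos rfl, one_mul]
        · rw [partner_partner hk₀, if_pos rfl, if_neg (partner_ne hk₀), hc k₀ hk₀]
          simp
      · subst hr
        obtain ⟨κ, hκ⟩ := hcorner rfl
        refine hchart _ κ ?_ h
        intro k hk s hs i j hi hj hxi hyj
        have hs' : 1 - s ∈ Icc (0 : ℝ) 1 := ⟨by linarith [hs.2], by linarith [hs.1]⟩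
        -- The parameters `s` and `1 - s` lie on opposite sides of `1/2`, so a beginning is always
        -- glued to an end. The two consistent cases are the corner condition for `k` and for its
        -- partner.
        rcases corner_cases hi hk hs hxi with ⟨rfl, h1⟩ | ⟨rfl, h1⟩ <;>
        rcases corner_cases hj (partner_lt hk) hs' hyj with ⟨rfl, h2⟩ | ⟨rfl, h2⟩
        · linarith
        · exact hκ _ hk
        · have := hκ _ (partner_lt hk)
          rw [partner_partner hk, hc k hk] at this
          rw [this]; simp
        · linarith)
  refine ⟨F, fun k hk => ?_⟩
  rw [sideLoop, dif_pos hk]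
  exact hF k _ _ ⟨hk, 1 / 2, by norm_num, rfl, rfl⟩

end FundamentalGroupOfModel

/-! ### Embeddings of quotients from saturated correspondences -/

section Correspondence

variable {Z S X Y : Type*} [TopologicalSpace Z] [TopologicalSpace S] [TopologicalSpace X]
  [TopologicalSpace Y]

/-- A correspondence `S ← Z → Y` that is saturated for the relation defining the quotient `X` of
`Y` induces an embedding of `S` into `X`. -/
theorem exists_isEmbedding_of_correspondence [CompactSpace Z] [T2Space Y] {q : C(Y, X)}
    (hq : IsQuotientMap q) {R : Y → Y → Prop} (hqR : ∀ x y, q x = q y → Relation.EqvGen R x y)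
    (hsymm : ∀ x y, R x y → R y x) {p : C(Z, S)} (hp : IsQuotientMap p) (φ : C(Z, Y))
    (h1 : ∀ z w, p z = p w → q (φ z) = q (φ w)) (h2 : ∀ z w, φ z = φ w → p z = p w)
    (h3 : ∀ z y, R (φ z) y → ∃ w, φ w = y ∧ p w = p z) :
    ∃ e : C(S, X), IsEmbedding e ∧ ∀ z, e (p z) = q (φ z) := by
  let e : C(S, X) := hp.lift (q.comp φ) h1
  have he : ∀ z, e (p z) = q (φ z) := fun z =>
    congrArg (fun f : C(Z, X) => f z) (hp.lift_comp (q.comp φ) h1)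
  -- The points of `Y` that correspond to a given point of `S` form a saturated set.
  have sat : ∀ x y, Relation.EqvGen R x y → ∀ a : S,
      (∃ z, φ z = x ∧ p z = a) ↔ ∃ w, φ w = y ∧ p w = a := by
    intro x y h
    induction h with
    | rel x y h =>
      intro a
      constructor
      · rintro ⟨z, rfl, rfl⟩
        exact h3 z y h
      · rintro ⟨z, rfl, rfl⟩
        exact h3 z x (hsymm _ _ h)
    | refl => exact fun _ => Iff.rfl
    | symm _ _ _ ih => exact fun a => (ih a).symm
    | trans _ _ _ _ _ ih ih' => exact fun a => (ih a).trans (ih' a)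
  refine ⟨e, (IsClosedEmbedding.of_continuous_injective_isClosedMap e.continuous ?_ ?_).isEmbedding,
    he⟩
  · intro a b hab
    obtain ⟨z, rfl⟩ := hp.surjective a
    obtain ⟨w, rfl⟩ := hp.surjective b
    rw [he, he] at hab
    obtain ⟨w', hw', hpw⟩ := (sat _ _ (hqR _ _ hab) (p z)).1 ⟨z, rfl, rfl⟩
    rw [← hpw, h2 _ _ hw']
  -- Closedness is tested in `Y`, where the preimage of the image of `C` is a compact set. No
  -- separation property of `X` is involved.
  · intro C hC
    rw [← hq.isClosed_preimage]
    have : q ⁻¹' (e '' C) = φ '' (p ⁻¹' C) := by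
      ext x
      constructor
      · rintro ⟨a, ha, hax⟩
        obtain ⟨z, rfl⟩ := hp.surjective a
        rw [he] at hax
        obtain ⟨w, hw, hpw⟩ := (sat _ _ (hqR _ _ hax) (p z)).1 ⟨z, rfl, rfl⟩
        exact ⟨w, by rw [mem_preimage, hpw]; exact ha, hw⟩
      · rintro ⟨z, hz, rfl⟩
        exact ⟨p z, hz, he z⟩
    rw [this]
    exact ((hC.preimage p.continuous).isCompact.image φ.continuous).isClosed

lemma map_trans_quotient (e : C(S, X)) {a₁ a₂ a₃ : S} (γ : Path.Homotopic.Quotient a₁ a₂)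
    (δ : Path.Homotopic.Quotient a₂ a₃) : (γ.trans δ).map e = (γ.map e).trans (δ.map e) :=
  (FundamentalGroupoid.map e).map_comp (X := ⟨a₁⟩) (Y := ⟨a₂⟩) (Z := ⟨a₃⟩) γ δ

lemma map_symm_quotient (e : C(S, X)) {a₁ a₂ : S} (γ : Path.Homotopic.Quotient a₁ a₂) :
    γ.symm.map e = (γ.map e).symm := by
  obtain ⟨γ⟩ := γ; rfl

variable {Y' : Type*} [TopologicalSpace Y'] [SimplyConnectedSpace Y] [SimplyConnectedSpace Y']

/-- Any path in the correspondence will do: its two projections represent the unique path classes in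
`Y'` and `Y`, and they become equal in `X`. -/
lemma map_seg_of_path {q : C(Y, X)} {q' : C(Y', S)} {p₀ : C(Z, Y')} {φ : C(Z, Y)} {e : C(S, X)}
    (he : ∀ z, e (q' (p₀ z)) = q (φ z)) {z₁ z₂ : Z} (γ : Path z₁ z₂) :
    (seg q' (p₀ z₁) (p₀ z₂)).map e = (seg q (φ z₁) (φ z₂)).cast (he z₁) (he z₂) := by
  rw [← map_eq_seg q' (.mk (γ.map p₀.continuous)), ← map_eq_seg q (.mk (γ.map φ.continuous)),
    ← Path.Homotopic.Quotient.mk_map, ← Path.Homotopic.Quotient.mk_map,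
    ← Path.Homotopic.Quotient.mk_map, ← Path.Homotopic.Quotient.mk_cast]
  congr 1
  ext t
  exact he (γ t)

/-- The image of a loop `hop` under a map, in terms of the images of its two halves. -/
lemma mapOfEq_hop {q : C(Y, X)} {q' : C(Y', S)} (e : C(S, X)) {b : Y} {b' : Y'}
    (h0 : e (q' b') = q b) {u u' : Y'} {v v' : Y} (hu : e (q' u) = q v) (hu' : e (q' u') = q v')
    (h : q' u = q' u') (hv : q v = q v') (ξ ξ' : FundamentalGroup X (q b))
    (hξ : (seg q' b' u).map e =
      ((FundamentalGroup.toPath ξ).trans (seg q b v)).cast h0 hu)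
    (hξ' : (seg q' b' u').map e =
      ((FundamentalGroup.toPath ξ').trans (seg q b v')).cast h0 hu') :
    FundamentalGroup.mapOfEq e h0 (hop q' b' u u' h) = ξ'⁻¹ * hop q b v v' hv * ξ := by
  have hsymm : (seg q' u' b').map e =
      ((seg q v' b).trans (FundamentalGroup.toPath ξ').symm).cast hu' h0 := by
    rw [← seg_symm, map_symm_quotient, hξ']
    have : ∀ (x y : X) (hx : x = q b) (hy : y = q v'),
        (((FundamentalGroup.toPath ξ').trans (seg q b v')).cast hx hy).symm =
        ((seg q v' b).trans (FundamentalGroup.toPath ξ').symm).cast hy hx := by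
      rintro _ _ rfl rfl
      rw [Path.Homotopic.Quotient.cast_rfl_rfl, Path.Homotopic.Quotient.cast_rfl_rfl,
        ← seg_symm q b v']
      induction ξ' using Quotient.ind
      rename_i x
      induction (seg q b v') using Quotient.ind
      rename_i y
      exact congrArg Path.Homotopic.Quotient.mk (Path.trans_symm x y)
    exact this _ _ _ _
  have hcast : ∀ {a₁ a₂ a₃ : S} (γ : Path.Homotopic.Quotient a₁ a₂) (hh : a₃ = a₁),
      (γ.cast hh rfl).map e = (γ.map e).cast (congrArg e hh) rfl := by
    rintro a₁ a₂ _ γ rfl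
    rw [Path.Homotopic.Quotient.cast_rfl_rfl, Path.Homotopic.Quotient.cast_rfl_rfl]
  rw [FundamentalGroup.mapOfEq_apply]
  change (((seg q' b' u).trans ((seg q' u' b').cast h rfl)).map e).cast h0.symm h0.symm =
    (FundamentalGroup.toPath ξ).trans (((seg q b v).trans ((seg q v' b).cast hv rfl)).trans
      (FundamentalGroup.toPath ξ').symm)
  rw [map_trans_quotient, hcast, hξ, hsymm]
  have key : ∀ (x y y' : X) (hx : x = q b) (hy : y = q v) (hy' : y' = q v') (hyy : y = y')
      (hx' : q b = x) (ξ ξ' : Path.Homotopic.Quotient (q b) (q b)),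
      (Path.Homotopic.Quotient.trans ((ξ.trans (seg q b v)).cast hx hy)
        ((((seg q v' b).trans ξ'.symm).cast hy' hx).cast hyy rfl)).cast hx' hx' =
      ξ.trans (((seg q b v).trans ((seg q v' b).cast hv rfl)).trans ξ'.symm) := by
    rintro _ _ _ rfl rfl rfl hyy hx' ξ ξ'
    have key2 : ∀ (w : X) (hw : w = q v') (γ : Path.Homotopic.Quotient (q b) (q b)),
        ((seg q v' b).trans γ).cast hw rfl = ((seg q v' b).cast hw rfl).trans γ := by
      rintro _ rfl γ
      simp only [Path.Homotopic.Quotient.cast_rfl_rfl]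
    simp only [Path.Homotopic.Quotient.cast_rfl_rfl]
    rw [key2]
    simp only [Path.Homotopic.Quotient.trans_assoc]
  exact key _ _ _ h0 hu hu' (congrArg e h) h0.symm ξ ξ'

end Correspondence

/-! ### Polar parametrisation of the disc -/

section Polar

/-- The point of the disc with polar coordinates `ρ ∈ [0, 1]` and `t`, in full turns. -/
def Disc.polar (ρ t : ℝ) : Disc :=
  ⟨(projIcc (0 : ℝ) 1 zero_le_one ρ : ℝ) * SurfaceRep.turn t, by
    have := (projIcc (0 : ℝ) 1 zero_le_one ρ).2
    simpa [abs_of_nonneg this.1] using this.2⟩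

lemma Disc.coe_polar {ρ : ℝ} (hρ : ρ ∈ Icc (0 : ℝ) 1) (t : ℝ) :
    (Disc.polar ρ t : ℂ) = ρ * SurfaceRep.turn t := by
  simp only [Disc.polar, projIcc_of_mem _ hρ]

@[fun_prop] lemma Disc.continuous_polar {Z : Type*} [TopologicalSpace Z] {f g : Z → ℝ}
    (hf : Continuous f) (hg : Continuous g) : Continuous fun z => Disc.polar (f z) (g z) := by
  unfold Disc.polar
  have : Continuous fun z => (projIcc (0 : ℝ) 1 zero_le_one (f z) : ℝ) :=
    continuous_subtype_val.comp (continuous_projIcc.comp hf)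
  exact Continuous.subtype_mk (by fun_prop) _

lemma Disc.polar_one (t : ℝ) : Disc.polar 1 t = Disc.turn t := by
  ext; rw [Disc.coe_polar (by simp)]; simp [Disc.turn]

lemma Disc.polar_zero (t : ℝ) : Disc.polar 0 t = Disc.zero := by
  ext; rw [Disc.coe_polar (by simp)]; simp [Disc.zero]

lemma Disc.turn_shift {m : ℕ} (hm : 0 < m) (a b : ℝ) (n : ℤ) :
    Disc.turn ((a + n * m + b) / m) = Disc.turn ((a + b) / m) := by
  rw [Disc.turn, Disc.turn, Subtype.mk.injEq, ← turn_div_add hm (a + b) n]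
  congr 2; ring

lemma Disc.polar_add_period {m : ℕ} (hm : 0 < m) (ρ a : ℝ) :
    Disc.polar ρ ((a + m) / m) = Disc.polar ρ (a / m) := by
  have := turn_div_add hm a 1
  simp only [Int.cast_one, one_mul] at this
  simp only [Disc.polar, this]

lemma eq_of_mem_Ico_of_eq_add {m : ℕ} {w a a' : ℝ} (ha : a ∈ Ico w (w + m))
    (ha' : a' ∈ Ico w (w + m)) {n : ℤ} (h : a = a' + n * m) : a = a' := by
  have hm : (0 : ℝ) < m := by linarith [ha.1, ha.2]
  have : n = 0 := by
    rcases lt_trichotomy n 0 with hn | hn | hn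
    · have : (n : ℝ) ≤ -1 := by exact_mod_cast (by omega : n ≤ -1)
      nlinarith [ha.1, ha'.2]
    · exact hn
    · have : (1 : ℝ) ≤ n := by exact_mod_cast (by omega : 1 ≤ n)
      nlinarith [ha.2, ha'.1]
  subst this; simpa using h

lemma Disc.polar_inj {m : ℕ} {w ρ ρ' a a' : ℝ} (hρ : 0 < ρ) (hρ1 : ρ ≤ 1)
    (hρ' : ρ' ∈ Icc (0 : ℝ) 1) (ha : a ∈ Ico w (w + m)) (ha' : a' ∈ Ico w (w + m))
    (h : Disc.polar ρ (a / m) = Disc.polar ρ' (a' / m)) : ρ = ρ' ∧ a = a' := by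
  have hm' : (0 : ℝ) < m := by linarith [ha.1, ha.2]
  have hm : 0 < m := by exact_mod_cast hm'
  have h' := congrArg Subtype.val h
  rw [Disc.coe_polar ⟨hρ.le, hρ1⟩, Disc.coe_polar hρ'] at h'
  obtain ⟨h1, n, hn⟩ := polar_eq hρ hρ'.1 h'
  obtain ⟨n, hn⟩ := turn_div_eq hm (SurfaceRep.turn_eq_turn_iff.2 ⟨n, hn⟩)
  exact ⟨h1, eq_of_mem_Ico_of_eq_add ha ha' hn⟩

lemma Disc.exists_polar {m : ℕ} (hm : 0 < m) (w : ℝ) (x : Disc) :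
    ∃ ρ ∈ Icc (0 : ℝ) 1, ∃ a ∈ Ico w (w + m), x = Disc.polar ρ (a / m) := by
  have hm' : (0 : ℝ) < m := by exact_mod_cast hm
  obtain ⟨t, ht, hx⟩ := SurfaceRep.exists_polar (x : ℂ) (w / m)
  refine ⟨‖(x : ℂ)‖, ⟨norm_nonneg _, x.norm_le⟩, t * m, ⟨?_, ?_⟩, ?_⟩
  · have := ht.1; rwa [div_le_iff₀ hm'] at this
  · have := ht.2
    have h2 : w / m * m = w := by field_simp
    nlinarith
  · ext
    rw [Disc.coe_polar ⟨norm_nonneg _, x.norm_le⟩, mul_div_assoc, div_self hm'.ne', mul_one]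
    exact hx

/-- Uniqueness of the parameters of an inner point of a side. -/
lemma side_inj {g r : ℕ} {i k : ℕ} (hi : i < numSides g r) (hk : k < numSides g r) {s x : ℝ}
    (hs : s ∈ Icc (0 : ℝ) 1) (hx : x ∈ Ioo (0 : ℝ) 1) (h : side g r i s = side g r k x) :
    i = k ∧ s = x := by
  have hm : 0 < numSides g r := by omega
  obtain ⟨n, hn⟩ := turn_div_eq hm (congrArg Subtype.val h)
  have hδ := sideLen_pos r
  have hδ1 := sideLen_le r
  have key : i = k := by
    refine int_mul_eq_zero_of_abs_lt hi hk (n := n) ?_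
    have : (i : ℝ) - k - n * numSides g r = sideLen r * (x - s) := by linarith
    rw [this, abs_mul, abs_of_pos hδ]
    have : |x - s| < 1 := by
      rw [abs_lt]; constructor <;> linarith [hs.1, hs.2, hx.1, hx.2]
    nlinarith [abs_nonneg (x - s)]
  subst key
  refine ⟨rfl, ?_⟩
  have hnz : n = 0 := by
    have h1 : |(n : ℝ) * numSides g r| < 1 := by
      have : (n : ℝ) * numSides g r = sideLen r * (s - x) := by linarith
      rw [this, abs_mul, abs_of_pos hδ]
      have : |s - x| < 1 := by
        rw [abs_lt]; constructor <;> linarith [hs.1, hs.2, hx.1, hx.2]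
      nlinarith [abs_nonneg (s - x)]
    have h2 : |n * (numSides g r : ℤ)| < 1 := by exact_mod_cast h1
    rw [Int.abs_lt_one_iff] at h2
    rcases mul_eq_zero.1 h2 with h | h
    · exact h
    · omega
  subst hnz
  have : sideLen r * s = sideLen r * x := by push_cast at hn; linarith
  exact mul_left_cancel₀ hδ.ne' this

end Polar

/-! ### Monotone interpolation and cut-off functions -/

section Interpolation

/-- Piecewise linear interpolation of increasing data. -/
lemma exists_interpolation {x y : ℕ → ℝ} (N : ℕ) (hx : ∀ i < N, x i < x (i + 1))
    (hy : ∀ i < N, y i < y (i + 1)) :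
    ∃ h : ℝ → ℝ, Continuous h ∧ StrictMono h ∧ h (x N) = y N ∧ ∀ i < N, ∀ t ∈ Icc (0 : ℝ) 1,
      h (x i + t * (x (i + 1) - x i)) = y i + t * (y (i + 1) - y i) := by
  induction N with
  | zero =>
    exact ⟨fun t => y 0 + (t - x 0), by fun_prop, fun a b hab => by simpa using hab, by simp,
      by simp⟩
  | succ N ih =>
    obtain ⟨h, hc, hm, hN, hi⟩ := ih (fun i h => hx i (by omega)) (fun i h => hy i (by omega))
    have hxN := hx N (by omega)
    have hyN := hy N (by omega)
    set c := (y (N + 1) - y N) / (x (N + 1) - x N) with hcdef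
    have hcpos : 0 < c := div_pos (by linarith) (by linarith)
    have hce : c * (x (N + 1) - x N) = y (N + 1) - y N :=
      div_mul_cancel₀ _ (sub_pos.2 hxN).ne'
    -- The earlier interpolation is frozen after the node `x N`, and a linear ramp of the required
    -- slope is added from there on.
    refine ⟨fun t => h (min t (x N)) + c * max 0 (t - x N), by fun_prop, ?_, ?_, ?_⟩
    · intro a b hab
      rcases le_or_gt b (x N) with hb | hb
      · simp only [min_eq_left hb, min_eq_left (hab.le.trans hb),
          max_eq_left (by linarith : b - x N ≤ 0), max_eq_left (by linarith : a - x N ≤ 0)]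
        linarith [hm hab]
      · rcases le_or_gt a (x N) with ha | ha
        · simp only [min_eq_right hb.le, min_eq_left ha,
            max_eq_right (by linarith : 0 ≤ b - x N), max_eq_left (by linarith : a - x N ≤ 0)]
          have := hm.monotone ha
          have : 0 < c * (b - x N) := mul_pos hcpos (by linarith)
          linarith
        · simp only [min_eq_right hb.le, min_eq_right ha.le,
            max_eq_right (by linarith : 0 ≤ b - x N), max_eq_right (by linarith : 0 ≤ a - x N)]
          have : 0 < c * (b - a) := mul_pos hcpos (by linarith)
          linarith
    · simp only [min_eq_right hxN.le, max_eq_right (by linarith : 0 ≤ x (N + 1) - x N), hN, hce]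
      ring
    · intro i hiN t ht
      rcases Nat.lt_succ_iff_lt_or_eq.1 hiN with hlt | rfl
      · have hle : ∀ j, j ≤ N → ∀ i ≤ j, x i ≤ x j := by
          intro j
          induction j with
          | zero => intro _ i hi; rw [Nat.le_zero.1 hi]
          | succ j ihj =>
            intro hj i hi
            rcases Nat.lt_succ_iff_lt_or_eq.1 (Nat.lt_succ_of_le hi) with h | rfl
            · exact (ihj (by omega) i (by omega)).trans (hx j (by omega)).le
            · exact le_rfl
        have h1 := hle N le_rfl (i + 1) hlt
        have h2 := hx i hiN
        have h3 : x i + t * (x (i + 1) - x i) ≤ x N := by nlinarith [ht.2]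
        simp only [min_eq_left h3, max_eq_left (by linarith : x i + t * (x (i + 1) - x i) - x N ≤ 0),
          hi i hlt t ht]
        ring
      · have h3 : x i ≤ x i + t * (x (i + 1) - x i) := by nlinarith [ht.1]
        simp only [min_eq_right h3, max_eq_right (by linarith :
          0 ≤ x i + t * (x (i + 1) - x i) - x i), hN]
        linear_combination t * hce

/-- A cut-off function on the circle with prescribed maximum set. -/
lemma exists_cutoff {A B : Set ℂ} (hA : IsCompact A) (hB : IsCompact B) (hAB : Disjoint A B)
    (hne : A.Nonempty) (hA0 : (0 : ℂ) ∉ A) :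
    ∃ v : ℂ → ℝ, Continuous v ∧ (∀ z, v z ∈ Icc (1 / 2 : ℝ) 1) ∧ (∀ z, v z = 1 ↔ z ∈ A) ∧
      ∀ z ∈ B, v z = 1 / 2 := by
  -- The origin keeps `C` nonempty even if `B` is empty, so that the distance to `C` is positive off
  -- `C`; it does not lie in `A`.
  set C := insert 0 B with hC
  have hCc : IsClosed C := (hB.insert 0).isClosed
  have hCne : C.Nonempty := insert_nonempty _ _
  have hdis : ∀ z ∈ A, z ∉ C := by
    rintro z hz (rfl | h)
    · exact hA0 hz
    · exact hAB.le_bot ⟨hz, h⟩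
  have hApos : ∀ z ∉ A, 0 < Metric.infDist z A := fun z hz =>
    (hA.isClosed.notMem_iff_infDist_pos hne).1 hz
  have hCpos : ∀ z ∉ C, 0 < Metric.infDist z C := fun z hz =>
    (hCc.notMem_iff_infDist_pos hCne).1 hz
  have hA' : ∀ z, 0 ≤ Metric.infDist z A := fun z => Metric.infDist_nonneg
  have hC' : ∀ z, 0 ≤ Metric.infDist z C := fun z => Metric.infDist_nonneg
  have hden : ∀ z, 0 < Metric.infDist z A + Metric.infDist z C := by
    intro z
    by_cases hz : z ∈ A
    · linarith [hA' z, hCpos z (hdis z hz)]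
    · linarith [hC' z, hApos z hz]
  refine ⟨fun z => 1 - 1 / 2 * (Metric.infDist z A / (Metric.infDist z A + Metric.infDist z C)),
    ?_, ?_, ?_, ?_⟩
  · have h1 : Continuous fun z : ℂ => Metric.infDist z A := Metric.continuous_infDist_pt A
    have h2 : Continuous fun z : ℂ => Metric.infDist z C := Metric.continuous_infDist_pt C
    exact continuous_const.sub (continuous_const.mul (h1.div (h1.add h2) fun z => (hden z).ne'))
  · intro z
    have h1 : Metric.infDist z A / (Metric.infDist z A + Metric.infDist z C) ≤ 1 := by
      rw [div_le_one (hden z)]; linarith [hC' z]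
    have h2 : 0 ≤ Metric.infDist z A / (Metric.infDist z A + Metric.infDist z C) :=
      div_nonneg (hA' z) (hden z).le
    constructor <;> simp only <;> linarith
  · intro z
    by_cases hz : z ∈ A
    · simp [hz, Metric.infDist_zero_of_mem hz]
    · have : 0 < Metric.infDist z A / (Metric.infDist z A + Metric.infDist z C) :=
        div_pos (hApos z hz) (hden z)
      simp only [hz, iff_false]
      intro h
      linarith
  · intro z hz
    have hzC : Metric.infDist z C = 0 := Metric.infDist_zero_of_mem (mem_insert_of_mem _ hz)
    have := hden z
    rw [hzC, add_zero] at this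
    simp only [hzC, add_zero, div_self this.ne']
    norm_num

end Interpolation

/-! ### Combinatorial data for an embedding of surfaces -/

section Routing

/-- Combinatorial data for an embedding of `Model g' r'`, `r' ≠ 0`, into `Model g r`. The disc of
the source is thickened along legs that run from the centre of the target disc to an inner
interval of the side `first k`; if `strip k` holds, the `k`-th leg crosses that side and continues
in a strip near the boundary of the disc to the side `last k`. -/
structure Routing (g' r' g r : ℕ) where
  /-- the side hit by the `k`-th leg -/
  first : ℕ → ℕ
  /-- the side on which the `k`-th side of the source is mapped -/
  last : ℕ → ℕ
  /-- number of full turns in the position of the leg -/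
  turns : ℕ → ℤ
  /-- number of full turns in the position of the entry of the strip -/
  turnsEntry : ℕ → ℤ
  /-- number of full turns in the position of the exit of the strip -/
  turnsExit : ℕ → ℤ
  /-- parameter on the first side of the beginning of the `k`-th side of the source -/
  start : ℕ → ℝ
  /-- parameter on the last side of the beginning of the `k`-th side of the source -/
  startLast : ℕ → ℝ
  /-- width of the leg -/
  width : ℕ → ℝ
  /-- the legs that are continued by a strip -/
  strip : ℕ → Prop
  /-- lower bound of the angles of the strip -/
  lo : ℕ → ℝ
  /-- upper bound of the angles of the strip -/
  hi : ℕ → ℝ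
  boundary_ne : r' ≠ 0
  numSides_pos : 0 < numSides g' r'
  first_lt : ∀ k < numSides g' r', first k < numSides g r
  last_lt : ∀ k < numSides g' r', last k < numSides g r
  width_pos : ∀ k < numSides g' r', 0 < width k
  -- A side of the source corresponds to `s ∈ [0, 1]`, but a leg is controlled for `s ∈ [-1/4,
  -- 5/4]`. In the two margins the leg withdraws from the boundary, or its strip tapers off; they
  -- too must stay inside the open side.
  start_pos : ∀ k < numSides g' r', 0 < start k - width k / 4
  start_lt : ∀ k < numSides g' r', start k + 5 / 4 * width k < 1
  startLast_pos : ∀ k < numSides g' r', 0 < startLast k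
  startLast_lt : ∀ k < numSides g' r', startLast k + width k < 1
  last_eq : ∀ k < numSides g' r', ¬ strip k → last k = first k
  startLast_eq : ∀ k < numSides g' r', ¬ strip k → startLast k = start k
  last_partner : ∀ k < numSides g' r', last (partner g' k) = partner g (last k)
  width_partner : ∀ k < numSides g' r', width (partner g' k) = width k
  startLast_partner : ∀ k < numSides g' r',
    startLast (partner g' k) = 1 - startLast k - width k
  leg_lt : ∀ k j, k < j → j < numSides g' r' →
    first k + turns k * numSides g r + sideLen r * (start k + width k * (5 / 4)) <
      first j + turns j * numSides g r + sideLen r * (start j + width j * (-1 / 4))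
  leg_lt_add : ∀ k < numSides g' r',
    first k + turns k * numSides g r + sideLen r * (start k + width k * (5 / 4)) <
      first 0 + turns 0 * numSides g r + sideLen r * (start 0 + width 0 * (-1 / 4)) +
        numSides g r
  -- All legs and strips are placed in a single period of positions, beginning with the margin of
  -- leg `0`. Their disjointness can thus be stated by inequalities of real numbers.
  lo_ge : ∀ k < numSides g' r', strip k →
    first 0 + turns 0 * numSides g r + sideLen r * (start 0 + width 0 * (-1 / 4)) ≤ lo k
  hi_lt : ∀ k < numSides g' r', strip k →
    hi k < first 0 + turns 0 * numSides g r + sideLen r * (start 0 + width 0 * (-1 / 4)) +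
      numSides g r
  strip_leg : ∀ k < numSides g' r', strip k → ∀ j < numSides g' r',
    hi k < first j + turns j * numSides g r + sideLen r * (start j + width j * (-1 / 4)) ∨
    first j + turns j * numSides g r + sideLen r * (start j + width j * (5 / 4)) < lo k
  strip_strip : ∀ k < numSides g' r', strip k → ∀ j < numSides g' r', strip j → k ≠ j →
    hi k < lo j ∨ hi j < lo k
  entry_mem : ∀ k < numSides g' r', strip k → ∀ s ∈ Icc (-1 / 4 : ℝ) (5 / 4),
    partner g (first k) + turnsEntry k * numSides g r +
      sideLen r * (1 - (start k + width k * s)) ∈ Icc (lo k) (hi k)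
  exit_mem : ∀ k < numSides g' r', strip k → ∀ s ∈ Icc (-1 / 4 : ℝ) (5 / 4),
    last k + turnsExit k * numSides g r +
      sideLen r * (startLast k + width k * s) ∈ Icc (lo k) (hi k)
  -- All arcs of a strip run in the same direction, and none of them is degenerate.
  entry_exit : ∀ k < numSides g' r', strip k →
    (∀ s ∈ Icc (-1 / 4 : ℝ) (5 / 4), 0 < last k + turnsExit k * numSides g r +
        sideLen r * (startLast k + width k * s) -
      (partner g (first k) + turnsEntry k * numSides g r +
        sideLen r * (1 - (start k + width k * s)))) ∨
    (∀ s ∈ Icc (-1 / 4 : ℝ) (5 / 4), last k + turnsExit k * numSides g r +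
        sideLen r * (startLast k + width k * s) -
      (partner g (first k) + turnsEntry k * numSides g r +
        sideLen r * (1 - (start k + width k * s))) < 0)

namespace Routing

variable {g' r' g r : ℕ} (D : Routing g' r' g r)

/-- Position of the leg. -/
def pos (k : ℕ) (s : ℝ) : ℝ :=
  D.first k + D.turns k * numSides g r + sideLen r * (D.start k + D.width k * s)

/-- Position of the entry of the strip. -/
def entry (k : ℕ) (s : ℝ) : ℝ :=
  partner g (D.first k) + D.turnsEntry k * numSides g r +
    sideLen r * (1 - (D.start k + D.width k * s))

/-- Position of the exit of the strip. -/
def exit (k : ℕ) (s : ℝ) : ℝ :=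
  D.last k + D.turnsExit k * numSides g r + sideLen r * (D.startLast k + D.width k * s)

lemma target_pos (D : Routing g' r' g r) : 0 < numSides g r := (Nat.zero_le _).trans_lt (D.first_lt 0 D.numSides_pos)

lemma sideLen_source (D : Routing g' r' g r) : sideLen r' = 1 / 2 := by rw [sideLen, if_neg D.boundary_ne]

lemma side_source (D : Routing g' r' g r) (k : ℕ) (s : ℝ) :
    side g' r' k s = Disc.polar 1 ((k + s / 2) / numSides g' r') := by
  rw [Disc.polar_one, side, D.sideLen_source]; congr 2; ring

lemma turn_pos (k : ℕ) (s : ℝ) : Disc.polar 1 (D.pos k s / numSides g r) =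
    side g r (D.first k) (D.start k + D.width k * s) := by
  rw [Disc.polar_one, side, pos, Disc.turn_shift D.target_pos]

lemma turn_entry (k : ℕ) (s : ℝ) : Disc.polar 1 (D.entry k s / numSides g r) =
    side g r (partner g (D.first k)) (1 - (D.start k + D.width k * s)) := by
  rw [Disc.polar_one, side, entry, Disc.turn_shift D.target_pos]

lemma turn_exit (k : ℕ) (s : ℝ) : Disc.polar 1 (D.exit k s / numSides g r) =
    side g r (D.last k) (D.startLast k + D.width k * s) := by
  rw [Disc.polar_one, side, exit, Disc.turn_shift D.target_pos]

lemma pos_lt_pos {k : ℕ} (hk : k < numSides g' r') {s t : ℝ} (h : s < t) :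
    D.pos k s < D.pos k t := by
  have := mul_pos (mul_pos (sideLen_pos r) (D.width_pos k hk)) (sub_pos.2 h)
  unfold pos; nlinarith

lemma pos_le_pos {k : ℕ} (hk : k < numSides g' r') {s t : ℝ} (h : s ≤ t) :
    D.pos k s ≤ D.pos k t := by
  rcases h.eq_or_lt with rfl | h
  · exact le_rfl
  · exact (D.pos_lt_pos hk h).le

lemma param_mem {k : ℕ} (hk : k < numSides g' r') {s : ℝ} (hs : s ∈ Icc (-1 / 4 : ℝ) (5 / 4)) :
    D.start k + D.width k * s ∈ Ioo (0 : ℝ) 1 := by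
  have h1 := D.start_pos k hk
  have h2 := D.start_lt k hk
  have h3 := D.width_pos k hk
  constructor <;> nlinarith [hs.1, hs.2]

lemma paramLast_mem {k : ℕ} (hk : k < numSides g' r') {s : ℝ} (hs : s ∈ Icc (0 : ℝ) 1) :
    D.startLast k + D.width k * s ∈ Ioo (0 : ℝ) 1 := by
  have h1 := D.startLast_pos k hk
  have h2 := D.startLast_lt k hk
  have h3 := D.width_pos k hk
  constructor <;> nlinarith [hs.1, hs.2]

/-- The beginning of the period of positions in which everything takes place. -/
def origin : ℝ := D.pos 0 (-1 / 4)

lemma pos_mem {k : ℕ} (hk : k < numSides g' r') {s : ℝ} (hs : s ∈ Icc (-1 / 4 : ℝ) (5 / 4)) :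
    D.pos k s ∈ Ico D.origin (D.origin + numSides g r) := by
  refine ⟨?_, (D.pos_le_pos hk hs.2).trans_lt (D.leg_lt_add k hk)⟩
  refine le_trans ?_ (D.pos_le_pos hk hs.1)
  rcases Nat.eq_zero_or_pos k with rfl | h
  · exact le_rfl
  · exact (D.pos_le_pos D.numSides_pos (by norm_num)).trans (D.leg_lt 0 k h hk).le

/-- Positions of the ends of the legs. -/
def node (i : ℕ) : ℝ :=
  if i = 2 * numSides g' r' then D.origin + numSides g r
  else if i % 2 = 0 then D.pos (i / 2) (-1 / 4) else D.pos (i / 2) (5 / 4)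

/-- Positions of the ends of the legs in the source. -/
def nodeSource (i : ℕ) : ℝ := ((i / 2 : ℕ) : ℝ) + if i % 2 = 0 then -1 / 8 else 5 / 8

lemma node_lt (i : ℕ) (hi : i < 2 * numSides g' r') : D.node i < D.node (i + 1) := by
  have hk : i / 2 < numSides g' r' := by omega
  unfold node
  rw [if_neg (by omega : i ≠ 2 * numSides g' r')]
  rcases Nat.mod_two_eq_zero_or_one i with h | h
  · rw [if_pos h, if_neg (by omega), if_neg (by omega), (by omega : (i + 1) / 2 = i / 2)]
    exact D.pos_lt_pos hk (by norm_num)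
  · rw [if_neg (by omega : ¬ i % 2 = 0)]
    split_ifs with h1
    · exact D.leg_lt_add _ hk
    · exact D.leg_lt _ _ (by omega) (by omega)
    · omega

lemma nodeSource_lt (i : ℕ) : nodeSource i < nodeSource (i + 1) := by
  unfold nodeSource
  rcases Nat.mod_two_eq_zero_or_one i with h | h
  · rw [if_pos h, if_neg (by omega), (by omega : (i + 1) / 2 = i / 2)]; linarith
  · rw [if_neg (by omega), if_pos (by omega), (by omega : (i + 1) / 2 = i / 2 + 1)]
    push_cast; linarith

/-- Sides of the source have length `1/2`, so side `k` with its margins occupies `[k - 1/8, k +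
5/8]`. These intervals are mapped affinely to the legs and the gaps between them to the gaps between
the legs; the last node is the first one moved by a full period. -/
lemma exists_angle : ∃ h : ℝ → ℝ, Continuous h ∧ StrictMono h ∧
    h (numSides g' r' - 1 / 8) = D.origin + numSides g r ∧
    ∀ k < numSides g' r', ∀ s ∈ Icc (-1 / 4 : ℝ) (5 / 4), h (k + s / 2) = D.pos k s := by
  obtain ⟨h, hc, hm, hN, hi⟩ := exists_interpolation (x := nodeSource) (y := D.node)
    (2 * numSides g' r') (fun i _ => nodeSource_lt i) D.node_lt
  refine ⟨h, hc, hm, ?_, ?_⟩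
  · convert hN using 2
    · simp [nodeSource]; ring
    · simp [node]
  · intro k hk s hs
    have := hi (2 * k) (by omega) ((s + 1 / 4) * (2 / 3))
      ⟨by linarith [hs.1], by linarith [hs.2]⟩
    have e1 : nodeSource (2 * k) = k - 1 / 8 := by
      simp [nodeSource]; ring
    have e2 : nodeSource (2 * k + 1) = k + 5 / 8 := by
      simp [nodeSource, (by omega : (2 * k + 1) / 2 = k), (by omega : (2 * k + 1) % 2 = 1)]
    have e3 : D.node (2 * k) = D.pos k (-1 / 4) := by
      rw [node, if_neg (by omega), if_pos (by omega), (by omega : 2 * k / 2 = k)]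
    have e4 : D.node (2 * k + 1) = D.pos k (5 / 4) := by
      rw [node, if_neg (by omega), if_neg (by omega), (by omega : (2 * k + 1) / 2 = k)]
    rw [e1, e2, e3, e4] at this
    convert this using 2
    · ring
    · unfold pos; ring

/-- The angle of the leg, as a function of the angle in the source. -/
def angle : ℝ → ℝ := D.exists_angle.choose

lemma continuous_angle : Continuous D.angle := D.exists_angle.choose_spec.1

lemma strictMono_angle : StrictMono D.angle := D.exists_angle.choose_spec.2.1

lemma angle_end : D.angle (numSides g' r' - 1 / 8) = D.origin + numSides g r :=
  D.exists_angle.choose_spec.2.2.1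

lemma angle_leg {k : ℕ} (hk : k < numSides g' r') {s : ℝ} (hs : s ∈ Icc (-1 / 4 : ℝ) (5 / 4)) :
    D.angle (k + s / 2) = D.pos k s := D.exists_angle.choose_spec.2.2.2 k hk s hs

lemma angle_begin : D.angle (-1 / 8) = D.origin := by
  have := D.angle_leg D.numSides_pos (s := -1 / 4) (by norm_num)
  rw [origin, ← this]; congr 1; norm_num

lemma angle_mem {y : ℝ} (hy : y ∈ Ico (-1 / 8 : ℝ) (-1 / 8 + numSides g' r')) :
    D.angle y ∈ Ico D.origin (D.origin + numSides g r) := by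
  rw [← D.angle_end, ← D.angle_begin]
  refine ⟨D.strictMono_angle.monotone hy.1, D.strictMono_angle (by linarith [hy.2])⟩

/-- The parameters of the leg in which it reaches the boundary of the disc. -/
def contact (k : ℕ) : Set ℝ := {s | s ∈ Icc (-1 / 4 : ℝ) (5 / 4) ∧ (D.strip k ∨ s ∈ Icc (0 : ℝ) 1)}

lemma isCompact_contact (k : ℕ) : IsCompact (D.contact k) := by
  by_cases h : D.strip k
  · have : D.contact k = Icc (-1 / 4 : ℝ) (5 / 4) := by ext; simp [contact, h]
    rw [this]; exact isCompact_Icc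
  · have : D.contact k = Icc (-1 / 4 : ℝ) (5 / 4) ∩ Icc 0 1 := by ext; simp [contact, h]
    rw [this]; exact isCompact_Icc.inter isCompact_Icc

/-- The thickened disc may touch the boundary circle exactly along the contact sets. In the
directions of the strips it retreats to radius `1/2`, which leaves the outer part of the disc to
them. -/
lemma exists_reach : ∃ v : ℂ → ℝ, Continuous v ∧ (∀ z, v z ∈ Icc (1 / 2 : ℝ) 1) ∧
    (∀ z, v z = 1 ↔ ∃ k < numSides g' r', ∃ s ∈ D.contact k, z = turn (D.pos k s / numSides g r)) ∧
    ∀ k < numSides g' r', D.strip k → ∀ a ∈ Icc (D.lo k) (D.hi k),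
      v (turn (a / numSides g r)) = 1 / 2 := by
  let A : Set ℂ := ⋃ k ∈ Finset.range (numSides g' r'),
    (fun s => turn (D.pos k s / numSides g r)) '' D.contact k
  let B : Set ℂ := ⋃ k ∈ {k ∈ (Finset.range (numSides g' r') : Set ℕ) | D.strip k},
    (fun a => turn (a / numSides g r)) '' Icc (D.lo k) (D.hi k)
  have hA : IsCompact A := Finset.isCompact_biUnion _ fun k _ =>
    (D.isCompact_contact k).image (by unfold pos; fun_prop)
  have hB : IsCompact B := ((Finset.range (numSides g' r')).finite_toSet.subset
    (fun k hk => hk.1)).isCompact_biUnion fun k _ => isCompact_Icc.image (by fun_prop)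
  have hAmem : ∀ z, z ∈ A ↔ ∃ k < numSides g' r', ∃ s ∈ D.contact k,
      z = turn (D.pos k s / numSides g r) := by
    intro z
    simp only [A, Finset.mem_range, mem_iUnion, mem_image, exists_prop]
    exact exists_congr fun k => and_congr_right fun _ => exists_congr fun s =>
      and_congr_right fun _ => eq_comm
  have hAB : Disjoint A B := by
    rw [Set.disjoint_left]
    intro z hz hz'
    obtain ⟨j, hj, s, hs, rfl⟩ := (hAmem z).1 hz
    simp only [B, mem_iUnion, mem_image] at hz'
    obtain ⟨k, hk, a, ha, hza⟩ := hz'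
    have hk1 : k < numSides g' r' := by simpa using hk.1
    have hk2 : D.strip k := hk.2
    obtain ⟨n, hn⟩ := turn_div_eq D.target_pos hza
    have h1 := D.pos_mem hj hs.1
    have h2 : a ∈ Ico D.origin (D.origin + numSides g r) :=
      ⟨(D.lo_ge k hk1 hk2).trans ha.1, ha.2.trans_lt (D.hi_lt k hk1 hk2)⟩
    have h3 := eq_of_mem_Ico_of_eq_add h2 h1 hn
    rcases D.strip_leg k hk1 hk2 j hj with h | h
    · have := D.pos_le_pos hj hs.1.1
      have h' : D.hi k < D.pos j (-1 / 4) := h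
      linarith [ha.2]
    · have := D.pos_le_pos hj hs.1.2
      have h' : D.pos j (5 / 4) < D.lo k := h
      linarith [ha.1]
  obtain ⟨v, hv, h1, h2, h3⟩ := exists_cutoff hA hB hAB
    ⟨_, (hAmem _).2 ⟨0, D.numSides_pos, 0, ⟨by norm_num, Or.inr (by norm_num)⟩, rfl⟩⟩ (by
      intro h
      obtain ⟨k, -, s, -, h⟩ := (hAmem 0).1 h
      exact turn_ne_zero _ h.symm)
  refine ⟨v, hv, h1, fun z => (h2 z).trans (hAmem z), fun k hk hs a ha => h3 _ ?_⟩
  simp only [B, mem_iUnion]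
  exact ⟨k, ⟨by simpa using hk, hs⟩, mem_image_of_mem _ ha⟩

/-- How far the thickened disc reaches in the direction of a given position. -/
def reach (a : ℝ) : ℝ := D.exists_reach.choose (turn (a / numSides g r))

lemma continuous_reach : Continuous D.reach :=
  D.exists_reach.choose_spec.1.comp (by fun_prop)

lemma reach_mem (a : ℝ) : D.reach a ∈ Icc (1 / 2 : ℝ) 1 := D.exists_reach.choose_spec.2.1 _

lemma reach_add (a : ℝ) : D.reach (a + numSides g r) = D.reach a := by
  have := turn_div_add D.target_pos a 1
  simp only [Int.cast_one, one_mul] at this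
  rw [reach, reach, this]

lemma reach_pos {k : ℕ} (hk : k < numSides g' r') {s : ℝ} (hs : s ∈ D.contact k) :
    D.reach (D.pos k s) = 1 := (D.exists_reach.choose_spec.2.2.1 _).2 ⟨k, hk, s, hs, rfl⟩

lemma reach_strip {k : ℕ} (hk : k < numSides g' r') (h : D.strip k) {a : ℝ}
    (ha : a ∈ Icc (D.lo k) (D.hi k)) : D.reach a = 1 / 2 :=
  D.exists_reach.choose_spec.2.2.2 k hk h a ha

lemma exists_of_reach_eq_one {a : ℝ} (ha : a ∈ Ico D.origin (D.origin + numSides g r))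
    (h : D.reach a = 1) : ∃ k < numSides g' r', ∃ s ∈ D.contact k, a = D.pos k s := by
  obtain ⟨k, hk, s, hs, h⟩ := (D.exists_reach.choose_spec.2.2.1 _).1 h
  obtain ⟨n, hn⟩ := turn_div_eq D.target_pos h
  exact ⟨k, hk, s, hs, eq_of_mem_Ico_of_eq_add ha (D.pos_mem hk hs.1) hn⟩

/-- The bump function of a side. -/
def tent (x : ℝ) : ℝ := max 0 (1 - 8 * max (max (-x) (x - 1 / 2)) 0)

@[fun_prop] lemma continuous_tent : Continuous tent := by unfold tent; fun_prop

end Routing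

end Routing

/-! ### The correspondence between source disc and target disc -/

namespace Routing

variable {g' r' g r : ℕ} (D : Routing g' r' g r)

section Bump

lemma tent_nonneg (x : ℝ) : 0 ≤ tent x := le_max_left _ _

lemma tent_le_one (x : ℝ) : tent x ≤ 1 := by
  unfold tent
  have : (0 : ℝ) ≤ max (max (-x) (x - 1 / 2)) 0 := le_max_right _ _
  exact max_le zero_le_one (by linarith)

lemma tent_eq_one_iff {x : ℝ} : tent x = 1 ↔ x ∈ Icc (0 : ℝ) (1 / 2) := by
  unfold tent
  constructor
  · intro h
    have h1 := le_max_left (max (-x) (x - 1 / 2)) 0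
    have h2 := le_max_left (-x) (x - 1 / 2)
    have h3 := le_max_right (-x) (x - 1 / 2)
    have : max (max (-x) (x - 1 / 2)) 0 ≤ 0 := by
      by_contra hc
      push Not at hc
      have : max 0 (1 - 8 * max (max (-x) (x - 1 / 2)) 0) < 1 :=
        max_lt zero_lt_one (by linarith)
      linarith
    constructor <;> linarith
  · rintro ⟨h1, h2⟩
    rw [max_eq_right (max_le (by linarith) (by linarith) : max (-x) (x - 1 / 2) ≤ 0)]
    norm_num

/-- The slope `8` brings the tent from one to zero over a margin of length `1/8`, which is a quarter
in the parameter of a side. -/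
lemma tent_eq_zero {x : ℝ} (h : x ≤ -1 / 8 ∨ 5 / 8 ≤ x) : tent x = 0 := by
  unfold tent
  refine max_eq_left ?_
  have h1 := le_max_left (max (-x) (x - 1 / 2)) 0
  have h2 := le_max_left (-x) (x - 1 / 2)
  have h3 := le_max_right (-x) (x - 1 / 2)
  rcases h with h | h <;> linarith

open Classical in
/-- One plus the height of the strips over the boundary of the source disc. -/
def bump (y : ℝ) : ℝ :=
  1 + ∑ k ∈ Finset.range (numSides g' r'), if D.strip k then tent (y - k) else 0

open Classical in
/-- The height of the strip over the `k`-th side. -/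
def height (k : ℕ) (s : ℝ) : ℝ := if D.strip k then tent (s / 2) else 0

lemma height_nonneg (k : ℕ) (s : ℝ) : 0 ≤ D.height k s := by
  unfold height; split_ifs; exacts [tent_nonneg _, le_rfl]

lemma height_le_one (k : ℕ) (s : ℝ) : D.height k s ≤ 1 := by
  unfold height; split_ifs; exacts [tent_le_one _, zero_le_one]

lemma height_eq_one_iff {k : ℕ} {s : ℝ} :
    D.height k s = 1 ↔ D.strip k ∧ s ∈ Icc (0 : ℝ) 1 := by
  unfold height
  split_ifs with h
  · rw [tent_eq_one_iff]
    simp only [h, true_and, mem_Icc]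
    constructor <;> rintro ⟨h1, h2⟩ <;> constructor <;> linarith
  · simp [h]

@[fun_prop] lemma continuous_height (k : ℕ) : Continuous (D.height k) := by
  unfold height; split_ifs <;> fun_prop

lemma continuous_bump : Continuous D.bump := by
  unfold bump
  refine continuous_const.add (continuous_finsetSum _ fun k _ => ?_)
  split_ifs <;> fun_prop

lemma one_le_bump (y : ℝ) : 1 ≤ D.bump y := by
  unfold bump
  exact le_add_of_nonneg_right (Finset.sum_nonneg fun k _ => by
    split_ifs; exacts [tent_nonneg _, le_rfl])

lemma bump_side {k : ℕ} (hk : k < numSides g' r') {s : ℝ} (hs : s ∈ Icc (-1 / 4 : ℝ) (5 / 4)) :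
    D.bump (k + s / 2) = 1 + D.height k s := by
  unfold bump height
  congr 1
  rw [Finset.sum_eq_single k]
  · simp
  · intro j _ hjk
    split_ifs
    · refine tent_eq_zero ?_
      rcases lt_or_gt_of_ne hjk with h | h
      · have : (j : ℝ) + 1 ≤ k := by exact_mod_cast h
        right; linarith [hs.1]
      · have : (k : ℝ) + 1 ≤ j := by exact_mod_cast h
        left; linarith [hs.2]
    · rfl
  · intro h; exact absurd (Finset.mem_range.2 hk) h

lemma bump_begin : D.bump (-1 / 8) = 1 := by
  unfold bump
  rw [Finset.sum_eq_zero, add_zero]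
  intro j _
  split_ifs
  · exact tent_eq_zero (Or.inl (by have : (0 : ℝ) ≤ j := j.cast_nonneg; linarith))
  · rfl

lemma bump_end : D.bump (numSides g' r' - 1 / 8) = 1 := by
  unfold bump
  rw [Finset.sum_eq_zero, add_zero]
  intro j hj
  split_ifs
  · refine tent_eq_zero (Or.inr ?_)
    have : (j : ℝ) + 1 ≤ numSides g' r' := by exact_mod_cast Finset.mem_range.1 hj
    linarith
  · rfl

lemma exists_of_bump {y : ℝ} (h : 1 < D.bump y) :
    ∃ k < numSides g' r', D.strip k ∧ ∃ s ∈ Icc (-1 / 4 : ℝ) (5 / 4), y = k + s / 2 := by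
  by_contra hc
  push Not at hc
  refine h.ne' ?_
  unfold bump
  rw [Finset.sum_eq_zero, add_zero]
  intro j hj
  split_ifs with hs
  · refine tent_eq_zero ?_
    by_contra hcon
    push Not at hcon
    refine hc j (Finset.mem_range.1 hj) hs (2 * (y - j)) ⟨by linarith [hcon.1], by linarith [hcon.2]⟩ ?_
    ring
  · rfl

end Bump

/-- The thickened disc, in the source. -/
def mainSource (ρ y : ℝ) : Disc := Disc.polar (ρ / D.bump y) (y / numSides g' r')

/-- The thickened disc, in the target. -/
def mainTarget (ρ y : ℝ) : Disc :=
  Disc.polar (ρ * D.reach (D.angle y)) (D.angle y / numSides g r)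

/-- The strip, in the source. -/
def stripSource (k : ℕ) (t s : ℝ) : Disc :=
  Disc.polar ((1 + t * D.height k s) / (1 + D.height k s)) ((k + s / 2) / numSides g' r')

/-- The path of the strip, in the target. -/
def stripPath (k : ℕ) (τ s : ℝ) : Disc :=
  Disc.polar (1 - τ * (1 - τ) * (D.exit k s - D.entry k s) ^ 2 / (numSides g r : ℝ) ^ 2)
    ((D.entry k s + τ * (D.exit k s - D.entry k s)) / numSides g r)

/-- The strip, in the target. -/
def stripTarget (k : ℕ) (t s : ℝ) : Disc := D.stripPath k (t * D.height k s) s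

/-- The correspondence between the two discs. -/
inductive Rel : Disc → Disc → Prop
  | main {ρ y : ℝ} (hρ : ρ ∈ Icc (0 : ℝ) 1) (hy : y ∈ Ico (-1 / 8 : ℝ) (-1 / 8 + numSides g' r')) :
    Rel (D.mainSource ρ y) (D.mainTarget ρ y)
  | strip {k : ℕ} {t s : ℝ} (hk : k < numSides g' r') (hks : D.strip k) (ht : t ∈ Icc (0 : ℝ) 1)
    (hs : s ∈ Icc (-1 / 4 : ℝ) (5 / 4)) : Rel (D.stripSource k t s) (D.stripTarget k t s)

lemma index_mem {k : ℕ} (hk : k < numSides g' r') {s : ℝ} (hs : s ∈ Icc (-1 / 4 : ℝ) (5 / 4)) :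
    (k + s / 2 : ℝ) ∈ Ico (-1 / 8 : ℝ) (-1 / 8 + numSides g' r') := by
  have h0 : (0 : ℝ) ≤ k := k.cast_nonneg
  have h1 : (k : ℝ) + 1 ≤ numSides g' r' := by exact_mod_cast hk
  constructor <;> linarith [hs.1, hs.2]

lemma index_inj {k j : ℕ} {s t : ℝ} (hs : s ∈ Icc (-1 / 4 : ℝ) (5 / 4))
    (ht : t ∈ Icc (-1 / 4 : ℝ) (5 / 4)) (h : (k + s / 2 : ℝ) = j + t / 2) : k = j ∧ s = t := by
  have : k = j := by
    rcases lt_trichotomy k j with h1 | h1 | h1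
    · have : (k : ℝ) + 1 ≤ j := by exact_mod_cast h1
      linarith [hs.1, hs.2, ht.1, ht.2]
    · exact h1
    · have : (j : ℝ) + 1 ≤ k := by exact_mod_cast h1
      linarith [hs.1, hs.2, ht.1, ht.2]
  subst this
  exact ⟨rfl, by linarith⟩

lemma Icc_subset {s : ℝ} (hs : s ∈ Icc (0 : ℝ) 1) : s ∈ Icc (-1 / 4 : ℝ) (5 / 4) :=
  ⟨by linarith [hs.1], by linarith [hs.2]⟩

lemma mainSource_radius {ρ : ℝ} (hρ : ρ ∈ Icc (0 : ℝ) 1) (y : ℝ) :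
    ρ / D.bump y ∈ Icc (0 : ℝ) 1 := by
  have := D.one_le_bump y
  exact ⟨div_nonneg hρ.1 (by linarith), (div_le_one (by linarith)).2 (by linarith [hρ.2])⟩

lemma mainTarget_radius {ρ : ℝ} (hρ : ρ ∈ Icc (0 : ℝ) 1) (y : ℝ) :
    ρ * D.reach y ∈ Icc (0 : ℝ) 1 := by
  have := D.reach_mem y
  exact ⟨mul_nonneg hρ.1 (by linarith [this.1]), mul_le_one₀ hρ.2 (by linarith [this.1]) this.2⟩

lemma stripSource_radius {t : ℝ} (ht : t ∈ Icc (0 : ℝ) 1) (k : ℕ) (s : ℝ) :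
    0 < (1 + t * D.height k s) / (1 + D.height k s) ∧
      (1 + t * D.height k s) / (1 + D.height k s) ≤ 1 := by
  have h := D.height_nonneg k s
  have : t * D.height k s ≤ D.height k s := mul_le_of_le_one_left h ht.2
  have h' : 0 ≤ t * D.height k s := mul_nonneg ht.1 h
  exact ⟨by positivity, (div_le_one (by linarith)).2 (by linarith)⟩

lemma height_mul_mem {t : ℝ} (ht : t ∈ Icc (0 : ℝ) 1) (k : ℕ) (s : ℝ) :
    t * D.height k s ∈ Icc (0 : ℝ) 1 :=
  ⟨mul_nonneg ht.1 (D.height_nonneg k s), mul_le_one₀ ht.2 (D.height_nonneg k s) (D.height_le_one k s)⟩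

section Strip

variable {k : ℕ} (hk : k < numSides g' r') (hks : D.strip k) {s : ℝ}
  (hs : s ∈ Icc (-1 / 4 : ℝ) (5 / 4)) {τ : ℝ} (hτ : τ ∈ Icc (0 : ℝ) 1)

include hk hks hs

lemma strip_gap : |D.exit k s - D.entry k s| ≤ numSides g r := by
  have h1 : D.entry k s ∈ Icc (D.lo k) (D.hi k) := D.entry_mem k hk hks s hs
  have h2 : D.exit k s ∈ Icc (D.lo k) (D.hi k) := D.exit_mem k hk hks s hs
  have h3 : D.origin ≤ D.lo k := D.lo_ge k hk hks
  have h4 : D.hi k < D.origin + numSides g r := D.hi_lt k hk hks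
  rw [abs_le]
  constructor <;> linarith [h1.1, h1.2, h2.1, h2.2]

include hτ

lemma strip_angle_mem : D.entry k s + τ * (D.exit k s - D.entry k s) ∈ Icc (D.lo k) (D.hi k) := by
  have h1 : D.entry k s ∈ Icc (D.lo k) (D.hi k) := D.entry_mem k hk hks s hs
  have h2 : D.exit k s ∈ Icc (D.lo k) (D.hi k) := D.exit_mem k hk hks s hs
  constructor <;> nlinarith [h1.1, h1.2, h2.1, h2.2, hτ.1, hτ.2]

lemma strip_angle_mem_Ico : D.entry k s + τ * (D.exit k s - D.entry k s) ∈
    Ico D.origin (D.origin + numSides g r) := by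
  have h := D.strip_angle_mem hk hks hs hτ
  have h3 : D.origin ≤ D.lo k := D.lo_ge k hk hks
  have h4 : D.hi k < D.origin + numSides g r := D.hi_lt k hk hks
  exact ⟨h3.trans h.1, h.2.trans_lt h4⟩

/-- The bound follows from `τ * (1 - τ) ≤ 1 / 4` and from the gap being at most one period. -/
lemma strip_radius : 1 - τ * (1 - τ) * (D.exit k s - D.entry k s) ^ 2 / (numSides g r : ℝ) ^ 2 ∈
    Icc (3 / 4 : ℝ) 1 := by
  have hm : (0 : ℝ) < numSides g r := by exact_mod_cast D.target_pos
  have h1 : (D.exit k s - D.entry k s) ^ 2 / (numSides g r : ℝ) ^ 2 ≤ 1 := by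
    rw [div_le_one (by positivity)]
    exact sq_le_sq.2 (by rw [abs_of_pos hm]; exact D.strip_gap hk hks hs)
  have h2 : 0 ≤ (D.exit k s - D.entry k s) ^ 2 / (numSides g r : ℝ) ^ 2 := by positivity
  have h3 : 0 ≤ τ * (1 - τ) := mul_nonneg hτ.1 (by linarith [hτ.2])
  have h4 : τ * (1 - τ) ≤ 1 / 4 := by nlinarith [sq_nonneg (τ - 1 / 2)]
  rw [mul_div_assoc]
  constructor <;> nlinarith

/-- At angle x an arc has radius 1 - (x - entry)(exit - x)/m², where m is the number of target
sides. Crossing a glued side reverses direction, so entry + exit does not depend on `s`, whereas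
exit - entry is strictly monotone in `s`. The arcs of one strip are therefore nested around a common
midpoint and disjoint. Different strips have disjoint ranges of angles. -/
lemma stripPath_inj {j : ℕ} (hj : j < numSides g' r') (hjs : D.strip j) {t τ' : ℝ}
    (ht : t ∈ Icc (-1 / 4 : ℝ) (5 / 4)) (hτ' : τ' ∈ Icc (0 : ℝ) 1)
    (h : D.stripPath k τ s = D.stripPath j τ' t) : k = j ∧ s = t ∧ τ = τ' := by
  have hr := D.strip_radius hk hks hs hτ
  have hr' := D.strip_radius hj hjs ht hτ'
  have ha := D.strip_angle_mem hk hks hs hτ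
  have ha' := D.strip_angle_mem hj hjs ht hτ'
  obtain ⟨h1, h2⟩ := Disc.polar_inj (by linarith [hr.1]) hr.2 ⟨by linarith [hr'.1], hr'.2⟩
    (D.strip_angle_mem_Ico hk hks hs hτ) (D.strip_angle_mem_Ico hj hjs ht hτ') h
  have hkj : k = j := by
    by_contra hne
    rcases D.strip_strip k hk hks j hj hjs hne with h | h
    · linarith [ha.2, ha'.1]
    · linarith [ha.1, ha'.2]
  subst hkj
  have hm : (0 : ℝ) < numSides g r := by exact_mod_cast D.target_pos
  have h1' : τ * (1 - τ) * (D.exit k s - D.entry k s) ^ 2 =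
      τ' * (1 - τ') * (D.exit k t - D.entry k t) ^ 2 := by
    have h0 := sub_right_injective h1
    field_simp at h0
    linarith
  have hsum : D.exit k s + D.entry k s = D.exit k t + D.entry k t := by
    unfold exit entry; ring
  have hdiff : D.exit k s - D.entry k s - (D.exit k t - D.entry k t) =
      2 * (sideLen r * D.width k) * (s - t) := by
    unfold exit entry; ring
  -- As the midpoint is constant, equal angles give equal (τ - 1/2)·gap, and equal radii give equal
  -- (1/4 - (τ - 1/2)²)·gap². Hence the squared gaps agree, and `entry_exit` settles the sign.
  have hsq : (D.exit k s - D.entry k s) ^ 2 = (D.exit k t - D.entry k t) ^ 2 := by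
    have e1 : (τ - 1 / 2) * (D.exit k s - D.entry k s) =
        (τ' - 1 / 2) * (D.exit k t - D.entry k t) := by linarith
    have e2 := congrArg (· ^ 2) e1
    nlinarith
  have hgap : D.exit k s - D.entry k s = D.exit k t - D.entry k t ∧
      D.exit k s - D.entry k s ≠ 0 := by
    rcases sq_eq_sq_iff_eq_or_eq_neg.1 hsq with e | e
    · refine ⟨e, ?_⟩
      rcases D.entry_exit k hk hks with hh | hh
      · exact (hh s hs).ne'
      · exact (hh s hs).ne
    · exfalso
      rcases D.entry_exit k hk hks with hh | hh
      · have a1 : 0 < D.exit k s - D.entry k s := hh s hs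
        have a2 : 0 < D.exit k t - D.entry k t := hh t ht
        linarith
      · have a1 : D.exit k s - D.entry k s < 0 := hh s hs
        have a2 : D.exit k t - D.entry k t < 0 := hh t ht
        linarith
  have hst : s = t := by
    have h0 : 2 * (sideLen r * D.width k) * (s - t) = 0 := by rw [← hdiff, hgap.1, sub_self]
    have hpos : 0 < 2 * (sideLen r * D.width k) := by
      have := mul_pos (sideLen_pos r) (D.width_pos k hk); linarith
    have := (mul_eq_zero.1 h0).resolve_left hpos.ne'
    linarith
  subst hst
  refine ⟨rfl, rfl, ?_⟩
  have : (τ - τ') * (D.exit k s - D.entry k s) = 0 := by linarith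
  have := (mul_eq_zero.1 this).resolve_right hgap.2
  linarith

end Strip

lemma stripPath_zero (k : ℕ) (s : ℝ) : D.stripPath k 0 s =
    side g r (partner g (D.first k)) (1 - (D.start k + D.width k * s)) := by
  rw [← D.turn_entry, stripPath]; congr 1 <;> ring

lemma stripPath_one (k : ℕ) (s : ℝ) : D.stripPath k 1 s =
    side g r (D.last k) (D.startLast k + D.width k * s) := by
  rw [← D.turn_exit, stripPath]; congr 1 <;> ring

lemma mainTarget_leg {k : ℕ} (hk : k < numSides g' r') {s : ℝ} (hs : s ∈ D.contact k) :
    D.mainTarget 1 (k + s / 2) = side g r (D.first k) (D.start k + D.width k * s) := by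
  rw [mainTarget, D.angle_leg hk hs.1, D.reach_pos hk hs, mul_one, D.turn_pos]

/-- Existence of a point of the correspondence over a side. -/
lemma rel_side {k : ℕ} (hk : k < numSides g' r') {s : ℝ} (hs : s ∈ Icc (0 : ℝ) 1) :
    D.Rel (side g' r' k s) (side g r (D.last k) (D.startLast k + D.width k * s)) := by
  have hs' := Icc_subset hs
  by_cases hks : D.strip k
  · have h1 : D.height k s = 1 := D.height_eq_one_iff.2 ⟨hks, hs⟩
    have := Rel.strip (D := D) hk hks (t := 1) (by simp) hs'
    rw [stripTarget, h1, one_mul, D.stripPath_one, stripSource, h1, one_mul,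
      div_self (by norm_num), ← D.side_source] at this
    exact this
  · have := Rel.main (D := D) (ρ := 1) (by simp) (index_mem hk hs')
    rw [mainSource, D.bump_side hk hs', height, if_neg hks, add_zero, div_one, ← D.side_source,
      D.mainTarget_leg hk ⟨hs', Or.inr hs⟩] at this
    rw [D.last_eq k hk hks, D.startLast_eq k hk hks]
    exact this

/-- In direction `y` the main part fills the radii up to `1 / D.bump y`. A collar remains only over
the sides that carry a strip, and there the strip fills it. -/
lemma exists_rel (a : Disc) : ∃ b, D.Rel a b := by
  obtain ⟨ρ, hρ, y, hy, rfl⟩ := Disc.exists_polar D.numSides_pos (-1 / 8) a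
  have hb := D.one_le_bump y
  rcases le_or_gt (ρ * D.bump y) 1 with h | h
  · have := Rel.main (D := D) (ρ := ρ * D.bump y)
      ⟨mul_nonneg hρ.1 (by linarith), h⟩ hy
    rw [mainSource, mul_div_cancel_right₀ _ (by linarith)] at this
    exact ⟨_, this⟩
  · have h1 : 1 < D.bump y := by nlinarith [hρ.2]
    obtain ⟨k, hk, hks, s, hs, rfl⟩ := D.exists_of_bump h1
    rw [D.bump_side hk hs] at h h1
    have hpos : 0 < D.height k s := by linarith
    have := Rel.strip (D := D) (t := (ρ * (1 + D.height k s) - 1) / D.height k s) hk hks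
      ⟨div_nonneg (by linarith) hpos.le, (div_le_one hpos).2 (by nlinarith [hρ.2])⟩ hs
    rw [stripSource, div_mul_cancel₀ _ hpos.ne', add_sub_cancel,
      mul_div_cancel_right₀ _ (by linarith)] at this
    exact ⟨_, this⟩

/-- Main part and strip meet in the source only where the strip begins. In the target the leg ends
there on the side `first k` and the strip starts at the glued point of the partner side, so the two
values agree in the surface. -/
lemma rel_congr_aux {k : ℕ} (hk : k < numSides g' r') {t s ρ y : ℝ}
    (ht : t ∈ Icc (0 : ℝ) 1) (hs : s ∈ Icc (-1 / 4 : ℝ) (5 / 4)) (hks : D.strip k)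
    (hρ : ρ ∈ Icc (0 : ℝ) 1) (hy : y ∈ Ico (-1 / 8 : ℝ) (-1 / 8 + numSides g' r'))
    (h : D.stripSource k t s = D.mainSource ρ y) :
    proj g r (D.stripTarget k t s) = proj g r (D.mainTarget ρ y) := by
  obtain ⟨h1, rfl⟩ := Disc.polar_inj (D.stripSource_radius ht k s).1
    (D.stripSource_radius ht k s).2 (D.mainSource_radius hρ y) (index_mem hk hs) hy h
  have hh := D.height_nonneg k s
  have hth := D.height_mul_mem ht k s
  rw [D.bump_side hk hs, div_left_inj' (by linarith)] at h1
  have h0 : t * D.height k s = 0 := by linarith [hth.1, hρ.2]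
  obtain rfl : ρ = 1 := by linarith
  rw [stripTarget, h0, D.stripPath_zero, D.mainTarget_leg hk ⟨hs, Or.inl hks⟩]
  exact (proj_side (D.first_lt k hk) (Ioo_subset_Icc_self (D.param_mem hk hs))).symm

lemma rel_congr {a b b' : Disc} (h : D.Rel a b) (h' : D.Rel a b') :
    proj g r b = proj g r b' := by
  generalize ha : a = a' at h'
  cases h with
  | @main ρ y hρ hy =>
    cases h' with
    | @main ρ' y' hρ' hy' =>
      rcases hρ.1.eq_or_lt with rfl | hpos
      · have : ρ' = 0 := by
          rcases hρ'.1.eq_or_lt with h0 | hpos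
          · exact h0.symm
          · have hb := D.one_le_bump y'
            have := (Disc.polar_inj (div_pos hpos (by linarith)) (D.mainSource_radius hρ' y').2
              (D.mainSource_radius hρ y) hy' hy ha.symm).1
            rw [zero_div] at this
            exact absurd this (div_pos hpos (by linarith)).ne'
        subst this
        simp only [mainTarget, zero_mul, Disc.polar_zero]
      · have hb := D.one_le_bump y
        obtain ⟨h1, rfl⟩ := Disc.polar_inj (div_pos hpos (by linarith)) (D.mainSource_radius hρ y).2
          (D.mainSource_radius hρ' y') hy hy' ha
        rw [div_left_inj' (by linarith)] at h1
        rw [h1]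
    | strip hk hks ht hs => exact (D.rel_congr_aux hk ht hs hks hρ hy ha.symm).symm
  | @strip k t s hk hks ht hs =>
    cases h' with
    | main hρ' hy' => exact D.rel_congr_aux hk ht hs hks hρ' hy' ha
    | @strip j t' s' hj hjs ht' hs' =>
      obtain ⟨h1, h2⟩ := Disc.polar_inj (D.stripSource_radius ht k s).1
        (D.stripSource_radius ht k s).2 ⟨(D.stripSource_radius ht' j s').1.le,
          (D.stripSource_radius ht' j s').2⟩ (index_mem hk hs) (index_mem hj hs') ha
      obtain ⟨rfl, rfl⟩ := index_inj hs hs' h2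
      have hh := D.height_nonneg k s
      rw [div_left_inj' (by linarith)] at h1
      rw [stripTarget, stripTarget, add_left_cancel h1]

/-- Glued sides of the source are sent to glued sides of the target because `last`, `startLast` and
`width` respect the pairing. Transitivity needs a point of the target corresponding to the
intermediate point, supplied by `exists_rel`. -/
lemma rel_congr_proj {a a' : Disc} (h : proj g' r' a = proj g' r' a') :
    ∀ {b b' : Disc}, D.Rel a b → D.Rel a' b' → proj g r b = proj g r b' := by
  have := proj_eq_iff h
  clear h
  induction this with
  | rel a a' h =>
    intro b b' hb hb'
    obtain ⟨k, hk, s, hs, rfl, rfl⟩ := h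
    have hs' : 1 - s ∈ Icc (0 : ℝ) 1 := ⟨by linarith [hs.2], by linarith [hs.1]⟩
    rw [D.rel_congr hb (D.rel_side hk hs), D.rel_congr hb' (D.rel_side (partner_lt hk) hs'),
      D.last_partner k hk, D.startLast_partner k hk, D.width_partner k hk,
      proj_side (D.last_lt k hk) (Ioo_subset_Icc_self (D.paramLast_mem hk hs))]
    congr 2; ring
  | refl a => intro b b' hb hb'; exact D.rel_congr hb hb'
  | symm a a' _ ih => intro b b' hb hb'; exact (ih hb' hb).symm
  | trans a c a' _ _ ih ih' =>
    intro b b' hb hb'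
    obtain ⟨d, hd⟩ := D.exists_rel c
    exact (ih hb hd).trans (ih' hd hb')

/-- In the directions of a strip the main part has radius at most `1/2`, the strip at least `3/4`.
-/
lemma mainTarget_ne_strip {k : ℕ} (hk : k < numSides g' r') (hks : D.strip k) {t s ρ y : ℝ}
    (ht : t ∈ Icc (0 : ℝ) 1) (hs : s ∈ Icc (-1 / 4 : ℝ) (5 / 4))
    (hρ : ρ ∈ Icc (0 : ℝ) 1) (hy : y ∈ Ico (-1 / 8 : ℝ) (-1 / 8 + numSides g' r')) :
    D.stripTarget k t s ≠ D.mainTarget ρ y := by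
  intro h
  have hτ := D.height_mul_mem ht k s
  have hr := D.strip_radius hk hks hs hτ
  obtain ⟨h1, h2⟩ := Disc.polar_inj (by linarith [hr.1]) hr.2 (D.mainTarget_radius hρ _)
    (D.strip_angle_mem_Ico hk hks hs hτ) (D.angle_mem hy) h
  rw [← h2, D.reach_strip hk hks (D.strip_angle_mem hk hks hs hτ)] at h1
  linarith [hr.1, hρ.2]

lemma rel_inj {a a' b : Disc} (h : D.Rel a b) (h' : D.Rel a' b) : a = a' := by
  generalize hb : b = b' at h'
  cases h with
  | @main ρ y hρ hy =>
    cases h' with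
    | @main ρ' y' hρ' hy' =>
      have hv := D.reach_mem (D.angle y)
      have hv' := D.reach_mem (D.angle y')
      rcases hρ.1.eq_or_lt with rfl | hpos
      · have : ρ' = 0 := by
          rcases hρ'.1.eq_or_lt with h0 | hpos
          · exact h0.symm
          · have hp : 0 < ρ' * D.reach (D.angle y') := mul_pos hpos (by linarith [hv'.1])
            have := (Disc.polar_inj hp (D.mainTarget_radius hρ' _).2
              (D.mainTarget_radius hρ (D.angle y)) (D.angle_mem hy') (D.angle_mem hy) hb.symm).1
            rw [zero_mul] at this
            exact absurd this hp.ne'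
        subst this
        simp only [mainSource, zero_div, Disc.polar_zero]
      · have hp : 0 < ρ * D.reach (D.angle y) := mul_pos hpos (by linarith [hv.1])
        obtain ⟨h1, h2⟩ := Disc.polar_inj hp (D.mainTarget_radius hρ _).2
          (D.mainTarget_radius hρ' _) (D.angle_mem hy) (D.angle_mem hy') hb
        have h3 := D.strictMono_angle.injective h2
        subst h3
        rw [mul_right_cancel₀ (by linarith [hv.1]) h1]
    | strip hk hks ht hs => exact absurd hb.symm (D.mainTarget_ne_strip hk hks ht hs hρ hy)
  | @strip k t s hk hks ht hs =>
    cases h' with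
    | main hρ' hy' => exact absurd hb (D.mainTarget_ne_strip hk hks ht hs hρ' hy')
    | @strip j t' s' hj hjs ht' hs' =>
      obtain ⟨rfl, rfl, h3⟩ := D.stripPath_inj hk hks hs (D.height_mul_mem ht k s) hj hjs hs'
        (D.height_mul_mem ht' j s') hb
      rw [stripSource, h3, ← stripSource]

lemma exists_rel_of_glue_last {k i : ℕ} (hk : k < numSides g' r') {s : ℝ}
    (hs : s ∈ Icc (0 : ℝ) 1) {c : Disc}
    (hc : glueAt g r i (side g r (D.last k) (D.startLast k + D.width k * s)) c) :
    ∃ a', D.Rel a' c ∧ proj g' r' a' = proj g' r' (side g' r' k s) := by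
  obtain ⟨hi, s₀, hs₀, h1, rfl⟩ := hc
  obtain ⟨rfl, rfl⟩ := side_inj hi (D.last_lt k hk) hs₀ (D.paramLast_mem hk hs) h1.symm
  have hs' : 1 - s ∈ Icc (0 : ℝ) 1 := ⟨by linarith [hs.2], by linarith [hs.1]⟩
  have := D.rel_side (partner_lt hk) hs'
  rw [D.last_partner k hk, D.startLast_partner k hk, D.width_partner k hk,
    (by ring : 1 - D.startLast k - D.width k + D.width k * (1 - s) =
      1 - (D.startLast k + D.width k * s))] at this
  exact ⟨_, this, (proj_side hk hs).symm⟩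

/-- This is saturation. A point of the image on a side is the end of a leg continued by a strip, the
beginning of a strip, or the image of a point of a source side. Gluing exchanges the first two
kinds, which come from the same source point, and takes the third to the image of the partner side.
-/
lemma exists_rel_of_glue {a b c : Disc} (h : D.Rel a b) {i : ℕ} (hc : glueAt g r i b c) :
    ∃ a', D.Rel a' c ∧ proj g' r' a' = proj g' r' a := by
  cases h with
  | @main ρ y hρ hy =>
    obtain ⟨hi, s₀, hs₀, h1, hc2⟩ := id hc
    have hv := D.reach_mem (D.angle y)
    have hr : ρ * D.reach (D.angle y) = 1 := by
      have e := congrArg (fun x : Disc => ‖(x : ℂ)‖) h1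
      simp only [mainTarget, Disc.coe_polar (D.mainTarget_radius hρ _), side, Disc.turn, norm_mul,
        norm_turn, mul_one, Complex.norm_real, Real.norm_eq_abs] at e
      rwa [← abs_mul, abs_of_nonneg (D.mainTarget_radius hρ (D.angle y)).1] at e
    have hρ1 : ρ = 1 := by nlinarith [hρ.1, hρ.2, hv.1, hv.2]
    subst hρ1
    rw [one_mul] at hr
    obtain ⟨k, hk, s, hs, hks⟩ := D.exists_of_reach_eq_one (D.angle_mem hy) hr
    rw [← D.angle_leg hk hs.1] at hks
    have := D.strictMono_angle.injective hks
    subst this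
    by_cases hst : D.strip k
    · rw [D.mainTarget_leg hk hs] at h1
      obtain ⟨rfl, rfl⟩ := side_inj hi (D.first_lt k hk) hs₀ (D.param_mem hk hs.1) h1.symm
      have := Rel.strip (D := D) hk hst (t := 0) (by simp) hs.1
      rw [stripTarget, zero_mul, D.stripPath_zero, ← hc2] at this
      refine ⟨_, this, ?_⟩
      rw [stripSource, mainSource, D.bump_side hk hs.1, zero_mul, add_zero]
    · have hs01 := hs.2.resolve_left hst
      have e1 : D.mainSource 1 (k + s / 2) = side g' r' k s := by
        rw [mainSource, D.bump_side hk hs.1, height, if_neg hst, add_zero, div_one, D.side_source]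
      rw [D.mainTarget_leg hk hs, ← D.last_eq k hk hst, ← D.startLast_eq k hk hst] at hc
      rw [e1]
      exact D.exists_rel_of_glue_last hk hs01 hc
  | @strip k t s hk hks ht hs =>
    have hτ := D.height_mul_mem ht k s
    have hm : (0 : ℝ) < numSides g r := by exact_mod_cast D.target_pos
    -- A strip reaches radius one only at its two ends, because the gap between entry and exit does
    -- not vanish.
    have hr : t * D.height k s * (1 - t * D.height k s) = 0 := by
      obtain ⟨hi, s₀, hs₀, h1, -⟩ := hc
      have hrad := D.strip_radius hk hks hs hτ
      have e := congrArg (fun x : Disc => ‖(x : ℂ)‖) h1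
      have hrad' : (1 - t * D.height k s * (1 - t * D.height k s) *
          (D.exit k s - D.entry k s) ^ 2 / (numSides g r : ℝ) ^ 2) ∈ Icc (0 : ℝ) 1 :=
        ⟨by linarith [hrad.1], hrad.2⟩
      simp only [stripTarget, stripPath, Disc.coe_polar hrad', side, Disc.turn, norm_mul,
        norm_turn, mul_one, Complex.norm_real, Real.norm_eq_abs, abs_of_nonneg hrad'.1] at e
      have hX : D.exit k s - D.entry k s ≠ 0 := by
        rcases D.entry_exit k hk hks with hh | hh
        · exact (hh s hs).ne'
        · exact (hh s hs).ne
      have e' : t * D.height k s * (1 - t * D.height k s) * (D.exit k s - D.entry k s) ^ 2 /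
          (numSides g r : ℝ) ^ 2 = 0 := by linarith
      rw [div_eq_zero_iff] at e'
      rcases e' with e' | e'
      · exact (mul_eq_zero.1 e').resolve_right (pow_ne_zero _ hX)
      · exact absurd e' (pow_ne_zero _ hm.ne')
    rcases mul_eq_zero.1 hr with h0 | h0
    · rw [stripTarget, h0, D.stripPath_zero] at hc
      obtain ⟨hi, s₀, hs₀, h1, rfl⟩ := hc
      have hp := D.param_mem hk hs
      obtain ⟨rfl, rfl⟩ := side_inj hi (partner_lt (D.first_lt k hk)) hs₀
        ⟨by linarith [hp.2], by linarith [hp.1]⟩ h1.symm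
      rw [partner_partner (D.first_lt k hk), sub_sub_cancel,
        ← D.mainTarget_leg hk ⟨hs, Or.inl hks⟩]
      refine ⟨_, Rel.main (by simp) (index_mem hk hs), ?_⟩
      rw [stripSource, mainSource, D.bump_side hk hs, h0, add_zero]
    · have h1 : t * D.height k s = 1 := by linarith
      have hh : D.height k s = 1 := by
        nlinarith [D.height_le_one k s, D.height_nonneg k s, ht.1, ht.2]
      rw [stripTarget, h1, D.stripPath_one] at hc
      rw [stripSource, h1, hh, div_self (by norm_num), ← D.side_source]
      exact D.exists_rel_of_glue_last hk (D.height_eq_one_iff.1 hh).2 hc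

end Routing

/-! ### The embedding of a routing and its effect on fundamental groups -/

namespace Routing

variable {g' r' g r : ℕ} (D : Routing g' r' g r)

/-- The parameter space of the correspondence. -/
abbrev Param : Type :=
  (Icc (0 : ℝ) 1 × Icc (-1 / 8 : ℝ) (-1 / 8 + numSides g' r')) ⊕
    ({k : Fin (numSides g' r') // D.strip k} × Icc (0 : ℝ) 1 × Icc (-1 / 4 : ℝ) (5 / 4))

lemma continuous_mainSource : Continuous fun z : ℝ × ℝ => D.mainSource z.1 z.2 := by
  unfold mainSource
  have h1 : Continuous fun z : ℝ × ℝ => z.1 / D.bump z.2 :=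
    continuous_fst.div (D.continuous_bump.comp continuous_snd)
      fun z => (zero_lt_one.trans_le (D.one_le_bump z.2)).ne'
  fun_prop

lemma continuous_mainTarget : Continuous fun z : ℝ × ℝ => D.mainTarget z.1 z.2 := by
  unfold mainTarget
  have h1 : Continuous fun z : ℝ × ℝ => D.angle z.2 := D.continuous_angle.comp continuous_snd
  have h2 : Continuous fun z : ℝ × ℝ => D.reach (D.angle z.2) := D.continuous_reach.comp h1
  fun_prop

lemma continuous_stripSource (k : ℕ) : Continuous fun z : ℝ × ℝ => D.stripSource k z.1 z.2 := by
  unfold stripSource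
  have h0 : Continuous fun z : ℝ × ℝ => D.height k z.2 :=
    (D.continuous_height k).comp continuous_snd
  have h1 : Continuous fun z : ℝ × ℝ => (1 + z.1 * D.height k z.2) / (1 + D.height k z.2) :=
    (by fun_prop : Continuous fun z : ℝ × ℝ => 1 + z.1 * D.height k z.2).div (by fun_prop)
      fun z => by have := D.height_nonneg k z.2; positivity
  fun_prop

lemma continuous_stripTarget (k : ℕ) : Continuous fun z : ℝ × ℝ => D.stripTarget k z.1 z.2 := by
  unfold stripTarget stripPath
  have h0 : Continuous fun z : ℝ × ℝ => D.height k z.2 :=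
    (D.continuous_height k).comp continuous_snd
  have h1 : Continuous fun z : ℝ × ℝ => D.entry k z.2 := by unfold entry; fun_prop
  have h2 : Continuous fun z : ℝ × ℝ => D.exit k z.2 := by unfold exit; fun_prop
  fun_prop

/-- The projection of the correspondence to the source. -/
def source : C(D.Param, Disc) where
  toFun := Sum.elim (fun z => D.mainSource z.1 z.2) fun z => D.stripSource z.1.1 z.2.1 z.2.2
  continuous_toFun := by
    refine continuous_sumElim.2 ⟨?_, ?_⟩
    · exact D.continuous_mainSource.comp
        (f := fun z : Icc (0 : ℝ) 1 × Icc (-1 / 8 : ℝ) (-1 / 8 + numSides g' r') =>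
          ((z.1 : ℝ), (z.2 : ℝ))) (by fun_prop)
    · refine continuous_prod_of_discrete_left.2 fun k => ?_
      exact (D.continuous_stripSource k.1).comp
        (f := fun z : Icc (0 : ℝ) 1 × Icc (-1 / 4 : ℝ) (5 / 4) => ((z.1 : ℝ), (z.2 : ℝ)))
        (by fun_prop)

/-- The projection of the correspondence to the target. -/
def target : C(D.Param, Disc) where
  toFun := Sum.elim (fun z => D.mainTarget z.1 z.2) fun z => D.stripTarget z.1.1 z.2.1 z.2.2
  continuous_toFun := by
    refine continuous_sumElim.2 ⟨?_, ?_⟩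
    · exact D.continuous_mainTarget.comp
        (f := fun z : Icc (0 : ℝ) 1 × Icc (-1 / 8 : ℝ) (-1 / 8 + numSides g' r') =>
          ((z.1 : ℝ), (z.2 : ℝ))) (by fun_prop)
    · refine continuous_prod_of_discrete_left.2 fun k => ?_
      exact (D.continuous_stripTarget k.1).comp
        (f := fun z : Icc (0 : ℝ) 1 × Icc (-1 / 4 : ℝ) (5 / 4) => ((z.1 : ℝ), (z.2 : ℝ)))
        (by fun_prop)

lemma rel_source_target (z : D.Param) : D.Rel (D.source z) (D.target z) := by
  rcases z with ⟨ρ, y⟩ | ⟨k, t, s⟩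
  -- The parameter space contains the closing angle of the period for compactness, whereas `Rel`
  -- uses a half-open period. Both functions take the same value at its two ends.
  · rcases y.2.2.eq_or_lt with h | h
    · have hm : (0 : ℝ) < numSides g' r' := by exact_mod_cast D.numSides_pos
      have := Rel.main (D := D) ρ.2 (y := -1 / 8) ⟨le_rfl, by linarith⟩
      have e : (y : ℝ) = numSides g' r' - 1 / 8 := by rw [h]; ring
      have e' : (y : ℝ) = -1 / 8 + numSides g' r' := h
      have e1 : D.source (Sum.inl (ρ, y)) = D.mainSource ρ (-1 / 8) := by
        change D.mainSource ρ y = _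
        rw [mainSource, mainSource, e, D.bump_end, D.bump_begin, ← e, e',
          Disc.polar_add_period D.numSides_pos]
      have e2 : D.target (Sum.inl (ρ, y)) = D.mainTarget ρ (-1 / 8) := by
        change D.mainTarget ρ y = _
        rw [mainTarget, mainTarget, e, D.angle_end, D.angle_begin, D.reach_add,
          Disc.polar_add_period D.target_pos]
      rw [e1, e2]
      exact this
    · exact Rel.main ρ.2 ⟨y.2.1, h⟩
  · exact Rel.strip k.1.2 k.2 t.2 s.2

lemma exists_param {a b : Disc} (h : D.Rel a b) : ∃ z, D.source z = a ∧ D.target z = b := by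
  cases h with
  | main hρ hy => exact ⟨Sum.inl (⟨_, hρ⟩, ⟨_, Ico_subset_Icc_self hy⟩), rfl, rfl⟩
  | strip hk hks ht hs => exact ⟨Sum.inr (⟨⟨_, hk⟩, hks⟩, ⟨_, ht⟩, ⟨_, hs⟩), rfl, rfl⟩

lemma isQuotientMap_source : IsQuotientMap ((proj g' r').comp D.source) := by
  have hs : Function.Surjective D.source := fun a => by
    obtain ⟨b, hb⟩ := D.exists_rel a
    obtain ⟨z, hz, -⟩ := D.exists_param hb
    exact ⟨z, hz⟩
  exact (isQuotientMap_proj g' r').comp (IsQuotientMap.of_surjective_continuous hs D.source.continuous)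

theorem exists_embedding : ∃ e : C(Model g' r', Model g r), IsEmbedding e ∧
    ∀ z, e (proj g' r' (D.source z)) = proj g r (D.target z) := by
  refine exists_isEmbedding_of_correspondence (isQuotientMap_proj g r)
    (fun x y h => proj_eq_iff h) (fun x y ⟨k, h⟩ => ⟨_, glueAt_symm h⟩)
    D.isQuotientMap_source D.target ?_ ?_ ?_
  · intro z w h
    exact D.rel_congr_proj h (D.rel_source_target z) (D.rel_source_target w)
  · intro z w h
    have := D.rel_source_target w
    rw [← h] at this
    exact congrArg (proj g' r') (D.rel_inj (D.rel_source_target z) this)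
  · rintro z y ⟨i, hi⟩
    obtain ⟨a', ha', hpa⟩ := D.exists_rel_of_glue (D.rel_source_target z) hi
    obtain ⟨w, rfl, hw⟩ := D.exists_param ha'
    exact ⟨w, hw, hpa⟩

/-- The embedding defined by a routing. -/
def emb : C(Model g' r', Model g r) := D.exists_embedding.choose

lemma isEmbedding_emb : IsEmbedding D.emb := D.exists_embedding.choose_spec.1

lemma emb_source (z : D.Param) : D.emb (proj g' r' (D.source z)) = proj g r (D.target z) :=
  D.exists_embedding.choose_spec.2 z

lemma emb_of_rel {a b : Disc} (h : D.Rel a b) : D.emb (proj g' r' a) = proj g r b := by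
  obtain ⟨z, rfl, rfl⟩ := D.exists_param h
  exact D.emb_source z

lemma map_seg_emb {z₁ z₂ : D.Param} (h : Joined z₁ z₂) {a a' b b' : Disc}
    (ha : D.source z₁ = a) (ha' : D.source z₂ = a') (hb : D.target z₁ = b)
    (hb' : D.target z₂ = b') (e1 : D.emb (proj g' r' a) = proj g r b)
    (e2 : D.emb (proj g' r' a') = proj g r b') :
    (seg (proj g' r') a a').map D.emb = (seg (proj g r) b b').cast e1 e2 := by
  subst ha ha' hb hb'
  exact map_seg_of_path D.emb_source h.somePath

lemma emb_base : D.emb (base g' r') = base g r := by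
  have hm : (1 : ℝ) ≤ numSides g' r' := by exact_mod_cast D.numSides_pos
  have := D.emb_of_rel (Rel.main (D := D) (ρ := 0) (y := 0) (by simp) ⟨by norm_num, by linarith⟩)
  simpa only [mainSource, mainTarget, zero_div, zero_mul, Disc.polar_zero] using this

open Classical in
/-- The loop along which the strips of the `k`-th side run before they reach the `last` side. -/
def detour (k : ℕ) : FundamentalGroup (Model g r) (base g r) :=
  if D.strip k then sideLoop g r (D.first k) else 1

lemma joined_main {ρ ρ' : Icc (0 : ℝ) 1} {y y' : Icc (-1 / 8 : ℝ) (-1 / 8 + numSides g' r')} :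
    Joined (Sum.inl (ρ, y) : D.Param) (Sum.inl (ρ', y')) := by
  have : Joined (ρ, y) (ρ', y') := by
    have : PathConnectedSpace (Icc (-1 / 8 : ℝ) (-1 / 8 + numSides g' r')) :=
      isPathConnected_iff_pathConnectedSpace.1 ((convex_Icc _ _).isPathConnected ⟨y, y.2⟩)
    have : PathConnectedSpace (Icc (0 : ℝ) 1) :=
      isPathConnected_iff_pathConnectedSpace.1 ((convex_Icc _ _).isPathConnected ⟨ρ, ρ.2⟩)
    exact PathConnectedSpace.joined _ _
  exact ⟨this.somePath.map continuous_inl⟩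

lemma joined_strip {k : {k : Fin (numSides g' r') // D.strip k}} {t t' : Icc (0 : ℝ) 1}
    {s s' : Icc (-1 / 4 : ℝ) (5 / 4)} :
    Joined (Sum.inr (k, t, s) : D.Param) (Sum.inr (k, t', s')) := by
  have : Joined (t, s) (t', s') := by
    have : PathConnectedSpace (Icc (-1 / 4 : ℝ) (5 / 4)) :=
      isPathConnected_iff_pathConnectedSpace.1 ((convex_Icc _ _).isPathConnected ⟨s, s.2⟩)
    have : PathConnectedSpace (Icc (0 : ℝ) 1) :=
      isPathConnected_iff_pathConnectedSpace.1 ((convex_Icc _ _).isPathConnected ⟨t, t.2⟩)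
    exact PathConnectedSpace.joined _ _
  exact ⟨this.somePath.map (f := fun x => (Sum.inr (k, x) : D.Param)) (by fun_prop)⟩

lemma emb_side {k : ℕ} (hk : k < numSides g' r') {s : ℝ} (hs : s ∈ Icc (0 : ℝ) 1) :
    D.emb (proj g' r' (side g' r' k s)) =
      proj g r (side g r (D.last k) (D.startLast k + D.width k * s)) :=
  D.emb_of_rel (D.rel_side hk hs)

lemma trans_cast_seg {X Y : Type*} [TopologicalSpace X] [TopologicalSpace Y]
    [SimplyConnectedSpace Y] (q : C(Y, X)) {b u v w : Y} (h : q u = q v) {x y z : X}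
    (hx : x = q b) (hy : y = q u) (hy' : y = q v) (hz : z = q w) :
    ((seg q b u).cast hx hy).trans ((seg q v w).cast hy' hz) =
      ((FundamentalGroup.toPath (hop q b u v h)).trans (seg q b w)).cast hx hz := by
  subst hx hz hy
  simp only [Path.Homotopic.Quotient.cast_rfl_rfl]
  change _ = ((seg q b u).trans ((seg q v b).cast h rfl)).trans (seg q b w)
  have key : ∀ (a : X) (ha : a = q v), ((seg q v b).cast ha rfl).trans (seg q b w) =
      (seg q v w).cast ha rfl := by
    rintro _ rfl
    simp only [Path.Homotopic.Quotient.cast_rfl_rfl, seg_trans]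
  rw [Path.Homotopic.Quotient.trans_assoc, key]

/-- A radius of the source runs through the main part up to the end of a leg and, if there is a
strip, continues in the strip. In the target the two pieces meet across the glued side `first k`,
and this crossing inserts the loop `detour k`. -/
lemma map_seg_side {k : ℕ} (hk : k < numSides g' r') {s : ℝ} (hs : s ∈ Icc (0 : ℝ) 1) :
    (seg (proj g' r') Disc.zero (side g' r' k s)).map D.emb =
      ((FundamentalGroup.toPath (D.detour k)).trans (seg (proj g r) Disc.zero
        (side g r (D.last k) (D.startLast k + D.width k * s)))).cast D.emb_base
          (D.emb_side hk hs) := by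
  have hs' := Icc_subset hs
  have hy := Ico_subset_Icc_self (index_mem hk hs')
  let z₀ : D.Param := Sum.inl (⟨0, by simp⟩, ⟨_, hy⟩)
  let z₁ : D.Param := Sum.inl (⟨1, by simp⟩, ⟨_, hy⟩)
  have e0 : D.source z₀ = Disc.zero := by
    change D.mainSource 0 (k + s / 2) = _
    rw [mainSource, zero_div, Disc.polar_zero]
  have e0' : D.target z₀ = Disc.zero := by
    change D.mainTarget 0 (k + s / 2) = _
    rw [mainTarget, zero_mul, Disc.polar_zero]
  by_cases hst : D.strip k
  · have hh : D.height k s = 1 := D.height_eq_one_iff.2 ⟨hst, hs⟩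
    have e1' : D.target z₁ = side g r (D.first k) (D.start k + D.width k * s) :=
      D.mainTarget_leg hk ⟨hs', Or.inl hst⟩
    let w₀ : D.Param := Sum.inr (⟨⟨k, hk⟩, hst⟩, ⟨0, by simp⟩, ⟨s, hs'⟩)
    let w₁ : D.Param := Sum.inr (⟨⟨k, hk⟩, hst⟩, ⟨1, by simp⟩, ⟨s, hs'⟩)
    have f0' : D.target w₀ = side g r (partner g (D.first k)) (1 - (D.start k + D.width k * s)) := by
      change D.stripTarget k 0 s = _
      rw [stripTarget, zero_mul, D.stripPath_zero]
    have f1' : D.target w₁ = side g r (D.last k) (D.startLast k + D.width k * s) := by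
      change D.stripTarget k 1 s = _
      rw [stripTarget, hh, one_mul, D.stripPath_one]
    have f1 : D.source w₁ = side g' r' k s := by
      change D.stripSource k 1 s = _
      rw [stripSource, hh, one_mul, div_self (by norm_num), ← D.side_source]
    have f0 : D.source w₀ = D.source z₁ := by
      change D.stripSource k 0 s = D.mainSource 1 (k + s / 2)
      rw [stripSource, mainSource, D.bump_side hk hs', zero_mul, add_zero]
    have hp := Ioo_subset_Icc_self (D.param_mem hk hs')
    have g1 : D.emb (proj g' r' (D.source z₁)) =
        proj g r (side g r (D.first k) (D.start k + D.width k * s)) := by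
      rw [D.emb_source, e1']
    have g2 := g1.trans (proj_side (D.first_lt k hk) hp)
    rw [← seg_trans (proj g' r') Disc.zero (D.source z₁), map_trans_quotient,
      D.map_seg_emb D.joined_main e0 rfl e0' e1' D.emb_base g1,
      D.map_seg_emb D.joined_strip f0 f1 f0' f1' g2 (D.emb_side hk hs),
      trans_cast_seg _ (proj_side (D.first_lt k hk) hp)]
    congr 3
    rw [detour, if_pos hst, ← sideLoopAt_eq (D.first_lt k hk) hp]
    rfl
  · have e1 : D.source z₁ = side g' r' k s := by
      change D.mainSource 1 (k + s / 2) = _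
      rw [mainSource, D.bump_side hk hs', height, if_neg hst, add_zero, div_one, D.side_source]
    have e1' : D.target z₁ = side g r (D.last k) (D.startLast k + D.width k * s) := by
      rw [D.last_eq k hk hst, D.startLast_eq k hk hst]
      exact D.mainTarget_leg hk ⟨hs', Or.inr hs⟩
    rw [D.map_seg_emb D.joined_main e0 e1 e0' e1' D.emb_base (D.emb_side hk hs), detour,
      if_neg hst]
    congr 1
    exact (Path.Homotopic.Quotient.refl_trans _).symm

/-- The effect of the embedding on the loops through the sides. -/
theorem mapOfEq_sideLoop {k : ℕ} (hk : k < numSides g' r') :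
    FundamentalGroup.mapOfEq D.emb D.emb_base (sideLoop g' r' k) =
      (D.detour (partner g' k))⁻¹ * sideLoop g r (D.last k) * D.detour k := by
  have h1 : (1 / 2 : ℝ) ∈ Icc (0 : ℝ) 1 := by norm_num
  have h2 : (1 - 1 / 2 : ℝ) ∈ Icc (0 : ℝ) 1 := by norm_num
  have hp := Ioo_subset_Icc_self (D.paramLast_mem hk h1)
  have e : side g r (D.last (partner g' k)) (D.startLast (partner g' k) +
      D.width (partner g' k) * (1 - 1 / 2)) =
      side g r (partner g (D.last k)) (1 - (D.startLast k + D.width k * (1 / 2))) := by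
    rw [D.last_partner k hk, D.startLast_partner k hk, D.width_partner k hk]
    congr 1; ring
  have hemb := D.emb_side (partner_lt hk) h2
  rw [e] at hemb
  have hs : ∀ x (_ : side g r (D.last (partner g' k)) (D.startLast (partner g' k) +
      D.width (partner g' k) * (1 - 1 / 2)) = x)
      (h : D.emb (proj g' r' (side g' r' (partner g' k) (1 - 1 / 2))) = proj g r x),
      (seg (proj g' r') Disc.zero (side g' r' (partner g' k) (1 - 1 / 2))).map D.emb =
        ((FundamentalGroup.toPath (D.detour (partner g' k))).trans
          (seg (proj g r) Disc.zero x)).cast D.emb_base h := by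
    rintro _ rfl _
    exact D.map_seg_side (partner_lt hk) h2
  rw [sideLoop, dif_pos hk, ← sideLoopAt_eq (D.last_lt k hk) hp]
  exact mapOfEq_hop D.emb D.emb_base (D.emb_side hk h1) hemb (proj_side hk h1)
    (proj_side (D.last_lt k hk) hp) _ _ (D.map_seg_side hk h1) (hs _ e hemb)

end Routing

/-! ### The routings that are used: selected sides, pants, torus and sphere -/

namespace Routing

/-- The routing without strips whose legs run to the sides at the positions `L k`. -/
def select {g' r' g r : ℕ} (hr' : r' ≠ 0) (hm' : 0 < numSides g' r') (hm : 0 < numSides g r)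
    (L : ℕ → ℕ) (hL : ∀ k j, k < j → j < numSides g' r' → L k < L j)
    (hL' : ∀ k < numSides g' r', L k < L 0 + numSides g r)
    (hp : ∀ k < numSides g' r',
      L (partner g' k) % numSides g r = partner g (L k % numSides g r)) : Routing g' r' g r :=
  -- The position `L k` may exceed one period; quotient and remainder give the number of full turns
  -- and the side.
  have key : ∀ k, ((L k % numSides g r : ℕ) : ℝ) + ((L k / numSides g r : ℕ) : ℤ) * numSides g r =
      L k := fun k => by
    rw [Int.cast_natCast, ← Nat.cast_mul, ← Nat.cast_add, Nat.mod_add_div']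
  { first := fun k => L k % numSides g r
    last := fun k => L k % numSides g r
    turns := fun k => (L k / numSides g r : ℕ)
    turnsEntry := fun _ => 0
    turnsExit := fun _ => 0
    start := fun _ => 1 / 4
    startLast := fun _ => 1 / 4
    width := fun _ => 1 / 2
    strip := fun _ => False
    lo := fun _ => 0
    hi := fun _ => 0
    boundary_ne := hr'
    numSides_pos := hm'
    first_lt := fun _ _ => Nat.mod_lt _ hm
    last_lt := fun _ _ => Nat.mod_lt _ hm
    width_pos := by norm_num
    start_pos := by norm_num
    start_lt := by norm_num
    startLast_pos := by norm_num
    startLast_lt := by norm_num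
    last_eq := by simp
    startLast_eq := by simp
    last_partner := hp
    width_partner := by simp
    startLast_partner := by norm_num
    leg_lt := by
      intro k j hkj hj
      have h : (L k : ℝ) + 1 ≤ L j := by exact_mod_cast hL k j hkj hj
      rw [key, key]
      have := sideLen_le r
      linarith
    leg_lt_add := by
      intro k hk
      have h : (L k : ℝ) + 1 ≤ L 0 + numSides g r := by exact_mod_cast hL' k hk
      rw [key, key]
      have := sideLen_le r
      linarith
    lo_ge := by simp
    hi_lt := by simp
    strip_leg := by simp
    strip_strip := by simp
    entry_mem := by simp
    exit_mem := by simp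
    entry_exit := by simp }

/-- The pair of pants in the four-holed sphere around the first two boundary components. -/
def pants : Routing 0 3 0 4 where
  -- Leg `0` leaves through side `0`, re-enters through side `1`, and its strip runs past the free
  -- arc to side `2`. The first pair of the pants thus encircles the first two pairs of the target
  -- together.
  first := fun | 0 => 0 | 1 => 3 | 2 => 4 | _ => 5
  last := fun | 0 => 2 | 1 => 3 | 2 => 4 | _ => 5
  turns := fun _ => 0
  turnsEntry := fun _ => 0
  turnsExit := fun _ => 0
  start := fun _ => 1 / 4
  startLast := fun _ => 1 / 4
  width := fun _ => 1 / 2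
  strip := fun k => k = 0
  lo := fun _ => 1
  hi := fun _ => 5 / 2
  boundary_ne := by norm_num
  numSides_pos := by norm_num [numSides]
  first_lt := by norm_num [numSides]; intro k hk; interval_cases k <;> norm_num
  last_lt := by norm_num [numSides]; intro k hk; interval_cases k <;> norm_num
  width_pos := by norm_num
  start_pos := by norm_num
  start_lt := by norm_num
  startLast_pos := by norm_num
  startLast_lt := by norm_num
  last_eq := by norm_num [numSides]; intro k hk; interval_cases k <;> norm_num
  startLast_eq := by norm_num
  last_partner := by
    norm_num [numSides]; intro k hk; interval_cases k <;> norm_num [partner]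
  width_partner := by norm_num
  startLast_partner := by norm_num
  leg_lt := by
    norm_num [numSides, sideLen]; intro k j hkj hj
    interval_cases j <;> interval_cases k <;> norm_num
  leg_lt_add := by norm_num [numSides, sideLen]; intro k hk; interval_cases k <;> norm_num
  lo_ge := by norm_num [numSides, sideLen]
  hi_lt := by norm_num [numSides, sideLen]
  strip_leg := by
    rintro k - rfl j hj; norm_num [numSides] at hj
    interval_cases j <;> norm_num [numSides, sideLen]
  strip_strip := by rintro k - rfl j - rfl h; exact absurd rfl h
  entry_mem := by
    rintro k - rfl s ⟨h1, h2⟩; norm_num [numSides, sideLen, partner]; constructor <;> linarith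
  exit_mem := by
    rintro k - rfl s ⟨h1, h2⟩; norm_num [numSides, sideLen]; constructor <;> linarith
  entry_exit := by
    rintro k - rfl; left; rintro s ⟨h1, h2⟩; norm_num [numSides, sideLen, partner]; linarith

/-- The one-holed torus in the two-holed torus obtained by replacing the handle curve `a` by
`a c`. -/
def torus : Routing 1 1 1 2 where
  -- Leg `1` leaves through side `2`, re-enters through side `0`, and its strip runs backwards to
  -- side `5`. Since the period begins at side `1`, side `0` is taken one turn later, at position
  -- `6`.
  first := fun | 0 => 1 | 1 => 2 | 2 => 3 | _ => 4
  last := fun | 0 => 1 | 1 => 5 | 2 => 3 | _ => 4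
  turns := fun _ => 0
  turnsEntry := fun _ => 1
  turnsExit := fun _ => 0
  start := fun _ => 1 / 4
  startLast := fun _ => 1 / 4
  width := fun _ => 1 / 2
  strip := fun k => k = 1
  lo := fun _ => 5
  hi := fun _ => 13 / 2
  boundary_ne := by norm_num
  numSides_pos := by norm_num [numSides]
  first_lt := by norm_num [numSides]; intro k hk; interval_cases k <;> norm_num
  last_lt := by norm_num [numSides]; intro k hk; interval_cases k <;> norm_num
  width_pos := by norm_num
  start_pos := by norm_num
  start_lt := by norm_num
  startLast_pos := by norm_num
  startLast_lt := by norm_num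
  last_eq := by norm_num [numSides]; intro k hk; interval_cases k <;> norm_num
  startLast_eq := by norm_num
  last_partner := by
    norm_num [numSides]; intro k hk; interval_cases k <;> norm_num [partner]
  width_partner := by norm_num
  startLast_partner := by norm_num
  leg_lt := by
    norm_num [numSides, sideLen]; intro k j hkj hj
    interval_cases j <;> interval_cases k <;> norm_num
  leg_lt_add := by norm_num [numSides, sideLen]; intro k hk; interval_cases k <;> norm_num
  lo_ge := by norm_num [numSides, sideLen]
  hi_lt := by norm_num [numSides, sideLen]
  strip_leg := by
    rintro k - rfl j hj; norm_num [numSides] at hj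
    interval_cases j <;> norm_num [numSides, sideLen]
  strip_strip := by rintro k - rfl j - rfl h; exact absurd rfl h
  entry_mem := by
    rintro k - rfl s ⟨h1, h2⟩; norm_num [numSides, sideLen, partner]; constructor <;> linarith
  exit_mem := by
    rintro k - rfl s ⟨h1, h2⟩; norm_num [numSides, sideLen]; constructor <;> linarith
  entry_exit := by
    rintro k - rfl; right; rintro s ⟨h1, h2⟩; norm_num [numSides, sideLen, partner]; linarith

/-- The complement in the two-holed torus of an annulus around the handle curve `b`. -/
def sphere : Routing 0 4 1 2 where
  -- Legs `0` and `1` leave through the two halves of side `3` and re-enter through side `1`. Their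
  -- strips separate, one to the first half of side `2`, the other to the second half of side `0`.
  -- The remaining halves of these sides belong to legs `5` and `4`, which are placed one turn
  -- later.
  first := fun | 0 => 3 | 1 => 3 | 2 => 4 | 3 => 5 | 4 => 0 | _ => 2
  last := fun | 0 => 2 | 1 => 0 | 2 => 4 | 3 => 5 | 4 => 0 | _ => 2
  turns := fun | 4 => 1 | 5 => 1 | _ => 0
  turnsEntry := fun _ => 1
  turnsExit := fun _ => 1
  start := fun | 0 => 1 / 8 | 1 => 5 / 8 | 2 => 1 / 4 | 3 => 1 / 4 | 4 => 1 / 8 | _ => 5 / 8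
  startLast := fun | 0 => 1 / 8 | 1 => 5 / 8 | 2 => 1 / 4 | 3 => 1 / 4 | 4 => 1 / 8 | _ => 5 / 8
  width := fun | 2 => 1 / 2 | 3 => 1 / 2 | _ => 1 / 4
  strip := fun k => k = 0 ∨ k = 1
  -- With margins, the halves of a side are the parameters `[1/16, 7/16]` and `[9/16, 15/16]`. At
  -- side length `1/2` these become `[1/32, 7/32]` and `[9/32, 15/32]`, so the bounds are the exact
  -- extremes of entry and exit.
  lo := fun | 0 => 7 + 9 / 32 | _ => 6 + 9 / 32
  hi := fun | 0 => 8 + 7 / 32 | _ => 7 + 7 / 32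
  boundary_ne := by norm_num
  numSides_pos := by norm_num [numSides]
  first_lt := by norm_num [numSides]; intro k hk; interval_cases k <;> norm_num
  last_lt := by norm_num [numSides]; intro k hk; interval_cases k <;> norm_num
  width_pos := by norm_num [numSides]; intro k hk; interval_cases k <;> norm_num
  start_pos := by norm_num [numSides]; intro k hk; interval_cases k <;> norm_num
  start_lt := by norm_num [numSides]; intro k hk; interval_cases k <;> norm_num
  startLast_pos := by norm_num [numSides]; intro k hk; interval_cases k <;> norm_num
  startLast_lt := by norm_num [numSides]; intro k hk; interval_cases k <;> norm_num
  last_eq := by norm_num [numSides]; intro k hk; interval_cases k <;> norm_num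
  startLast_eq := by norm_num
  last_partner := by
    norm_num [numSides]; intro k hk; interval_cases k <;> norm_num [partner]
  width_partner := by
    norm_num [numSides]; intro k hk; interval_cases k <;> norm_num [partner]
  startLast_partner := by
    norm_num [numSides]; intro k hk; interval_cases k <;> norm_num [partner]
  leg_lt := by
    norm_num [numSides, sideLen]; intro k j hkj hj
    interval_cases j <;> interval_cases k <;> norm_num
  leg_lt_add := by norm_num [numSides, sideLen]; intro k hk; interval_cases k <;> norm_num
  lo_ge := by rintro k - (rfl | rfl) <;> norm_num [numSides, sideLen]
  hi_lt := by rintro k - (rfl | rfl) <;> norm_num [numSides, sideLen]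
  strip_leg := by
    rintro k - (rfl | rfl) <;> norm_num [numSides, sideLen] <;> intro j hj <;>
      interval_cases j <;> norm_num
  strip_strip := by
    rintro k - (rfl | rfl) j - (rfl | rfl) h <;> first | exact absurd rfl h | norm_num
  entry_mem := by
    rintro k - (rfl | rfl) s ⟨h1, h2⟩ <;> norm_num [numSides, sideLen, partner] <;>
      constructor <;> linarith
  exit_mem := by
    rintro k - (rfl | rfl) s ⟨h1, h2⟩ <;> norm_num [numSides, sideLen] <;>
      constructor <;> linarith
  entry_exit := by
    rintro k - (rfl | rfl)
    · left; rintro s ⟨h1, h2⟩; norm_num [numSides, sideLen, partner]; linarith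
    · right; rintro s ⟨h1, h2⟩; norm_num [numSides, sideLen, partner]; linarith

variable {g' r' g r : ℕ}

/-- The homomorphism of fundamental groups induced by the embedding defined by a routing. -/
def hom (D : Routing g' r' g r) : FundamentalGroup (Model g' r') (base g' r') →*
    FundamentalGroup (Model g r) (base g r) := FundamentalGroup.mapOfEq D.emb D.emb_base

lemma hom_sideLoop (D : Routing g' r' g r) {k : ℕ} (hk : k < numSides g' r') :
    D.hom (sideLoop g' r' k) =
      (D.detour (partner g' k))⁻¹ * sideLoop g r (D.last k) * D.detour k :=
  D.mapOfEq_sideLoop hk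

lemma detour_of_strip (D : Routing g' r' g r) {k : ℕ} (h : D.strip k) :
    D.detour k = sideLoop g r (D.first k) := if_pos h

lemma detour_of_not_strip (D : Routing g' r' g r) {k : ℕ} (h : ¬ D.strip k) :
    D.detour k = 1 := if_neg h

lemma select_hom {hr' : r' ≠ 0} {hm' : 0 < numSides g' r'} {hm : 0 < numSides g r}
    {L : ℕ → ℕ} {hL : ∀ k j, k < j → j < numSides g' r' → L k < L j}
    {hL' : ∀ k < numSides g' r', L k < L 0 + numSides g r}
    {hp : ∀ k < numSides g' r',
      L (partner g' k) % numSides g r = partner g (L k % numSides g r)} {k : ℕ}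
    (hk : k < numSides g' r') :
    (select hr' hm' hm L hL hL' hp).hom (sideLoop g' r' k) = sideLoop g r (L k % numSides g r) := by
  rw [hom_sideLoop _ hk, detour_of_not_strip _ not_false, detour_of_not_strip _ not_false, inv_one,
    one_mul, mul_one]
  rfl

lemma pants_hom_zero : pants.hom (sideLoop 0 3 0) = sideLoop 0 4 2 * sideLoop 0 4 0 := by
  rw [hom_sideLoop _ (by norm_num [numSides]), 
    detour_of_not_strip _ (by change ¬ partner 0 0 = 0; norm_num [partner]),
    detour_of_strip _ (by rfl), inv_one, one_mul]
  rfl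

lemma pants_hom_two : pants.hom (sideLoop 0 3 2) = sideLoop 0 4 4 := by
  rw [hom_sideLoop _ (by norm_num [numSides]),
    detour_of_not_strip _ (by change ¬ partner 0 2 = 0; norm_num [partner]),
    detour_of_not_strip _ (by change ¬ 2 = 0; norm_num), inv_one, one_mul,
    mul_one]
  rfl

lemma torus_hom_zero : torus.hom (sideLoop 1 1 0) = sideLoop 1 2 1 := by
  rw [hom_sideLoop _ (by norm_num [numSides]),
    detour_of_not_strip _ (by change ¬ partner 1 0 = 1; norm_num [partner]),
    detour_of_not_strip _ (by change ¬ 0 = 1; norm_num), inv_one, one_mul,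
    mul_one]
  rfl

lemma torus_hom_one : torus.hom (sideLoop 1 1 1) = sideLoop 1 2 5 * sideLoop 1 2 2 := by
  rw [hom_sideLoop _ (by norm_num [numSides]), 
    detour_of_not_strip _ (by change ¬ partner 1 1 = 1; norm_num [partner]),
    detour_of_strip _ (by rfl), inv_one, one_mul]
  rfl

/-- Both sides of this pair carry strips that cross side `3`, so detours occur at both ends and
produce a conjugate. -/
lemma sphere_hom_zero : sphere.hom (sideLoop 0 4 0) =
    (sideLoop 1 2 3)⁻¹ * sideLoop 1 2 2 * sideLoop 1 2 3 := by
  rw [hom_sideLoop _ (by norm_num [numSides]),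
    detour_of_strip _ (by change partner 0 0 = 0 ∨ partner 0 0 = 1; norm_num [partner]),
    detour_of_strip _ (by change 0 = 0 ∨ 0 = 1; norm_num)]
  rfl

lemma sphere_hom_two : sphere.hom (sideLoop 0 4 2) = sideLoop 1 2 4 := by
  rw [hom_sideLoop _ (by norm_num [numSides]),
    detour_of_not_strip _ (by change ¬ (partner 0 2 = 0 ∨ partner 0 2 = 1); norm_num [partner]),
    detour_of_not_strip _ (by change ¬ (2 = 0 ∨ 2 = 1); norm_num),
    inv_one, one_mul, mul_one]
  rfl

lemma sphere_hom_four : sphere.hom (sideLoop 0 4 4) = sideLoop 1 2 0 := by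
  rw [hom_sideLoop _ (by norm_num [numSides]),
    detour_of_not_strip _ (by change ¬ (partner 0 4 = 0 ∨ partner 0 4 = 1); norm_num [partner]),
    detour_of_not_strip _ (by change ¬ (4 = 0 ∨ 4 = 1); norm_num),
    inv_one, one_mul, mul_one]
  rfl

end Routing

/-! ### Homomorphisms from labels on the generators, and a criterion for injectivity -/

section Label

variable {G : Type*} [Group G]

/-- The contribution of the `i`-th handle to the relation between the loops of a closed surface. -/
def handleWord (f : ℕ → G) (i : ℕ) : G :=
  f (4 * i + 1) * (f (4 * i))⁻¹ * (f (4 * i + 1))⁻¹ * f (4 * i)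

/-- Homomorphisms with prescribed values on the loops through one side of each pair. -/
theorem exists_hom_label {g r : ℕ} (hm : 0 < numSides g r) (f : ℕ → G)
    (h : r = 0 → ∃ P : ℕ → G, (∀ i < g, P (i + 1) = handleWord f i * P i) ∧ P g = P 0) :
    ∃ F : FundamentalGroup (Model g r) (base g r) →* G,
      ∀ l < numSides g r, l < partner g l → F (sideLoop g r l) = f l := by
  let d : ℕ → G := fun k => if k < partner g k then f k else (f (partner g k))⁻¹
  have hd : ∀ k < numSides g r, d (partner g k) = (d k)⁻¹ := by
    intro k hk
    have hne := partner_ne hk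
    simp only [d, partner_partner hk]
    rcases lt_or_gt_of_ne hne with hlt | hlt
    · rw [if_pos hlt, if_neg (by omega), inv_inv]
    · rw [if_neg (by omega), if_pos hlt]
  -- The homomorphism takes values in the opposite group. Inverse labels are prescribed so that
  -- composition with inversion gives the desired ones in `G`.
  obtain ⟨F, hF⟩ := exists_hom_sideLoop (g := g) (r := r) hm (fun k => (d k)⁻¹)
    (fun k hk => by rw [hd k hk]) (by
      intro hr
      obtain ⟨P, hP, hP0⟩ := h hr
      have hmg : numSides g r = 4 * g := by rw [hr, numSides_even_zero]
      -- Around the vertex the corners follow each other as `4i`, `4i+3`, `4i+2`, `4i+1`, `4(i+1)`,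
      -- and each step contributes one letter of the handle word on the left. `P i` is the product
      -- accumulated at corner `4i`, and `P g = P 0` closes the circuit.
      let κ : ℕ → G := fun k =>
        if k % 4 = 0 then P (k / 4)
        else if k % 4 = 3 then f (4 * (k / 4)) * P (k / 4)
        else if k % 4 = 2 then (f (4 * (k / 4) + 1))⁻¹ * f (4 * (k / 4)) * P (k / 4)
        else (f (4 * (k / 4)))⁻¹ * (f (4 * (k / 4) + 1))⁻¹ * f (4 * (k / 4)) * P (k / 4)
      have h0 : ∀ i, κ (4 * i) = P i := fun i => by
        simp only [κ, (by omega : 4 * i % 4 = 0), (by omega : 4 * i / 4 = i), if_true]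
      have h1 : ∀ i, κ (4 * i + 1) = (f (4 * i))⁻¹ * (f (4 * i + 1))⁻¹ * f (4 * i) * P i := fun i => by
        simp only [κ, (by omega : (4 * i + 1) % 4 = 1), (by omega : (4 * i + 1) / 4 = i)]
        norm_num
      have h2 : ∀ i, κ (4 * i + 2) = (f (4 * i + 1))⁻¹ * f (4 * i) * P i := fun i => by
        simp only [κ, (by omega : (4 * i + 2) % 4 = 2), (by omega : (4 * i + 2) / 4 = i)]
        norm_num
      have h3 : ∀ i, κ (4 * i + 3) = f (4 * i) * P i := fun i => by
        simp only [κ, (by omega : (4 * i + 3) % 4 = 3), (by omega : (4 * i + 3) / 4 = i)]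
        norm_num
      refine ⟨fun k => (κ k)⁻¹, fun k hk => ?_⟩
      rw [← mul_inv_rev, inv_inj]
      rw [hmg] at hk ⊢
      obtain ⟨i, hi | hi | hi | hi⟩ : ∃ i, k = 4 * i ∨ k = 4 * i + 1 ∨ k = 4 * i + 2 ∨
          k = 4 * i + 3 := ⟨k / 4, by omega⟩
      · have hp : partner g k = 4 * i + 2 := by unfold partner; split_ifs <;> omega
        have hpk : d k = f (4 * i) := by simp only [d, hp]; rw [if_pos (by omega), hi]
        rw [hp, hpk, Nat.mod_eq_of_lt (by omega), h3, hi, h0]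
      · have hp : partner g k = 4 * i + 3 := by unfold partner; split_ifs <;> omega
        have hpk : d k = f (4 * i + 1) := by simp only [d, hp]; rw [if_pos (by omega), hi]
        rw [hp, hpk, hi, h1]
        have hk4 : κ ((4 * i + 3 + 1) % (4 * g)) = P (i + 1) := by
          rcases Nat.lt_or_ge (i + 1) g with hlt | hge
          · rw [Nat.mod_eq_of_lt (by omega), (by ring : 4 * i + 3 + 1 = 4 * (i + 1)), h0]
          · obtain rfl : g = i + 1 := by omega
            rw [(by ring : 4 * i + 3 + 1 = 4 * (i + 1)), Nat.mod_self, hP0]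
            exact h0 0
        rw [hk4, hP i (by omega), handleWord]
        group
      · have hp : partner g k = 4 * i := by unfold partner; split_ifs <;> omega
        have hpk : d k = (f (4 * i))⁻¹ := by simp only [d, hp]; rw [if_neg (by omega)]
        rw [hp, hpk, Nat.mod_eq_of_lt (by omega), h1, hi, h2]
        group
      · have hp : partner g k = 4 * i + 1 := by unfold partner; split_ifs <;> omega
        have hpk : d k = (f (4 * i + 1))⁻¹ := by simp only [d, hp]; rw [if_neg (by omega)]
        rw [hp, hpk, Nat.mod_eq_of_lt (by omega), h2, hi, h3]
        group)
  refine ⟨(MulEquiv.inv' G).symm.toMonoidHom.comp F, fun l hl hlp => ?_⟩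
  rw [MonoidHom.comp_apply, hF l hl]
  simp [d, hlp]

/-- The boundary relation is satisfied if at most two handles contribute and their contributions
cancel. -/
lemma exists_handle_product {g : ℕ} (f : ℕ → G) {i j : ℕ} (hi : i < g) (hj : j < g) (hij : i ≠ j)
    (h : ∀ n, n ≠ i → n ≠ j → handleWord f n = 1)
    (hw : handleWord f j * handleWord f i = 1) :
    ∃ P : ℕ → G, (∀ i < g, P (i + 1) = handleWord f i * P i) ∧ P g = P 0 := by
  have hw' : handleWord f i * handleWord f j = 1 := by
    rw [mul_eq_one_iff_eq_inv] at hw ⊢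
    rw [hw, inv_inv]
  -- The two contributions are inverse to each other and hence commute. The accumulated product can
  -- be written in one order, whichever of `i` and `j` comes first.
  refine ⟨fun n => (if i < n then handleWord f i else 1) * if j < n then handleWord f j else 1,
    fun n hn => ?_, ?_⟩
  · by_cases hni : n = i
    · subst hni
      rcases Nat.lt_or_ge j n with hlt | hge
      · simp [hlt, hlt.trans (Nat.lt_succ_self n)]
      · beta_reduce
        rw [if_pos (by omega), if_neg (by omega), if_neg (by omega), if_neg (by omega)]; simp
    · by_cases hnj : n = j
      · subst hnj
        rcases Nat.lt_or_ge i n with hlt | hge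
        · simp [hlt, hlt.trans (Nat.lt_succ_self n), hw, hw']
        · beta_reduce
          rw [if_neg (by omega), if_pos (by omega), if_neg (by omega), if_neg (by omega)]; simp
      · rw [h n hni hnj, one_mul]
        simp only [(by omega : i < n + 1 ↔ i < n), (by omega : j < n + 1 ↔ j < n)]
  · simp [hi, hj, hw']

lemma handleWord_eq_one_left {f : ℕ → G} {i : ℕ} (h : f (4 * i) = 1) : handleWord f i = 1 := by
  simp [handleWord, h]

lemma handleWord_eq_one_right {f : ℕ → G} {i : ℕ} (h : f (4 * i + 1) = 1) :
    handleWord f i = 1 := by simp [handleWord, h]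

/-- The boundary relation is satisfied if no handle contributes. -/
lemma exists_handle_product_of_trivial {g : ℕ} (f : ℕ → G)
    (h : ∀ n, f (4 * n) = 1 ∨ f (4 * n + 1) = 1) :
    ∃ P : ℕ → G, (∀ i < g, P (i + 1) = handleWord f i * P i) ∧ P g = P 0 := by
  refine ⟨fun _ => 1, fun i _ => ?_, rfl⟩
  rcases h i with h | h
  · rw [handleWord_eq_one_left h, one_mul]
  · rw [handleWord_eq_one_right h, one_mul]

/-- A homomorphism is injective if the images of some generators become free generators under a
further homomorphism. -/
lemma injective_of_free {ι H H' G : Type*} [Group H] [Group H'] [Group G] (Φ : H →* H')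
    (Ψ : H' →* G) (x : ι → H) (hx : Subgroup.closure (range x) = ⊤)
    (h : Function.Injective (FreeGroup.lift fun j => Ψ (Φ (x j)))) : Function.Injective Φ := by
  have hs : Function.Surjective (FreeGroup.lift x) := by
    rw [← MonoidHom.range_eq_top, FreeGroup.range_lift_eq_closure, hx]
  have he : FreeGroup.lift (fun j => Ψ (Φ (x j))) = (Ψ.comp Φ).comp (FreeGroup.lift x) := by
    ext; simp
  intro a b hab
  obtain ⟨a, rfl⟩ := hs a
  obtain ⟨b, rfl⟩ := hs b
  have : a = b := h (by rw [he, MonoidHom.comp_apply, MonoidHom.comp_apply, MonoidHom.comp_apply,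
    MonoidHom.comp_apply, hab])
  rw [this]

lemma closure_sideLoop_generator {g r : ℕ} (hm : 0 < numSides g r) :
    Subgroup.closure {x | ∃ l < numSides g r, l < partner g l ∧ x = sideLoop g r l} = ⊤ := by
  rw [eq_top_iff, ← closure_sideLoop hm, Subgroup.closure_le]
  rintro x ⟨k, hk, rfl⟩
  rcases lt_or_gt_of_ne (partner_ne hk) with h | h
  · rw [← partner_partner hk, sideLoop_partner (partner_lt hk)]
    exact inv_mem (Subgroup.subset_closure ⟨_, partner_lt hk, by rwa [partner_partner hk], rfl⟩)
  · exact Subgroup.subset_closure ⟨k, hk, h, rfl⟩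

lemma closure_range_sphere (r : ℕ) (hr : 2 ≤ r) : Subgroup.closure
    (range fun j : Fin (r - 1) => sideLoop 0 r (2 * j)) = ⊤ := by
  rw [eq_top_iff, ← closure_sideLoop_generator (g := 0) (r := r) (by unfold numSides; omega),
    Subgroup.closure_le]
  rintro x ⟨l, hl, hlp, rfl⟩
  refine Subgroup.subset_closure ⟨⟨l / 2, by unfold numSides at hl; omega⟩, ?_⟩
  have : 2 * (l / 2) = l := by
    unfold partner at hlp
    split_ifs at hlp <;> omega
  simp only [this]

lemma closure_range_torus : Subgroup.closure
    (range fun j : Fin 2 => sideLoop 1 1 j) = ⊤ := by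
  rw [eq_top_iff, ← closure_sideLoop_generator (g := 1) (r := 1) (by norm_num [numSides]),
    Subgroup.closure_le]
  rintro x ⟨l, hl, hlp, rfl⟩
  refine Subgroup.subset_closure ⟨⟨l, ?_⟩, rfl⟩
  unfold numSides at hl
  unfold partner at hlp
  split_ifs at hlp <;> omega

end Label

/-! ### Automorphisms of the free group of rank three realised by conjugation -/

section Holomorph

/-- The group in which a handle loop can act by an arbitrary automorphism of a free group. -/
abbrev Holomorph (n : ℕ) : Type :=
  FreeGroup (Fin n) ⋊[MonoidHom.id (MulAut (FreeGroup (Fin n)))] MulAut (FreeGroup (Fin n))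

open FreeGroup

/-- Automorphism of a free group from values on generators, with inverse. -/
def freeAut {n : ℕ} (u v : Fin n → FreeGroup (Fin n)) (h : ∀ i, lift v (u i) = of i)
    (h' : ∀ i, lift u (v i) = of i) : MulAut (FreeGroup (Fin n)) :=
  MonoidHom.toMulEquiv (lift u) (lift v) (by ext i; simp [h]) (by ext i; simp [h'])

lemma freeAut_of {n : ℕ} {u v : Fin n → FreeGroup (Fin n)} {h : ∀ i, lift v (u i) = of i}
    {h' : ∀ i, lift u (v i) = of i} (i : Fin n) : freeAut u v h h' (of i) = u i := by
  change lift u (of i) = u i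
  simp

/-- The automorphism that exchanges the first and the last of three generators, up to inversion. -/
def autSwap : MulAut (FreeGroup (Fin 3)) :=
  freeAut ![(of 2)⁻¹, of 1, (of 0)⁻¹] ![(of 2)⁻¹, of 1, (of 0)⁻¹]
    (by intro i; fin_cases i <;> simp) (by intro i; fin_cases i <;> simp)

/-- The automorphism that multiplies the second generator by the product of the others. -/
def autRight : MulAut (FreeGroup (Fin 3)) :=
  freeAut ![of 0, of 1 * of 0 * of 2, of 2] ![of 0, of 1 * (of 2)⁻¹ * (of 0)⁻¹, of 2]
    (by intro i; fin_cases i <;> simp) (by intro i; fin_cases i <;> simp)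

/-- The automorphism that multiplies the second generator by the product of the others. -/
def autLeft : MulAut (FreeGroup (Fin 3)) :=
  freeAut ![of 0, of 0 * of 2 * of 1, of 2] ![of 0, (of 2)⁻¹ * (of 0)⁻¹ * of 1, of 2]
    (by intro i; fin_cases i <;> simp [mul_assoc]) (by intro i; fin_cases i <;> simp [mul_assoc])

open SemidirectProduct

/-- Every automorphism of the free group becomes a conjugation here, so a handle word can be given a
prescribed value while one loop of the handle keeps a free generator as its label. -/
lemma inr_conj {n : ℕ} (β : MulAut (FreeGroup (Fin n))) (x : FreeGroup (Fin n)) :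
    (inr β * inl x * (inr β)⁻¹ : Holomorph n) = inl (β x) := by
  rw [← _root_.map_inv]
  exact (inl_aut (φ := MonoidHom.id _) β x).symm

lemma autSwap_conj : (inr autSwap * (inl (of 2))⁻¹ * (inr autSwap)⁻¹ : Holomorph 3) =
    inl (of 0) := by
  rw [← _root_.map_inv, inr_conj, _root_.map_inv, autSwap, freeAut_of]; simp

/-- The left factor is the handle word with the free generator x₁ on the first loop. It equals
β(x₁)⁻¹ x₁ for the automorphism β: x₁ ↦ x₁x₀x₂, which is the inverse of the word x₀x₂ of the handle
that is cut open. -/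
lemma autRight_conj : (inr autRight * (inl (of 1))⁻¹ * (inr autRight)⁻¹ * inl (of 1) : Holomorph 3) *
    inl (of 0 * of 2) = 1 := by
  rw [← _root_.map_inv, inr_conj, _root_.map_inv, autRight, freeAut_of, ← _root_.map_mul, ← _root_.map_mul]
  simp [mul_assoc]

/-- The counterpart with x₁ on the second loop of the handle: the word is x₁ β(x₁)⁻¹, so the product
x₀x₂ has to enter on the left of x₁. -/
lemma autLeft_conj : (inl (of 1) * ((inr autLeft)⁻¹)⁻¹ * (inl (of 1))⁻¹ * (inr autLeft)⁻¹ : Holomorph 3) *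
    inl (of 0 * of 2) = 1 := by
  have h := inr_conj autLeft (of 1)⁻¹
  rw [_root_.map_inv inl] at h
  rw [inv_inv, mul_assoc (inl (of 1)), mul_assoc (inl (of 1)), h, _root_.map_inv autLeft, autLeft,
    freeAut_of, ← _root_.map_mul, ← _root_.map_mul]
  simp [mul_assoc]

end Holomorph

/-! ### Common eigenvectors of 2 × 2 matrices -/

section CommonEigenvector

variable {K : Type*} [Field K]

/-- The matrices that have `v` as an eigenvector. -/
def eigenStab (v : Fin 2 → K) : Subgroup (Matrix.SpecialLinearGroup (Fin 2) K) where
  carrier := {A | ∃ c : K, (A : Matrix (Fin 2) (Fin 2) K).mulVec v = c • v}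
  one_mem' := ⟨1, by simp⟩
  mul_mem' := by
    rintro A B ⟨a, ha⟩ ⟨b, hb⟩
    refine ⟨b * a, ?_⟩
    rw [Matrix.SpecialLinearGroup.coe_mul, ← Matrix.mulVec_mulVec, hb, Matrix.mulVec_smul, ha,
      smul_smul]
  inv_mem' := by
    rintro A ⟨a, ha⟩
    have hv : ((A⁻¹ : Matrix.SpecialLinearGroup (Fin 2) K) : Matrix (Fin 2) (Fin 2) K).mulVec
        ((A : Matrix (Fin 2) (Fin 2) K).mulVec v) = v := by
      rw [Matrix.mulVec_mulVec, ← Matrix.SpecialLinearGroup.coe_mul, inv_mul_cancel]; simp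
    rw [ha, Matrix.mulVec_smul] at hv
    rcases eq_or_ne a 0 with rfl | h0
    · rw [zero_smul] at hv
      exact ⟨0, by rw [← hv]; simp⟩
    · refine ⟨a⁻¹, ?_⟩
      conv_rhs => rw [← hv]
      rw [smul_smul, inv_mul_cancel₀ h0, one_smul]

/-- A set of matrices has a common eigenvector. -/
def HasCommonEigenvector (T : Set (Matrix.SpecialLinearGroup (Fin 2) K)) : Prop :=
  ∃ v : Fin 2 → K, v ≠ 0 ∧ T ⊆ eigenStab v

lemma HasCommonEigenvector.mono {T T' : Set (Matrix.SpecialLinearGroup (Fin 2) K)}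
    (h : HasCommonEigenvector T') (hT : T ⊆ T') : HasCommonEigenvector T :=
  h.imp fun _ h => ⟨h.1, hT.trans h.2⟩

lemma HasCommonEigenvector.closure {T : Set (Matrix.SpecialLinearGroup (Fin 2) K)}
    (h : HasCommonEigenvector T) : 
    HasCommonEigenvector (Subgroup.closure T : Set (Matrix.SpecialLinearGroup (Fin 2) K)) :=
  h.imp fun v h => ⟨h.1, (Subgroup.closure_le (eigenStab v)).2 h.2⟩

lemma isReducible_iff {G : Type*} [Group G] {ρ : G →* Matrix.SpecialLinearGroup (Fin 2) K} :
    IsReducible ρ ↔ HasCommonEigenvector (range ρ) := by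
  constructor
  · rintro ⟨L, hL, hρ⟩
    obtain ⟨⟨v, hv⟩, hv0, hspan⟩ := finrank_eq_one_iff'.1 hL
    replace hv0 : v ≠ 0 := fun h0 => hv0 (Subtype.ext h0)
    refine ⟨v, hv0, ?_⟩
    rintro _ ⟨γ, rfl⟩
    obtain ⟨c, hc⟩ := hspan ⟨_, hρ γ v hv⟩
    exact ⟨c, (congrArg Subtype.val hc).symm⟩
  · rintro ⟨v, hv, h⟩
    refine ⟨K ∙ v, finrank_span_singleton hv, fun γ w hw => ?_⟩
    obtain ⟨a, rfl⟩ := Submodule.mem_span_singleton.1 hw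
    obtain ⟨c, hc⟩ := h ⟨γ, rfl⟩
    rw [Matrix.mulVec_smul, hc]
    exact Submodule.smul_mem _ _ (Submodule.smul_mem _ _ (Submodule.mem_span_singleton_self v))

/-- The determinant of two vectors. -/
def wedge (v w : Fin 2 → K) : K := v 0 * w 1 - v 1 * w 0

lemma exists_smul_of_wedge {v w : Fin 2 → K} (hv : v ≠ 0) (h : wedge v w = 0) :
    ∃ c : K, w = c • v := by
  unfold wedge at h
  by_cases h0 : v 0 = 0
  · have h1 : v 1 ≠ 0 := fun h1 => hv (by ext i; fin_cases i <;> simpa)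
    refine ⟨w 1 / v 1, ?_⟩
    ext i
    fin_cases i
    · have : w 0 = 0 := by
        rw [h0, zero_mul, zero_sub, neg_eq_zero] at h
        exact (mul_eq_zero.1 h).resolve_left h1
      simp [h0, this]
    · simp [h1]
  · refine ⟨w 0 / v 0, ?_⟩
    ext i
    fin_cases i
    · simp [h0]
    · simp only [Fin.mk_one, Pi.smul_apply, smul_eq_mul]
      field_simp
      linear_combination h

lemma wedge_smul_right (v w : Fin 2 → K) (c : K) : wedge v (c • w) = c * wedge v w := by
  simp only [wedge, Pi.smul_apply, smul_eq_mul]; ring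

lemma wedge_self (v : Fin 2 → K) : wedge v v = 0 := by unfold wedge; ring

lemma wedge_swap (v w : Fin 2 → K) : wedge w v = -wedge v w := by unfold wedge; ring

lemma wedge_swap_eq_zero {v w : Fin 2 → K} : wedge w v = 0 ↔ wedge v w = 0 := by
  rw [wedge_swap, neg_eq_zero]

variable {A B C : Matrix.SpecialLinearGroup (Fin 2) K} {u v w : Fin 2 → K}

lemma mem_eigenStab_iff_wedge (hv : v ≠ 0) :
    A ∈ eigenStab v ↔ wedge v ((A : Matrix (Fin 2) (Fin 2) K).mulVec v) = 0 := by
  constructor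
  · rintro ⟨c, hc⟩
    rw [hc, wedge_smul_right, wedge_self, mul_zero]
  · exact fun h => exists_smul_of_wedge hv h

lemma mem_eigenStab_of_wedge (hv : v ≠ 0) (h : wedge v w = 0) (hA : A ∈ eigenStab v) :
    A ∈ eigenStab w := by
  obtain ⟨c, rfl⟩ := exists_smul_of_wedge hv h
  obtain ⟨a, ha⟩ := hA
  exact ⟨a, by rw [Matrix.mulVec_smul, ha, smul_comm]⟩

/-- A matrix with three distinct eigenlines is scalar. -/
lemma mem_eigenStab_of_three (hu : u ≠ 0) (hv : v ≠ 0) (hw : w ≠ 0) (hAu : A ∈ eigenStab u)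
    (hAv : A ∈ eigenStab v) (hAw : A ∈ eigenStab w) (huv : wedge u v ≠ 0) (hvw : wedge v w ≠ 0)
    (huw : wedge u w ≠ 0) {x : Fin 2 → K} (hx : x ≠ 0) : A ∈ eigenStab x := by
  rw [mem_eigenStab_iff_wedge ‹_›] at *
  -- The expression x ∧ Ax is a quadratic form in two variables. The identity is its Lagrange
  -- interpolation from the three lines spanned by `u`, `v` and `w`, valid over every field.
  have key : wedge u v * wedge v w * wedge u w *
      wedge x ((A : Matrix (Fin 2) (Fin 2) K).mulVec x) =
      wedge v w * wedge x v * wedge x w * wedge u ((A : Matrix (Fin 2) (Fin 2) K).mulVec u) -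
      wedge u w * wedge x u * wedge x w * wedge v ((A : Matrix (Fin 2) (Fin 2) K).mulVec v) +
      wedge u v * wedge x u * wedge x v * wedge w ((A : Matrix (Fin 2) (Fin 2) K).mulVec w) := by
    simp only [wedge, Matrix.mulVec, dotProduct, Fin.sum_univ_two]
    ring
  rw [hAu, hAv, hAw] at key
  simp only [mul_zero, sub_zero, add_zero] at key
  exact (mul_eq_zero.1 key).resolve_left (mul_ne_zero (mul_ne_zero huv hvw) huw)

/-- If every three of the matrices have a common eigenvector, then all of them have. -/
theorem HasCommonEigenvector.of_triples {T : Set (Matrix.SpecialLinearGroup (Fin 2) K)}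
    (h : ∀ A ∈ T, ∀ B ∈ T, ∀ C ∈ T, HasCommonEigenvector {A, B, C}) : HasCommonEigenvector T := by
  by_cases hs : ∀ A ∈ T, ∀ x : Fin 2 → K, x ≠ 0 → A ∈ eigenStab x
  · exact ⟨fun _ => 1, fun h => by simpa using congrFun h 0, fun A hA =>
      hs A hA _ fun h => by simpa using congrFun h 0⟩
  push Not at hs
  obtain ⟨A, hA, x, hx, hAx⟩ := hs
  -- Without a common eigenvector the nonscalar matrix `A` would acquire three eigenlines: some `v`,
  -- a line `w` shared with a matrix `B` that moves `v`, and a line `u` shared with `B` and a matrix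
  -- `C` that moves `w`.
  by_contra hcon
  obtain ⟨v, hv, hAv⟩ := h A hA A hA A hA
  have : ∃ B ∈ T, B ∉ eigenStab v := by
    by_contra hc
    push Not at hc
    exact hcon ⟨v, hv, hc⟩
  obtain ⟨B, hB, hBv⟩ := this
  obtain ⟨w, hw, hABw⟩ := h A hA B hB B hB
  have : ∃ C ∈ T, C ∉ eigenStab w := by
    by_contra hc
    push Not at hc
    exact hcon ⟨w, hw, hc⟩
  obtain ⟨C, hC, hCw⟩ := this
  obtain ⟨u, hu, hABCu⟩ := h A hA B hB C hC
  refine hAx (mem_eigenStab_of_three hu hv hw (hABCu (by simp)) (hAv (by simp)) (hABw (by simp))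
    (fun h0 => ?_) (fun h0 => ?_) (fun h0 => ?_) hx)
  · exact hBv (mem_eigenStab_of_wedge hu h0 (hABCu (by simp)))
  · exact hBv (mem_eigenStab_of_wedge hw (wedge_swap_eq_zero.1 h0) (hABw (by simp)))
  · exact hCw (mem_eigenStab_of_wedge hu h0 (hABCu (by simp)))

/-- Criterion for three matrices in terms of pairs. -/
theorem hasCommonEigenvector_of_pairs (hAB : HasCommonEigenvector {A, B})
    (hBC : HasCommonEigenvector {B, C}) (hAC : HasCommonEigenvector {A, C})
    (hBAC : HasCommonEigenvector {B * A, C}) : HasCommonEigenvector {A, B, C} := by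
  obtain ⟨u, hu, hABu⟩ := hAB
  obtain ⟨v, hv, hBCv⟩ := hBC
  obtain ⟨w, hw, hACw⟩ := hAC
  obtain ⟨z, hz, hBACz⟩ := hBAC
  have hAu : A ∈ eigenStab u := hABu (by simp)
  have hBu : B ∈ eigenStab u := hABu (by simp)
  have hBv : B ∈ eigenStab v := hBCv (by simp)
  have hCv : C ∈ eigenStab v := hBCv (by simp)
  have hAw : A ∈ eigenStab w := hACw (by simp)
  have hCw : C ∈ eigenStab w := hACw (by simp)
  have hBAz : B * A ∈ eigenStab z := hBACz (by simp)
  have hCz : C ∈ eigenStab z := hBACz (by simp)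
  have fin : ∀ x : Fin 2 → K, x ≠ 0 → A ∈ eigenStab x → B ∈ eigenStab x → C ∈ eigenStab x →
      HasCommonEigenvector {A, B, C} := fun x hx h1 h2 h3 =>
    ⟨x, hx, by rintro _ (rfl | rfl | rfl) <;> assumption⟩
  -- Coincidence of `u` and `v`, or of `v` and `w`, gives a common line directly. If `z` coincides
  -- with `v` or `w`, a line fixed by `B * A` and one factor is fixed by the other factor. Otherwise
  -- `z`, `v`, `w` are three eigenlines of `C`, so `u` is an eigenline as well.
  by_cases huv : wedge u v = 0
  · exact fin v hv (mem_eigenStab_of_wedge hu huv hAu) hBv hCv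
  by_cases hvw : wedge v w = 0
  · exact fin w hw hAw (mem_eigenStab_of_wedge hv hvw hBv) hCw
  by_cases hzv : wedge z v = 0
  · have := mem_eigenStab_of_wedge hz hzv hBAz
    exact fin v hv (by simpa using mul_mem (inv_mem hBv) this) hBv hCv
  by_cases hzw : wedge z w = 0
  · have := mem_eigenStab_of_wedge hz hzw hBAz
    exact fin w hw hAw (by simpa using mul_mem this (inv_mem hAw)) hCw
  exact fin u hu hAu hBu (mem_eigenStab_of_three hz hv hw hCz hCv hCw hzv hvw hzw hu)

/-- Criterion for a handle and a further matrix. -/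
theorem hasCommonEigenvector_of_handle (hAB : HasCommonEigenvector {A, B})
    (hconj : HasCommonEigenvector {B * A⁻¹ * B⁻¹, C, A})
    (hmul : HasCommonEigenvector {B, C⁻¹ * A⁻¹}) : HasCommonEigenvector {A, B, C} := by
  have fin : ∀ x : Fin 2 → K, x ≠ 0 → A ∈ eigenStab x → B ∈ eigenStab x → C ∈ eigenStab x →
      HasCommonEigenvector {A, B, C} := fun x hx h1 h2 h3 =>
    ⟨x, hx, by rintro _ (rfl | rfl | rfl) <;> assumption⟩
  by_cases hs : ∀ x : Fin 2 → K, x ≠ 0 → A ∈ eigenStab x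
  -- For scalar `A`, the matrices `C⁻¹ * A⁻¹` and `C` have the same eigenvectors.
  · obtain ⟨v, hv, h⟩ := hmul
    have hCA : C⁻¹ * A⁻¹ ∈ eigenStab v := h (by simp)
    refine fin v hv (hs v hv) (h (by simp)) ?_
    simpa using inv_mem (mul_mem hCA (hs v hv))
  push Not at hs
  obtain ⟨x, hx, hAx⟩ := hs
  obtain ⟨v, hv, hv'⟩ := hAB
  obtain ⟨w, hw, hw'⟩ := hconj
  have hAv : A ∈ eigenStab v := hv' (by simp)
  have hBv : B ∈ eigenStab v := hv' (by simp)
  have hAw : A ∈ eigenStab w := hw' (by simp)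
  have hCw : C ∈ eigenStab w := hw' (by simp)
  have hBw : B * A⁻¹ * B⁻¹ ∈ eigenStab w := hw' (by simp)
  by_cases hvw : wedge v w = 0
  · exact fin w hw hAw (mem_eigenStab_of_wedge hv hvw hBv) hCw
  -- Since `w` is an eigenvector of `B * A⁻¹ * B⁻¹`, the vector `B⁻¹w` is one of `A`. A nonscalar
  -- `A` cannot have `v`, `w` and `y` on three different lines, and the admissible coincidences make
  -- `B` fix the line of `w`.
  set y := ((B⁻¹ : Matrix.SpecialLinearGroup (Fin 2) K) : Matrix (Fin 2) (Fin 2) K).mulVec w with hy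
  have hBy : (B : Matrix (Fin 2) (Fin 2) K).mulVec y = w := by
    rw [hy, Matrix.mulVec_mulVec, ← Matrix.SpecialLinearGroup.coe_mul, mul_inv_cancel]; simp
  have hy0 : y ≠ 0 := by
    intro h0
    rw [h0, Matrix.mulVec_zero] at hBy
    exact hw hBy.symm
  have hAy : A ∈ eigenStab y := by
    obtain ⟨c, hc⟩ := inv_mem hBw
    refine ⟨c, ?_⟩
    have : A * B⁻¹ = B⁻¹ * (B * A⁻¹ * B⁻¹)⁻¹ := by group
    rw [hy, Matrix.mulVec_mulVec, ← Matrix.SpecialLinearGroup.coe_mul, this,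
      Matrix.SpecialLinearGroup.coe_mul, ← Matrix.mulVec_mulVec, hc, Matrix.mulVec_smul]
  by_cases hyv : wedge v y = 0
  · exfalso
    obtain ⟨c, hc⟩ := exists_smul_of_wedge hv hyv
    obtain ⟨b, hb⟩ := hBv
    rw [hc, Matrix.mulVec_smul, hb, smul_smul] at hBy
    exact hvw (by rw [← hBy, wedge_smul_right, wedge_self, mul_zero])
  by_cases hyw : wedge w y = 0
  · obtain ⟨c, hc⟩ := exists_smul_of_wedge hw hyw
    have : B⁻¹ ∈ eigenStab w := ⟨c, hc⟩
    exact fin w hw hAw (by simpa using inv_mem this) hCw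
  exact absurd (mem_eigenStab_of_three hv hw hy0 hAv hAw hAy hvw hyw hyv hx) hAx

/-- A representation of a group generated by a set is reducible if the images of the generators have
a common eigenvector. -/
lemma isReducible_of_closure {G : Type*} [Group G] {ρ : G →* Matrix.SpecialLinearGroup (Fin 2) K}
    {S : Set G} (hS : Subgroup.closure S = ⊤) (h : HasCommonEigenvector (ρ '' S)) :
    IsReducible ρ := by
  rw [isReducible_iff]
  refine h.closure.mono ?_
  rw [← MonoidHom.map_closure, hS]
  rintro _ ⟨γ, rfl⟩
  exact ⟨γ, trivial, rfl⟩

lemma IsReducible.hasCommonEigenvector {G : Type*} [Group G]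
    {ρ : G →* Matrix.SpecialLinearGroup (Fin 2) K} (h : IsReducible ρ)
    {T : Set (Matrix.SpecialLinearGroup (Fin 2) K)} (hT : T ⊆ range ρ) : HasCommonEigenvector T :=
  (isReducible_iff.1 h).mono hT

lemma IsReducible.comp {G H : Type*} [Group G] [Group H]
    {ρ : G →* Matrix.SpecialLinearGroup (Fin 2) K} (h : IsReducible ρ) (φ : H →* G) :
    IsReducible (ρ.comp φ) := by
  rw [isReducible_iff] at h ⊢
  refine h.mono ?_
  rintro _ ⟨x, rfl⟩
  exact ⟨φ x, rfl⟩

lemma isReducible_comp_iff_range {G H : Type*} [Group G] [Group H]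
    {ρ : G →* Matrix.SpecialLinearGroup (Fin 2) K} (φ : H →* G) :
    IsReducible (ρ.comp φ) ↔ IsReducible (ρ.comp φ.range.subtype) := by
  rw [isReducible_iff, isReducible_iff]
  have : range (ρ.comp φ) = range (ρ.comp φ.range.subtype) := by
    ext A
    constructor
    · rintro ⟨x, rfl⟩
      exact ⟨⟨φ x, x, rfl⟩, rfl⟩
    · rintro ⟨⟨_, x, rfl⟩, rfl⟩
      exact ⟨x, rfl⟩
  rw [this]

end CommonEigenvector

/-! ### Essential embeddings, change of base point and reduction to compact surfaces -/

section Transfer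

variable {S M X : Type*} [TopologicalSpace S] [TopologicalSpace M] [TopologicalSpace X]

lemma mulEquivOfPath_apply {s t : S} (p : Path s t) (x : FundamentalGroup S s) :
    FundamentalGroup.fundamentalGroupMulEquivOfPath p x =
      (Path.Homotopic.Quotient.symm (.mk p)).trans
        ((FundamentalGroup.toPath x).trans (.mk p)) := rfl

lemma map_mulEquivOfPath (e : C(S, X)) {s t : S} (p : Path s t) (x : FundamentalGroup S s) :
    FundamentalGroup.map e t (FundamentalGroup.fundamentalGroupMulEquivOfPath p x) =
      FundamentalGroup.fundamentalGroupMulEquivOfPath (p.map e.continuous)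
        (FundamentalGroup.map e s x) := by
  rw [mulEquivOfPath_apply, mulEquivOfPath_apply]
  change Path.Homotopic.Quotient.map _ e = _
  rw [map_trans_quotient, map_trans_quotient, map_symm_quotient]
  rfl

lemma mapOfEq_rfl (e : C(S, X)) (s : S) :
    FundamentalGroup.mapOfEq e (rfl : e s = e s) = FundamentalGroup.map e s := by
  ext x
  rw [FundamentalGroup.mapOfEq_apply, Path.Homotopic.Quotient.cast_rfl_rfl]
  rfl

lemma map_comp_apply (e : C(M, X)) (e' : C(S, M)) (s : S) (x : FundamentalGroup S s) :
    FundamentalGroup.map (e.comp e') s x =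
      FundamentalGroup.map e (e' s) (FundamentalGroup.map e' s x) := by
  induction x using Quotient.ind
  rfl

lemma IsEssential.comp {e : C(M, X)} {e' : C(S, M)} (h : IsEssential e) (h' : IsEssential e') :
    IsEssential (e.comp e') := by
  refine ⟨h.1.comp h'.1, fun s x y hxy => h'.2 s (h.2 (e' s) ?_)⟩
  rw [← map_comp_apply, ← map_comp_apply, hxy]

/-- The homomorphism is induced by an embedding. -/
def IsEmbeddingHom {s : S} {x : X} (Φ : FundamentalGroup S s →* FundamentalGroup X x) : Prop :=
  ∃ (e : C(S, X)) (h : e s = x), IsEmbedding e ∧ Φ = FundamentalGroup.mapOfEq e h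

/-- The homomorphism is induced by an essential embedding. -/
def IsEssentialHom {s : S} {x : X} (Φ : FundamentalGroup S s →* FundamentalGroup X x) : Prop :=
  ∃ (e : C(S, X)) (h : e s = x), IsEssential e ∧ Φ = FundamentalGroup.mapOfEq e h

lemma IsEmbeddingHom.comp {s : S} {m : M} {x : X} {Ψ : FundamentalGroup M m →* FundamentalGroup X x}
    {Φ : FundamentalGroup S s →* FundamentalGroup M m} (hΨ : IsEmbeddingHom Ψ)
    (hΦ : IsEmbeddingHom Φ) : IsEmbeddingHom (Ψ.comp Φ) := by
  obtain ⟨e, rfl, he, rfl⟩ := hΨ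
  obtain ⟨e', rfl, he', rfl⟩ := hΦ
  refine ⟨e.comp e', rfl, he.comp he', ?_⟩
  ext x
  rw [MonoidHom.comp_apply, mapOfEq_rfl, mapOfEq_rfl, mapOfEq_rfl (e.comp e'), map_comp_apply]

/-- Transport along paths carries injectivity from one base point to all others, because the source
is path connected. -/
lemma IsEmbeddingHom.isEssentialHom [PathConnectedSpace S] {s : S} {x : X}
    {Φ : FundamentalGroup S s →* FundamentalGroup X x} (h : IsEmbeddingHom Φ)
    (hi : Function.Injective Φ) : IsEssentialHom Φ := by
  obtain ⟨e, rfl, he, rfl⟩ := h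
  rw [mapOfEq_rfl] at hi
  refine ⟨e, rfl, ⟨he, fun t x y hxy => ?_⟩, rfl⟩
  let p := PathConnectedSpace.somePath s t
  obtain ⟨x, rfl⟩ := (FundamentalGroup.fundamentalGroupMulEquivOfPath p).surjective x
  obtain ⟨y, rfl⟩ := (FundamentalGroup.fundamentalGroupMulEquivOfPath p).surjective y
  rw [map_mulEquivOfPath, map_mulEquivOfPath] at hxy
  rw [hi ((FundamentalGroup.fundamentalGroupMulEquivOfPath _).injective hxy)]

lemma IsEssentialHom.comp {s : S} {m : M} {x : X} {Ψ : FundamentalGroup M m →* FundamentalGroup X x}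
    {Φ : FundamentalGroup S s →* FundamentalGroup M m} (hΨ : IsEssentialHom Ψ)
    (hΦ : IsEssentialHom Φ) : IsEssentialHom (Ψ.comp Φ) := by
  obtain ⟨e, rfl, he, rfl⟩ := hΨ
  obtain ⟨e', rfl, he', rfl⟩ := hΦ
  refine ⟨e.comp e', rfl, he.comp he', ?_⟩
  ext x
  rw [MonoidHom.comp_apply, mapOfEq_rfl, mapOfEq_rfl, mapOfEq_rfl (e.comp e'), map_comp_apply]

lemma isEssentialHom_id (s : S) : IsEssentialHom (MonoidHom.id (FundamentalGroup S s)) := by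
  have : FundamentalGroup.map (.id S) = fun s => MonoidHom.id (FundamentalGroup S s) := by
    ext s x
    induction x using Quotient.ind
    rfl
  refine ⟨.id S, rfl, ⟨IsEmbedding.id, fun t => ?_⟩, ?_⟩
  · rw [this]; exact fun _ _ h => h
  · exact ((mapOfEq_rfl (.id S) s).trans (congrFun this s)).symm

lemma Routing.isEmbeddingHom {g' r' g r : ℕ} (D : Routing g' r' g r) : IsEmbeddingHom D.hom :=
  ⟨D.emb, D.emb_base, D.isEmbedding_emb, rfl⟩

/-- Transport along a path of `M` followed by `e` is transport along the image path. Subsurfaces of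
a model, constructed at its standard base point, can thus be used for an embedding that meets `x₀`
elsewhere. -/
lemma inducedHom_comp (e : C(M, X)) {s b : M} {x₀ : X} (h : e s = x₀) (q : Path b s)
    (e' : C(S, M)) {b' : S} (h' : e' b' = b) :
    inducedHom (e.comp e') b' ((q.map e.continuous).cast (congrArg e h') h.symm) =
      (FundamentalGroup.mapOfEq e h).comp
        ((FundamentalGroup.fundamentalGroupMulEquivOfPath q).toMonoidHom.comp
          (FundamentalGroup.mapOfEq e' h')) := by
  subst h h'
  ext x
  rw [mapOfEq_rfl, mapOfEq_rfl]
  change FundamentalGroup.fundamentalGroupMulEquivOfPath _ (FundamentalGroup.map _ _ x) =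
    FundamentalGroup.map _ _ (FundamentalGroup.fundamentalGroupMulEquivOfPath q _)
  rw [map_mulEquivOfPath, map_comp_apply]
  rfl

variable {K : Type*} [Field K]

/-- The representation of the group of a subsurface, with another base point. -/
abbrev restrictTo {x₀ : X} (ρ : FundamentalGroup X x₀ →* Matrix.SpecialLinearGroup (Fin 2) K)
    (e : C(M, X)) {s b : M} (h : e s = x₀) (q : Path b s) :
    FundamentalGroup M b →* Matrix.SpecialLinearGroup (Fin 2) K :=
  ρ.comp ((FundamentalGroup.mapOfEq e h).comp
    (FundamentalGroup.fundamentalGroupMulEquivOfPath q).toMonoidHom)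

/-- Essential subsurfaces of an essential subsurface are essential in `X`. The hypothesis about
subgroups of the group of `X` therefore becomes one about homomorphisms into the group of the
subsurface. -/
lemma isReducible_restrictTo_comp {x₀ : X}
    (ρ : FundamentalGroup X x₀ →* Matrix.SpecialLinearGroup (Fin 2) K) {g' r' : ℕ}
    (H : ∀ H : Subgroup (FundamentalGroup X x₀), IsSubsurfaceGroup g' r' H →
      IsReducible (ρ.comp H.subtype))
    {e : C(M, X)} (he : IsEssential e) {s b : M} (h : e s = x₀) (q : Path b s)
    {Φ : FundamentalGroup (Model g' r') (base g' r') →* FundamentalGroup M b}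
    (hΦ : IsEssentialHom Φ) : IsReducible ((restrictTo ρ e h q).comp Φ) := by
  obtain ⟨e', h', he', rfl⟩ := hΦ
  have := inducedHom_comp e h q e' h'
  have h1 := H _ ⟨e.comp e', he.comp he', base g' r', (q.map e.continuous).cast (congrArg e h') h.symm, rfl⟩
  rw [this, ← isReducible_comp_iff_range] at h1
  exact h1

lemma hasCommonEigenvector_of_restrictTo {x₀ : X}
    {ρ : FundamentalGroup X x₀ →* Matrix.SpecialLinearGroup (Fin 2) K}
    {e : C(M, X)} {s b : M} {h : e s = x₀} {q : Path b s}
    (hr : IsReducible (restrictTo ρ e h q)) :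
    HasCommonEigenvector (ρ '' range (FundamentalGroup.mapOfEq e h)) := by
  refine hr.hasCommonEigenvector ?_
  rintro _ ⟨_, ⟨y, rfl⟩, rfl⟩
  obtain ⟨x, rfl⟩ := (FundamentalGroup.fundamentalGroupMulEquivOfPath q).surjective y
  exact ⟨x, rfl⟩

/-- A loop in the image of an embedding comes from a loop. -/
lemma exists_mapOfEq_eq {e : C(M, X)} (he : IsEmbedding e) {s : M} {x₀ : X} (h : e s = x₀)
    (γ : Path x₀ x₀) (hγ : range γ ⊆ range e) :
    ∃ δ, FundamentalGroup.mapOfEq e h δ = FundamentalGroup.fromPath (.mk γ) := by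
  subst h
  have hc : ∀ t, ∃ y, e y = γ t := fun t => hγ ⟨t, rfl⟩
  choose f hf using hc
  have hfc : Continuous f := he.continuous_iff.2 (by
    have : e ∘ f = γ := funext hf
    rw [this]; exact γ.continuous)
  let δ : Path s s :=
    { toFun := f
      continuous_toFun := hfc
      source' := he.injective (by rw [hf, γ.source])
      target' := he.injective (by rw [hf, γ.target]) }
  refine ⟨FundamentalGroup.fromPath (.mk δ), ?_⟩
  rw [mapOfEq_rfl]
  change Path.Homotopic.Quotient.mk (δ.map e.continuous) = Path.Homotopic.Quotient.mk γ
  congr 1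
  ext t
  exact hf t

lemma isEssential_homeomorph (φ : M ≃ₜ X) : IsEssential (φ : C(M, X)) := by
  refine ⟨φ.isEmbedding, fun s x y hxy => ?_⟩
  have key : ∀ x : FundamentalGroup M s, (Path.Homotopic.Quotient.map
      (FundamentalGroup.toPath (FundamentalGroup.map (φ : C(M, X)) s x)) (φ.symm : C(X, M))) =
      (FundamentalGroup.toPath x).cast (φ.symm_apply_apply s) (φ.symm_apply_apply s) := by
    intro x
    induction x using Quotient.ind
    rename_i γ
    change Path.Homotopic.Quotient.mk _ = Path.Homotopic.Quotient.mk _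
    congr 1
    ext t
    exact φ.symm_apply_apply _
  have h := key x
  rw [hxy, key y] at h
  have inj : ∀ (t : M) (ht : t = s) (a b : Path.Homotopic.Quotient s s),
      a.cast ht ht = b.cast ht ht → a = b := by
    rintro _ rfl a b h
    simpa only [Path.Homotopic.Quotient.cast_rfl_rfl] using h
  exact (inj _ _ _ _ h).symm

/-- Finitely many loops on a surface lie in an essential compact subsurface. -/
lemma IsSurfaceOfLevelGE.exists_subsurface {l : ℤ} (hX : IsSurfaceOfLevelGE l X) (x₀ : X)
    (γ₁ γ₂ γ₃ : FundamentalGroup X x₀) : ∃ g r : ℕ, eulerChar g r < 0 ∧ l ≤ level g r ∧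
      ∃ e : C(Model g r, X), IsEssential e ∧ ∃ (s : Model g r) (h : e s = x₀),
        {γ₁, γ₂, γ₃} ⊆ range (FundamentalGroup.mapOfEq e h) := by
  obtain ⟨γ₁⟩ := γ₁
  obtain ⟨γ₂⟩ := γ₂
  obtain ⟨γ₃⟩ := γ₃
  change Path x₀ x₀ at γ₁ γ₂ γ₃
  obtain ⟨g, r, hχ, hl, e, he, hC⟩ : ∃ g r : ℕ, eulerChar g r < 0 ∧ l ≤ level g r ∧
      ∃ e : C(Model g r, X), IsEssential e ∧ range γ₁ ∪ range γ₂ ∪ range γ₃ ⊆ range e := by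
    rcases hX with ⟨g, r, hχ, hl, ⟨φ⟩⟩ | ⟨-, hX⟩
    · refine ⟨g, r, hχ, hl, φ.symm, isEssential_homeomorph φ.symm, fun x _ => ⟨φ x, ?_⟩⟩
      exact φ.symm_apply_apply x
    · obtain ⟨g, r, hχ, hl, e, he, hC⟩ := hX (range γ₁ ∪ range γ₂ ∪ range γ₃)
        (((isCompact_range γ₁.continuous).union (isCompact_range γ₂.continuous)).union
          (isCompact_range γ₃.continuous))
      exact ⟨g, r, hχ, hl, e, he, hC.trans interior_subset⟩
  obtain ⟨s, hs⟩ : x₀ ∈ range e := hC (Or.inl (Or.inl ⟨0, γ₁.source⟩))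
  refine ⟨g, r, hχ, hl, e, he, s, hs, ?_⟩
  rintro _ (rfl | rfl | rfl)
  · exact exists_mapOfEq_eq he.1 hs γ₁ fun x hx => hC (Or.inl (Or.inl hx))
  · exact exists_mapOfEq_eq he.1 hs γ₂ fun x hx => hC (Or.inl (Or.inr hx))
  · exact exists_mapOfEq_eq he.1 hs γ₃ fun x hx => hC (Or.inr hx)

/-- Reducibility can be checked on essential compact subsurfaces. -/
lemma isReducible_of_subsurfaces {l : ℤ} (hX : IsSurfaceOfLevelGE l X) {x₀ : X}
    {ρ : FundamentalGroup X x₀ →* Matrix.SpecialLinearGroup (Fin 2) K}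
    (H : ∀ g r : ℕ, eulerChar g r < 0 → l ≤ level g r → ∀ e : C(Model g r, X), IsEssential e →
      ∀ (s : Model g r) (h : e s = x₀) (q : Path (base g r) s),
        IsReducible (restrictTo ρ e h q)) : IsReducible ρ := by
  rw [isReducible_iff]
  -- Three loops have compact union, so one subsurface contains them even if `X` has infinite type.
  -- No limit of invariant lines along an exhaustion is required.
  refine HasCommonEigenvector.of_triples ?_
  rintro _ ⟨γ₁, rfl⟩ _ ⟨γ₂, rfl⟩ _ ⟨γ₃, rfl⟩
  obtain ⟨g, r, hχ, hl, e, he, s, h, hsub⟩ := hX.exists_subsurface x₀ γ₁ γ₂ γ₃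
  refine (hasCommonEigenvector_of_restrictTo (H g r hχ hl e he s h
    (PathConnectedSpace.somePath _ _))).mono ?_
  rintro _ (rfl | rfl | rfl)
  · exact mem_image_of_mem _ (hsub (by simp))
  · exact mem_image_of_mem _ (hsub (by simp))
  · exact mem_image_of_mem _ (hsub (by simp))

end Transfer

/-! ### Essential subsurfaces of the models and their injectivity -/

section Subsurfaces

lemma injective_of_free_generators {ι H H' G : Type*} [Group H] [Group H'] [Group G] {Φ : H →* H'}
    (Ψ : H' →* G) {x : ι → H} (hx : Subgroup.closure (range x) = ⊤) (φ : FreeGroup ι →* G)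
    (hφ : Function.Injective φ) (h : ∀ j, Ψ (Φ (x j)) = φ (.of j)) : Function.Injective Φ := by
  refine injective_of_free Φ Ψ x hx ?_
  have : FreeGroup.lift (fun j => Ψ (Φ (x j))) = φ := by
    ext j; simp [h]
  rwa [this]

lemma partner_handle {g i : ℕ} (hi : i < g) : partner g (4 * i) = 4 * i + 2 ∧
    partner g (4 * i + 1) = 4 * i + 3 ∧ partner g (4 * i + 2) = 4 * i ∧
    partner g (4 * i + 3) = 4 * i + 1 := by
  unfold partner
  refine ⟨?_, ?_, ?_, ?_⟩ <;> split_ifs <;> omega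

variable {g r : ℕ}

/-- The four-holed sphere around three pairs of sides in different blocks. -/
theorem exists_isEssentialHom_sphere {l₁ l₂ l₃ : ℕ} (h₁ : l₁ < partner g l₁)
    (h₁₂ : partner g l₁ < l₂) (h₂ : l₂ < partner g l₂) (h₂₃ : partner g l₂ < l₃)
    (h₃ : l₃ < partner g l₃) (hl : l₃ < numSides g r) :
    ∃ Φ : FundamentalGroup (Model 0 4) (base 0 4) →* FundamentalGroup (Model g r) (base g r),
      IsEssentialHom Φ ∧ Φ (sideLoop 0 4 0) = sideLoop g r l₁ ∧
        Φ (sideLoop 0 4 2) = sideLoop g r l₂ ∧ Φ (sideLoop 0 4 4) = sideLoop g r l₃ := by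
  have hm : 0 < numSides g r := by omega
  have hp₃ := partner_lt hl
  have e₁ := partner_partner (g := g) (r := r) (k := l₁) (by omega)
  have e₂ := partner_partner (g := g) (r := r) (k := l₂) (by omega)
  have e₃ := partner_partner (g := g) (r := r) (k := l₃) (by omega)
  have h6 : numSides 0 4 = 6 := rfl
  let L : ℕ → ℕ := fun | 0 => l₁ | 1 => partner g l₁ | 2 => l₂ | 3 => partner g l₂ | 4 => l₃
                       | _ => partner g l₃
  have hLm : ∀ k < numSides 0 4, L k < numSides g r := by
    intro k hk
    rw [h6] at hk
    interval_cases k <;> simp only [L] <;> omega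
  let D : Routing 0 4 g r := Routing.select (by norm_num) (by norm_num [numSides]) hm L
    (by
      intro k j hkj hj
      rw [h6] at hj
      interval_cases j <;> interval_cases k <;> simp only [L] <;> omega)
    (by intro k hk; have := hLm k hk; omega)
    (by
      intro k hk
      rw [Nat.mod_eq_of_lt (hLm k hk), Nat.mod_eq_of_lt (hLm _ (partner_lt hk))]
      rw [h6] at hk
      interval_cases k
      exacts [rfl, e₁.symm, rfl, e₂.symm, rfl, e₃.symm])
  have hD : ∀ k < numSides 0 4, D.hom (sideLoop 0 4 k) = sideLoop g r (L k) := fun k hk => by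
    rw [Routing.select_hom hk, Nat.mod_eq_of_lt (hLm k hk)]
  have hD0 := hD 0 (by norm_num [numSides])
  have hD2 := hD 2 (by norm_num [numSides])
  have hD4 := hD 4 (by norm_num [numSides])
  refine ⟨D.hom, D.isEmbeddingHom.isEssentialHom ?_, hD0, hD2, hD4⟩
  -- The three chosen pairs receive free generators, all others are killed. They lie in different
  -- blocks, so at least one loop of each handle is trivial and the surface relation holds.
  let f : ℕ → FreeGroup (Fin 3) := fun k =>
    if k = l₁ then .of 0 else if k = l₂ then .of 1 else if k = l₃ then .of 2 else 1
  obtain ⟨F, hF⟩ := exists_hom_label (g := g) (r := r) hm f fun _ =>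
    exists_handle_product_of_trivial f fun n => by
      by_cases hn : 4 * n = l₁ ∨ 4 * n = l₂ ∨ 4 * n = l₃
      · right
        simp only [f]
        rw [if_neg (by omega), if_neg (by omega), if_neg (by omega)]
      · left
        simp only [f]
        rw [if_neg (by omega), if_neg (by omega), if_neg (by omega)]
  refine injective_of_free_generators F (closure_range_sphere 4 (by norm_num))
    (MonoidHom.id _) Function.injective_id fun j => ?_
  fin_cases j
  · refine (congrArg F hD0).trans ((hF l₁ (by omega) h₁).trans ?_)
    simp [f]
  · refine (congrArg F hD2).trans ((hF l₂ (by omega) h₂).trans ?_)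
    exact (if_neg (by omega)).trans (if_pos rfl)
  · refine (congrArg F hD4).trans ((hF l₃ (by omega) h₃).trans ?_)
    exact (if_neg (by omega)).trans ((if_neg (by omega)).trans (if_pos rfl))

/-- The pair of pants around two boundary components of the four-holed sphere. -/
theorem exists_isEssentialHom_pants {i j : ℕ} (hij : i < j) (hj : j < 3) :
    ∃ Φ : FundamentalGroup (Model 0 3) (base 0 3) →* FundamentalGroup (Model 0 4) (base 0 4),
      IsEssentialHom Φ ∧ Φ (sideLoop 0 3 0) = sideLoop 0 4 (2 * i) ∧
        Φ (sideLoop 0 3 2) = sideLoop 0 4 (2 * j) := by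
  have h4 : numSides 0 3 = 4 := rfl
  have h6 : numSides 0 4 = 6 := rfl
  let L : ℕ → ℕ := fun | 0 => 2 * i | 1 => 2 * i + 1 | 2 => 2 * j | _ => 2 * j + 1
  have hLm : ∀ k < numSides 0 3, L k < numSides 0 4 := by
    intro k hk
    rw [h4] at hk
    rw [h6]
    interval_cases k <;> simp only [L] <;> omega
  let D : Routing 0 3 0 4 := Routing.select (by norm_num) (by norm_num [numSides])
    (by norm_num [numSides]) L
    (by
      intro k j hkj hj
      rw [h4] at hj
      interval_cases j <;> interval_cases k <;> simp only [L] <;> omega)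
    (by intro k hk; have := hLm k hk; omega)
    (by
      intro k hk
      rw [Nat.mod_eq_of_lt (hLm k hk), Nat.mod_eq_of_lt (hLm _ (partner_lt hk))]
      rw [h4] at hk
      interval_cases k <;> simp [L, partner])
  have hD : ∀ k < numSides 0 3, D.hom (sideLoop 0 3 k) = sideLoop 0 4 (L k) := fun k hk => by
    rw [Routing.select_hom hk, Nat.mod_eq_of_lt (hLm k hk)]
  have hD0 := hD 0 (by norm_num [numSides])
  have hD2 := hD 2 (by norm_num [numSides])
  refine ⟨D.hom, D.isEmbeddingHom.isEssentialHom ?_, hD0, hD2⟩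
  obtain ⟨F, hF⟩ := exists_hom_label (g := 0) (r := 4) (by norm_num [numSides])
    (fun k => if k = 2 * i then (.of 0 : FreeGroup (Fin 2)) else .of 1) (by norm_num)
  refine injective_of_free_generators F (closure_range_sphere 3 (by norm_num))
    (MonoidHom.id _) Function.injective_id fun k => ?_
  fin_cases k
  · refine (congrArg F hD0).trans ((hF (2 * i) (by omega) (by simp [partner])).trans ?_)
    simp
  · refine (congrArg F hD2).trans ((hF (2 * j) (by omega) (by simp [partner])).trans ?_)
    exact if_neg (by omega)

/-- The pair of pants around the union of two boundary components and a third one. -/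
theorem isEssentialHom_pants : IsEssentialHom Routing.pants.hom := by
  refine Routing.pants.isEmbeddingHom.isEssentialHom ?_
  obtain ⟨F, hF⟩ := exists_hom_label (g := 0) (r := 4) (by norm_num [numSides])
    (fun k => if k = 0 then (.of 0 : FreeGroup (Fin 2)) else if k = 2 then 1 else .of 1)
    (by norm_num)
  refine injective_of_free_generators F (closure_range_sphere 3 (by norm_num))
    (MonoidHom.id _) Function.injective_id fun k => ?_
  have h0 := hF 0 (by norm_num [numSides]) (by simp [partner])
  have h2 := hF 2 (by norm_num [numSides]) (by simp [partner])
  have h4 := hF 4 (by norm_num [numSides]) (by simp [partner])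
  fin_cases k
  · refine (congrArg F Routing.pants_hom_zero).trans ?_
    rw [map_mul, h0, h2]; simp
  · refine (congrArg F Routing.pants_hom_two).trans ?_
    rw [h4]; simp

/-- The one-holed torus formed by a handle. -/
theorem exists_isEssentialHom_torus {i : ℕ} (hi : i < g) (h : r = 0 → 2 ≤ g) :
    ∃ Φ : FundamentalGroup (Model 1 1) (base 1 1) →* FundamentalGroup (Model g r) (base g r),
      IsEssentialHom Φ ∧ Φ (sideLoop 1 1 0) = sideLoop g r (4 * i) ∧
        Φ (sideLoop 1 1 1) = sideLoop g r (4 * i + 1) := by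
  have h4 : numSides 1 1 = 4 := rfl
  have hmg : 4 * g ≤ numSides g r := by unfold numSides; omega
  obtain ⟨p0, p1, p2, p3⟩ := partner_handle hi
  have hLm : ∀ k < numSides 1 1, 4 * i + k < numSides g r := by
    intro k hk
    omega
  let D : Routing 1 1 g r := Routing.select (by norm_num) (by norm_num [numSides]) (by omega)
    (fun k => 4 * i + k) (by intro k j hkj hj; omega)
    (by intro k hk; have := hLm k hk; omega)
    (by
      intro k hk
      rw [Nat.mod_eq_of_lt (hLm k hk), Nat.mod_eq_of_lt (hLm _ (partner_lt hk))]
      rw [h4] at hk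
      interval_cases k
      · exact p0.symm
      · exact p1.symm
      · exact p2.symm
      · exact p3.symm)
  have hD : ∀ k < numSides 1 1, D.hom (sideLoop 1 1 k) = sideLoop g r (4 * i + k) := fun k hk => by
    rw [Routing.select_hom hk, Nat.mod_eq_of_lt (hLm k hk)]
  have hD0 := hD 0 (by norm_num [numSides])
  have hD1 := hD 1 (by norm_num [numSides])
  refine ⟨D.hom, D.isEmbeddingHom.isEssentialHom ?_, hD0, hD1⟩
  -- On a closed surface another handle exists. Labelling its loops by the inverse generators in
  -- exchanged order makes its word the inverse of the word of handle `i`.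
  let j := if i = 0 then 1 else 0
  have hij : i ≠ j := by simp only [j]; split_ifs <;> omega
  let f : ℕ → FreeGroup (Fin 2) := fun k => if k = 4 * i then .of 0 else if k = 4 * i + 1 then .of 1
    else if k = 4 * j then (.of 1)⁻¹ else if k = 4 * j + 1 then (.of 0)⁻¹ else 1
  have f0 : f (4 * i) = .of 0 := by simp [f]
  have f1 : f (4 * i + 1) = .of 1 := by simp [f]
  have f2 : f (4 * j) = (.of 1)⁻¹ := by
    simp only [f]; rw [if_neg (by omega), if_neg (by omega), if_true]
  have f3 : f (4 * j + 1) = (.of 0)⁻¹ := by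
    simp only [f]; rw [if_neg (by omega), if_neg (by omega), if_neg (by omega), if_true]
  obtain ⟨F, hF⟩ := exists_hom_label (g := g) (r := r) (by omega) f fun hr =>
    exists_handle_product f hi (j := j) (by have := h hr; simp only [j]; split_ifs <;> omega) hij
      (fun n hni hnj => handleWord_eq_one_left (by
        simp only [f]
        rw [if_neg (by omega), if_neg (by omega), if_neg (by omega), if_neg (by omega)]))
      (by rw [handleWord, handleWord, f0, f1, f2, f3]; group)
  refine injective_of_free_generators F closure_range_torus
    (MonoidHom.id _) Function.injective_id fun k => ?_
  fin_cases k
  · refine (congrArg F hD0).trans ((hF (4 * i) (by omega) (by omega)).trans f0)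
  · refine (congrArg F hD1).trans ((hF (4 * i + 1) (by omega) (by omega)).trans f1)

/-- The two-holed torus formed by a handle and a pair of sides in another block. -/
theorem exists_routing_handle {i l : ℕ} (hi : i < g) (hl : l < numSides g r)
    (hlp : l < partner g l) (hil : l / 4 ≠ i) : ∃ D : Routing 1 2 g r,
      D.hom (sideLoop 1 2 0) = sideLoop g r (4 * i) ∧
      D.hom (sideLoop 1 2 1) = sideLoop g r (4 * i + 1) ∧
      D.hom (sideLoop 1 2 4) = sideLoop g r l := by
  have h6 : numSides 1 2 = 6 := rfl
  have hmg : 4 * g ≤ numSides g r := by unfold numSides; omega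
  obtain ⟨p0, p1, p2, p3⟩ := partner_handle hi
  have hpl := partner_lt hl
  have hpp := partner_partner hl
  have hpl4 : l < 4 * i → partner g l < 4 * i := by
    intro h
    unfold partner
    split_ifs <;> omega
  -- The handle has to come before the pair of `l` in the cyclic order of legs. If `l` precedes the
  -- handle in the polygon, its pair is taken one full turn later.
  obtain ⟨s, hs, hs0, hs1⟩ : ∃ s, (s = 0 ∨ s = numSides g r) ∧ 4 * i + 3 < l + s ∧
      partner g l + s < 4 * i + numSides g r := by
    by_cases h : l < 4 * i
    · exact ⟨_, Or.inr rfl, by omega, by have := hpl4 h; omega⟩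
    · exact ⟨0, Or.inl rfl, by omega, by omega⟩
  have hmod : ∀ k < numSides g r, (k + s) % numSides g r = k := by
    intro k hk
    rcases hs with rfl | rfl
    · exact Nat.mod_eq_of_lt hk
    · rw [Nat.add_mod_right, Nat.mod_eq_of_lt hk]
  have q0 : 4 * i % numSides g r = 4 * i := Nat.mod_eq_of_lt (by omega)
  have q1 : (4 * i + 1) % numSides g r = 4 * i + 1 := Nat.mod_eq_of_lt (by omega)
  have q2 : (4 * i + 2) % numSides g r = 4 * i + 2 := Nat.mod_eq_of_lt (by omega)
  have q3 : (4 * i + 3) % numSides g r = 4 * i + 3 := Nat.mod_eq_of_lt (by omega)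
  have q4 := hmod l hl
  have q5 := hmod _ hpl
  let L : ℕ → ℕ := fun | 0 => 4 * i | 1 => 4 * i + 1 | 2 => 4 * i + 2 | 3 => 4 * i + 3
                       | 4 => l + s | _ => partner g l + s
  let D : Routing 1 2 g r := Routing.select (by norm_num) (by norm_num [numSides]) (by omega) L
    (by
      intro k j hkj hj
      rw [h6] at hj
      interval_cases j <;> interval_cases k <;> simp only [L] <;> omega)
    (by
      intro k hk
      rw [h6] at hk
      interval_cases k <;> simp only [L] <;> omega)
    (by
      intro k hk
      rw [h6] at hk
      interval_cases k
      · change (4 * i + 2) % _ = partner g (4 * i % _); rw [q0, q2, p0]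
      · change (4 * i + 3) % _ = partner g ((4 * i + 1) % _); rw [q1, q3, p1]
      · change (4 * i) % _ = partner g ((4 * i + 2) % _); rw [q2, q0, p2]
      · change (4 * i + 1) % _ = partner g ((4 * i + 3) % _); rw [q3, q1, p3]
      · change (partner g l + s) % _ = partner g ((l + s) % _); rw [q4, q5]
      · change (l + s) % _ = partner g ((partner g l + s) % _); rw [q4, q5, hpp])
  refine ⟨D, ?_, ?_, ?_⟩
  · exact (Routing.select_hom (by norm_num [numSides])).trans (congrArg (sideLoop g r) q0)
  · exact (Routing.select_hom (by norm_num [numSides])).trans (congrArg (sideLoop g r) q1)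
  · exact (Routing.select_hom (by norm_num [numSides])).trans (congrArg (sideLoop g r) q4)

lemma sideLoop_two_holed_torus : sideLoop 1 2 2 = (sideLoop 1 2 0)⁻¹ ∧
    sideLoop 1 2 3 = (sideLoop 1 2 1)⁻¹ ∧ sideLoop 1 2 5 = (sideLoop 1 2 4)⁻¹ :=
  ⟨sideLoop_partner (k := 0) (by norm_num [numSides]),
    sideLoop_partner (k := 1) (by norm_num [numSides]),
    sideLoop_partner (k := 4) (by norm_num [numSides])⟩

/-- The one-holed torus obtained from a handle by sliding it over a further pair of sides. -/
theorem exists_isEssentialHom_torus_slide {i l : ℕ} (hi : i < g) (hl : l < numSides g r)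
    (hlp : l < partner g l) (hil : l / 4 ≠ i) :
    ∃ Φ : FundamentalGroup (Model 1 1) (base 1 1) →* FundamentalGroup (Model g r) (base g r),
      IsEssentialHom Φ ∧ Φ (sideLoop 1 1 0) = sideLoop g r (4 * i + 1) ∧
        Φ (sideLoop 1 1 1) = (sideLoop g r l)⁻¹ * (sideLoop g r (4 * i))⁻¹ := by
  have hmg : 4 * g ≤ numSides g r := by unfold numSides; omega
  obtain ⟨p0, p1, p2, p3⟩ := partner_handle hi
  obtain ⟨D, d0, d1, d4⟩ := exists_routing_handle hi hl hlp hil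
  obtain ⟨s2, s3, s5⟩ := sideLoop_two_holed_torus
  have e0 : (D.hom.comp Routing.torus.hom) (sideLoop 1 1 0) = sideLoop g r (4 * i + 1) := by
    rw [MonoidHom.comp_apply, Routing.torus_hom_zero, d1]
  have e1 : (D.hom.comp Routing.torus.hom) (sideLoop 1 1 1) =
      (sideLoop g r l)⁻¹ * (sideLoop g r (4 * i))⁻¹ := by
    rw [MonoidHom.comp_apply, Routing.torus_hom_one, s2, s5, map_mul, map_inv, map_inv, d0, d4]
  refine ⟨_, (D.isEmbeddingHom.comp Routing.torus.isEmbeddingHom).isEssentialHom ?_, e0, e1⟩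
  -- The first loop of the handle is killed, so the slid loop maps to a free generator through `l`
  -- alone; no handle keeps both of its loops.
  let f : ℕ → FreeGroup (Fin 2) := fun k =>
    if k = 4 * i + 1 then .of 0 else if k = l then (.of 1)⁻¹ else 1
  have f0 : f (4 * i) = 1 := by
    simp only [f]; rw [if_neg (by omega), if_neg (by omega)]
  have f1 : f (4 * i + 1) = .of 0 := by simp [f]
  have fl : f l = (.of 1)⁻¹ := by
    simp only [f]; rw [if_neg (by omega), if_true]
  obtain ⟨F, hF⟩ := exists_hom_label (g := g) (r := r) (by omega) f fun _ =>
    exists_handle_product_of_trivial f fun n => by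
      by_cases hn : 4 * n = l
      · right; simp only [f]; rw [if_neg (by omega), if_neg (by omega)]
      · left; simp only [f]; rw [if_neg (by omega), if_neg (by omega)]
  refine injective_of_free_generators F closure_range_torus
    (MonoidHom.id _) Function.injective_id fun k => ?_
  fin_cases k
  · refine (congrArg F e0).trans ((hF (4 * i + 1) (by omega) (by omega)).trans f1)
  · refine (congrArg F e1).trans ?_
    rw [map_mul, map_inv, map_inv, hF l hl hlp, hF (4 * i) (by omega) (by omega), f0, fl]
    simp

/-- The four-holed sphere obtained by cutting open a handle. -/
theorem exists_isEssentialHom_sphere_handle {i l : ℕ} (hi : i < g) (hl : l < numSides g r)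
    (hlp : l < partner g l) (hil : l / 4 ≠ i) :
    ∃ Φ : FundamentalGroup (Model 0 4) (base 0 4) →* FundamentalGroup (Model g r) (base g r),
      IsEssentialHom Φ ∧ Φ (sideLoop 0 4 0) = sideLoop g r (4 * i + 1) *
        (sideLoop g r (4 * i))⁻¹ * (sideLoop g r (4 * i + 1))⁻¹ ∧
        Φ (sideLoop 0 4 2) = sideLoop g r l ∧ Φ (sideLoop 0 4 4) = sideLoop g r (4 * i) := by
  have hmg : 4 * g ≤ numSides g r := by unfold numSides; omega
  obtain ⟨p0, p1, p2, p3⟩ := partner_handle hi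
  obtain ⟨D, d0, d1, d4⟩ := exists_routing_handle hi hl hlp hil
  obtain ⟨s2, s3, s5⟩ := sideLoop_two_holed_torus
  have e0 : (D.hom.comp Routing.sphere.hom) (sideLoop 0 4 0) = sideLoop g r (4 * i + 1) *
      (sideLoop g r (4 * i))⁻¹ * (sideLoop g r (4 * i + 1))⁻¹ := by
    rw [MonoidHom.comp_apply, Routing.sphere_hom_zero, s2, s3, inv_inv, map_mul, map_mul, map_inv,
      map_inv, d0, d1]
  have e2 : (D.hom.comp Routing.sphere.hom) (sideLoop 0 4 2) = sideLoop g r l := by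
    rw [MonoidHom.comp_apply, Routing.sphere_hom_two, d4]
  have e4 : (D.hom.comp Routing.sphere.hom) (sideLoop 0 4 4) = sideLoop g r (4 * i) := by
    rw [MonoidHom.comp_apply, Routing.sphere_hom_four, d0]
  refine ⟨_, (D.isEmbeddingHom.comp Routing.sphere.isEmbeddingHom).isEssentialHom ?_, e0, e2, e4⟩
  -- The loops a and b a⁻¹ b⁻¹ become independent once b acts by an automorphism that takes x₂⁻¹ to
  -- x₀. The handle then contributes x₀x₂. On a closed surface `l` belongs to another handle, whose
  -- second loop is `l + 1` or `l - 1` and carries the automorphism that cancels this contribution.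
  let f : ℕ → Holomorph 3 := fun k =>
    if k = 4 * i then .inl (.of 2) else if k = 4 * i + 1 then .inr autSwap
    else if k = l then .inl (.of 1) else if k = l + 1 then .inr autRight
    else if k + 1 = l then (.inr autLeft)⁻¹ else 1
  have f0 : f (4 * i) = .inl (.of 2) := by simp [f]
  have f1 : f (4 * i + 1) = .inr autSwap := by simp [f]
  have fl : f l = .inl (.of 1) := by
    simp only [f]; rw [if_neg (by omega), if_neg (by omega), if_true]
  have hw : handleWord f i = .inl (.of 0 * .of 2) := by
    rw [handleWord, f0, f1, autSwap_conj, map_mul]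
  obtain ⟨F, hF⟩ := exists_hom_label (g := g) (r := r) (by omega) f fun hr => by
    have hl4 : l < 4 * g := by rwa [hr, numSides_even_zero] at hl
    have hlmod : l % 4 < 2 := by
      unfold partner at hlp
      split_ifs at hlp <;> omega
    refine exists_handle_product f hi (j := l / 4) (by omega) hil.symm
      (fun n hni hnj => handleWord_eq_one_left ?_) ?_
    · simp only [f]
      rw [if_neg (by omega), if_neg (by omega), if_neg (by omega), if_neg (by omega),
        if_neg (by omega)]
    · rw [hw, handleWord]
      obtain hmod | hmod : l % 4 = 0 ∨ l % 4 = 1 := by omega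
      · rw [(by omega : 4 * (l / 4) = l), fl]
        have : f (l + 1) = .inr autRight := by
          simp only [f]
          rw [if_neg (by omega), if_neg (by omega), if_neg (by omega), if_true]
        rw [this]
        exact autRight_conj
      · rw [(by omega : 4 * (l / 4) + 1 = l), fl]
        have : f (4 * (l / 4)) = (.inr autLeft)⁻¹ := by
          simp only [f]
          rw [if_neg (by omega), if_neg (by omega), if_neg (by omega), if_neg (by omega),
            if_pos (by omega)]
        rw [this]
        exact autLeft_conj
  refine injective_of_free_generators F (closure_range_sphere 4 (by norm_num))
    SemidirectProduct.inl SemidirectProduct.inl_injective fun k => ?_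
  have h0 := hF (4 * i) (by omega) (by omega)
  have h1 := hF (4 * i + 1) (by omega) (by omega)
  fin_cases k
  · refine (congrArg F e0).trans ?_
    rw [map_mul, map_mul, map_inv, map_inv, h0, h1, f0, f1]
    exact autSwap_conj
  · exact (congrArg F e2).trans ((hF l hl hlp).trans fl)
  · exact (congrArg F e4).trans (h0.trans f0)

end Subsurfaces

/-! ### Reducibility on compact surfaces from level-one and level-zero pieces -/

section Criterion

variable {K : Type*} [Field K] {g r : ℕ}

/-- On the four-holed sphere, reducibility can be checked on essential pairs of pants. -/
theorem isReducible_of_pants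
    (ρ : FundamentalGroup (Model 0 4) (base 0 4) →* Matrix.SpecialLinearGroup (Fin 2) K)
    (H : ∀ Φ : FundamentalGroup (Model 0 3) (base 0 3) →* FundamentalGroup (Model 0 4) (base 0 4),
      IsEssentialHom Φ → IsReducible (ρ.comp Φ)) : IsReducible ρ := by
  have pair : ∀ i j : ℕ, i < j → j < 3 →
      HasCommonEigenvector {ρ (sideLoop 0 4 (2 * i)), ρ (sideLoop 0 4 (2 * j))} := by
    intro i j hij hj
    obtain ⟨Φ, hΦ, h0, h2⟩ := exists_isEssentialHom_pants hij hj
    refine (H Φ hΦ).hasCommonEigenvector ?_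
    rw [← h0, ← h2]
    rintro _ (rfl | rfl) <;> exact ⟨_, rfl⟩
  have hprod : HasCommonEigenvector
      {ρ (sideLoop 0 4 2) * ρ (sideLoop 0 4 0), ρ (sideLoop 0 4 4)} := by
    refine (H _ isEssentialHom_pants).hasCommonEigenvector ?_
    rw [← map_mul, ← Routing.pants_hom_zero, ← Routing.pants_hom_two]
    rintro _ (rfl | rfl) <;> exact ⟨_, rfl⟩
  refine isReducible_of_closure (closure_range_sphere 4 (by norm_num))
    ((hasCommonEigenvector_of_pairs (pair 0 1 (by norm_num) (by norm_num))
      (pair 1 2 (by norm_num) (by norm_num)) (pair 0 2 (by norm_num) (by norm_num)) hprod).mono ?_)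
  rintro _ ⟨_, ⟨j, rfl⟩, rfl⟩
  fin_cases j <;> simp

/-- The sides that represent the pairs of glued sides. -/
def IsGenerator (g r l : ℕ) : Prop := l < numSides g r ∧ l < partner g l

/-- Two sides belong to the same handle or are equal. -/
def SameBlock (g l l' : ℕ) : Prop := l = l' ∨ (l < 4 * g ∧ l' < 4 * g ∧ l / 4 = l' / 4)

lemma partner_lt_of_not_sameBlock {l l' : ℕ} (h : IsGenerator g r l) (h' : IsGenerator g r l')
    (hlt : l < l') (hb : ¬ SameBlock g l l') : partner g l < l' := by
  unfold SameBlock at hb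
  have h1 := h.2
  have h2 := h'.2
  unfold partner at *
  split_ifs at * <;> omega

lemma IsGenerator.cases {l : ℕ} (h : IsGenerator g r l) :
    (l < 4 * g ∧ (l = 4 * (l / 4) ∨ l = 4 * (l / 4) + 1)) ∨ (4 * g ≤ l ∧ l % 2 = 0) := by
  have h1 := h.2
  unfold partner at h1
  split_ifs at h1 <;> omega

lemma isGenerator_zero (hg : 0 < g) : IsGenerator g r 0 := by
  refine ⟨by unfold numSides; omega, ?_⟩
  unfold partner
  split_ifs <;> omega

lemma isGenerator_even {l : ℕ} (hl : l % 2 = 0) (h : l < numSides 0 r) : IsGenerator 0 r l := by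
  refine ⟨h, ?_⟩
  unfold partner
  split_ifs <;> omega

/-- On a compact surface of level at least one, reducibility can be checked on essential
four-holed spheres and one-holed tori. -/
theorem isReducible_of_levelOne (hχ : eulerChar g r < 0) (hl : 1 ≤ level g r)
    (ρ : FundamentalGroup (Model g r) (base g r) →* Matrix.SpecialLinearGroup (Fin 2) K)
    (H4 : ∀ Φ : FundamentalGroup (Model 0 4) (base 0 4) →* FundamentalGroup (Model g r) (base g r),
      IsEssentialHom Φ → IsReducible (ρ.comp Φ))
    (H1 : ∀ Φ : FundamentalGroup (Model 1 1) (base 1 1) →* FundamentalGroup (Model g r) (base g r),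
      IsEssentialHom Φ → IsReducible (ρ.comp Φ)) : IsReducible ρ := by
  have hgr : r = 0 → 2 ≤ g := by
    rintro rfl
    unfold eulerChar at hχ
    omega
  have hr4 : g = 0 → 4 ≤ r := by
    rintro rfl
    unfold level at hl
    omega
  have hm : 0 < numSides g r := by unfold numSides; omega
  have sorted : ∀ l₁ l₂ l₃, IsGenerator g r l₁ → IsGenerator g r l₂ → IsGenerator g r l₃ →
      ¬ SameBlock g l₁ l₂ → ¬ SameBlock g l₂ l₃ → l₁ < l₂ → l₂ < l₃ →
      HasCommonEigenvector {ρ (sideLoop g r l₁), ρ (sideLoop g r l₂), ρ (sideLoop g r l₃)} := by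
    intro l₁ l₂ l₃ h₁ h₂ h₃ b₁₂ b₂₃ h₁₂ h₂₃
    obtain ⟨Φ, hΦ, e0, e2, e4⟩ := exists_isEssentialHom_sphere h₁.2
      (partner_lt_of_not_sameBlock h₁ h₂ h₁₂ b₁₂) h₂.2
      (partner_lt_of_not_sameBlock h₂ h₃ h₂₃ b₂₃) h₃.2 h₃.1
    refine (H4 Φ hΦ).hasCommonEigenvector ?_
    rw [← e0, ← e2, ← e4]
    rintro _ (rfl | rfl | rfl) <;> exact ⟨_, rfl⟩
  have symm : ∀ l l', SameBlock g l l' → SameBlock g l' l := by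
    rintro l l' (h | ⟨h1, h2, h3⟩)
    exacts [Or.inl h.symm, Or.inr ⟨h2, h1, h3.symm⟩]
  have blocks : ∀ l₁ l₂ l₃, IsGenerator g r l₁ → IsGenerator g r l₂ → IsGenerator g r l₃ →
      ¬ SameBlock g l₁ l₂ → ¬ SameBlock g l₂ l₃ → ¬ SameBlock g l₁ l₃ →
      HasCommonEigenvector {ρ (sideLoop g r l₁), ρ (sideLoop g r l₂), ρ (sideLoop g r l₃)} := by
    intro l₁ l₂ l₃ h₁ h₂ h₃ b₁₂ b₂₃ b₁₃
    have n₁₂ : l₁ ≠ l₂ := fun h => b₁₂ (Or.inl h)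
    have n₂₃ : l₂ ≠ l₃ := fun h => b₂₃ (Or.inl h)
    have n₁₃ : l₁ ≠ l₃ := fun h => b₁₃ (Or.inl h)
    have b₂₁ := fun h => b₁₂ (symm _ _ h)
    have b₃₂ := fun h => b₂₃ (symm _ _ h)
    have b₃₁ := fun h => b₁₃ (symm _ _ h)
    rcases lt_or_gt_of_ne n₁₂ with h12 | h12 <;> rcases lt_or_gt_of_ne n₂₃ with h23 | h23 <;>
      rcases lt_or_gt_of_ne n₁₃ with h13 | h13
    · exact sorted _ _ _ h₁ h₂ h₃ b₁₂ b₂₃ h12 h23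
    · omega
    · exact (sorted _ _ _ h₁ h₃ h₂ b₁₃ b₃₂ h13 h23).mono (by simp [insert_subset_iff])
    · exact (sorted _ _ _ h₃ h₁ h₂ b₃₁ b₁₂ h13 h12).mono (by simp [insert_subset_iff])
    · exact (sorted _ _ _ h₂ h₁ h₃ b₂₁ b₁₃ h12 h13).mono (by simp [insert_subset_iff])
    · exact (sorted _ _ _ h₂ h₃ h₁ b₂₃ b₃₁ h23 h13).mono (by simp [insert_subset_iff])
    · omega
    · exact (sorted _ _ _ h₃ h₂ h₁ b₃₂ b₂₁ h23 h12).mono (by simp [insert_subset_iff])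
  have handle : ∀ i < g,
      HasCommonEigenvector {ρ (sideLoop g r (4 * i)), ρ (sideLoop g r (4 * i + 1))} := by
    intro i hi
    obtain ⟨Φ, hΦ, e0, e1⟩ := exists_isEssentialHom_torus (r := r) hi hgr
    refine (H1 Φ hΦ).hasCommonEigenvector ?_
    rw [← e0, ← e1]
    rintro _ (rfl | rfl) <;> exact ⟨_, rfl⟩
  have handle' : ∀ i < g, ∀ l, IsGenerator g r l → l / 4 ≠ i → HasCommonEigenvector
      {ρ (sideLoop g r (4 * i)), ρ (sideLoop g r (4 * i + 1)), ρ (sideLoop g r l)} := by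
    intro i hi l hl hil
    refine hasCommonEigenvector_of_handle (handle i hi) ?_ ?_
    · obtain ⟨Φ, hΦ, e0, e2, e4⟩ := exists_isEssentialHom_sphere_handle hi hl.1 hl.2 hil
      refine (H4 Φ hΦ).hasCommonEigenvector ?_
      rw [← map_inv, ← map_inv, ← map_mul, ← map_mul, ← e0, ← e2, ← e4]
      rintro _ (rfl | rfl | rfl) <;> exact ⟨_, rfl⟩
    · obtain ⟨Φ, hΦ, e0, e1⟩ := exists_isEssentialHom_torus_slide hi hl.1 hl.2 hil
      refine (H1 Φ hΦ).hasCommonEigenvector ?_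
      rw [← map_inv, ← map_inv, ← map_mul, ← e0, ← e1]
      rintro _ (rfl | rfl) <;> exact ⟨_, rfl⟩
  have same : ∀ x y z, IsGenerator g r x → IsGenerator g r y → IsGenerator g r z →
      SameBlock g x y →
      HasCommonEigenvector {ρ (sideLoop g r x), ρ (sideLoop g r y), ρ (sideLoop g r z)} := by
    intro x y z hx hy hz hxy
    rcases hx.cases with ⟨hx4, hx'⟩ | ⟨hx4, hx2⟩
    · have hi : x / 4 < g := by omega
      have hy' : y = 4 * (x / 4) ∨ y = 4 * (x / 4) + 1 := by
        rcases hxy with rfl | ⟨-, hy4, hxy⟩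
        · exact hx'
        · rcases hy.cases with h | h <;> omega
      by_cases hz4 : z / 4 = x / 4
      · have hz' : z = 4 * (x / 4) ∨ z = 4 * (x / 4) + 1 := by
          rcases hz.cases with h | h <;> omega
        refine (handle _ hi).mono ?_
        generalize x / 4 = i at *
        rcases hx' with rfl | rfl <;> rcases hy' with rfl | rfl <;> rcases hz' with rfl | rfl <;>
          simp [insert_subset_iff]
      · refine (handle' _ hi z hz hz4).mono ?_
        generalize x / 4 = i at *
        rcases hx' with rfl | rfl <;> rcases hy' with rfl | rfl <;> simp [insert_subset_iff]
    · obtain rfl : x = y := by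
        rcases hxy with h | ⟨h, -⟩
        · exact h
        · omega
      rcases hz.cases with ⟨hz4, hz'⟩ | ⟨hz4, hz2⟩
      · refine (handle' (z / 4) (by omega) x hx (by omega)).mono ?_
        generalize z / 4 = i at *
        rcases hz' with rfl | rfl <;> simp [insert_subset_iff]
      -- Neither `x` nor `z` belongs to a handle, and they are completed to a triple from three
      -- different blocks. In genus zero `4 ≤ r` provides three blocks; if `z = x` and there is a
      -- handle, the handle criterion applies instead.
      · have ht : ∃ t u, IsGenerator g r t ∧ IsGenerator g r u ∧ ¬ SameBlock g x t ∧
            ¬ SameBlock g t u ∧ ¬ SameBlock g x u ∧ (z = x ∨ z = u) ∨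
            z = x ∧ 0 < g := by
          unfold SameBlock
          by_cases hg : 0 < g
          · by_cases hzx : z = x
            · exact ⟨0, 0, Or.inr ⟨hzx, hg⟩⟩
            · exact ⟨0, z, Or.inl ⟨isGenerator_zero hg, hz, by omega, by omega, by omega,
                Or.inr rfl⟩⟩
          · obtain rfl : g = 0 := by omega
            have hr := hr4 rfl
            have h0 : IsGenerator 0 r 0 := isGenerator_even rfl (by unfold numSides; omega)
            have h2 : IsGenerator 0 r 2 := isGenerator_even rfl (by unfold numSides; omega)
            have h4 : IsGenerator 0 r 4 := isGenerator_even rfl (by unfold numSides; omega)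
            by_cases hzx : z = x
            · by_cases x0 : x = 0
              · exact ⟨2, 4, Or.inl ⟨h2, h4, by omega, by omega, by omega, Or.inl hzx⟩⟩
              · by_cases x2 : x = 2
                · exact ⟨0, 4, Or.inl ⟨h0, h4, by omega, by omega, by omega, Or.inl hzx⟩⟩
                · exact ⟨0, 2, Or.inl ⟨h0, h2, by omega, by omega, by omega, Or.inl hzx⟩⟩
            · by_cases t0 : x ≠ 0 ∧ z ≠ 0
              · exact ⟨0, z, Or.inl ⟨h0, hz, by omega, by omega, by omega, Or.inr rfl⟩⟩
              · by_cases t2 : x ≠ 2 ∧ z ≠ 2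
                · exact ⟨2, z, Or.inl ⟨h2, hz, by omega, by omega, by omega, Or.inr rfl⟩⟩
                · exact ⟨4, z, Or.inl ⟨h4, hz, by omega, by omega, by omega, Or.inr rfl⟩⟩
        obtain ⟨t, u, ⟨ht, hu, b1, b2, b3, hzu⟩ | ⟨rfl, hg⟩⟩ := ht
        · refine (blocks x t u hx ht hu b1 b2 b3).mono ?_
          rcases hzu with rfl | rfl <;> simp [insert_subset_iff]
        · exact (handle' 0 hg z hx (by omega)).mono (by simp)
  -- The Helly property is used a second time, now for the generators of the compact surface.
  refine isReducible_of_closure (closure_sideLoop_generator hm)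
    (HasCommonEigenvector.of_triples ?_)
  rintro _ ⟨_, ⟨x, hx, hxp, rfl⟩, rfl⟩ _ ⟨_, ⟨y, hy, hyp, rfl⟩, rfl⟩ _ ⟨_, ⟨z, hz, hzp, rfl⟩, rfl⟩
  have hx : IsGenerator g r x := ⟨hx, hxp⟩
  have hy : IsGenerator g r y := ⟨hy, hyp⟩
  have hz : IsGenerator g r z := ⟨hz, hzp⟩
  by_cases hxy : SameBlock g x y
  · exact same x y z hx hy hz hxy
  by_cases hyz : SameBlock g y z
  · exact (same y z x hy hz hx hyz).mono (by simp [insert_subset_iff])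
  by_cases hxz : SameBlock g x z
  · exact (same x z y hx hz hy hxz).mono (by simp [insert_subset_iff])
  exact blocks x y z hx hy hz hxy hyz hxz

/-- On a compact surface of negative Euler characteristic, reducibility can be checked on essential
pairs of pants and one-holed tori. -/
theorem isReducible_of_levelZero (hχ : eulerChar g r < 0) (hl : 0 ≤ level g r)
    (ρ : FundamentalGroup (Model g r) (base g r) →* Matrix.SpecialLinearGroup (Fin 2) K)
    (H3 : ∀ Φ : FundamentalGroup (Model 0 3) (base 0 3) →* FundamentalGroup (Model g r) (base g r),
      IsEssentialHom Φ → IsReducible (ρ.comp Φ))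
    (H1 : ∀ Φ : FundamentalGroup (Model 1 1) (base 1 1) →* FundamentalGroup (Model g r) (base g r),
      IsEssentialHom Φ → IsReducible (ρ.comp Φ)) : IsReducible ρ := by
  by_cases h : 1 ≤ level g r
  · refine isReducible_of_levelOne hχ h ρ (fun Φ hΦ => ?_) H1
    refine isReducible_of_pants _ fun Ψ hΨ => ?_
    rw [MonoidHom.comp_assoc]
    exact H3 _ (hΦ.comp hΨ)
  -- At level zero the closed torus is excluded by its Euler characteristic, and the surface is
  -- itself a pair of pants.
  · obtain ⟨rfl, rfl⟩ : g = 0 ∧ r = 3 := by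
      unfold level at h hl
      unfold eulerChar at hχ
      omega
    exact H3 _ (isEssentialHom_id _)

lemma isLevelOneSubsurfaceGroup_sphere {X : Type*} [TopologicalSpace X] {x₀ : X}
    {H : Subgroup (FundamentalGroup X x₀)} (h : IsSubsurfaceGroup 0 4 H) :
    IsLevelOneSubsurfaceGroup H := ⟨0, 4, by norm_num [eulerChar], by norm_num [level], h⟩

lemma isLevelOneSubsurfaceGroup_torus {X : Type*} [TopologicalSpace X] {x₀ : X}
    {H : Subgroup (FundamentalGroup X x₀)} (h : IsSubsurfaceGroup 1 1 H) :
    IsLevelOneSubsurfaceGroup H := ⟨1, 1, by norm_num [eulerChar], by norm_num [level], h⟩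

end Criterion

end SurfaceRep

end

theorem mainTheorem5 {K : Type*} [Field K] {X : Type*} [TopologicalSpace X] (x₀ : X)
    (ρ : FundamentalGroup X x₀ →* Matrix.SpecialLinearGroup (Fin 2) K) :
    (SurfaceRep.IsSurfaceOfLevelGE 1 X →
      (SurfaceRep.IsReducible ρ ↔
        ∀ H : Subgroup (FundamentalGroup X x₀),
          SurfaceRep.IsLevelOneSubsurfaceGroup H → SurfaceRep.IsReducible (ρ.comp H.subtype))) ∧
    (SurfaceRep.IsSurfaceOfLevelGE 0 X →
      (SurfaceRep.IsReducible ρ ↔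
        ∀ H : Subgroup (FundamentalGroup X x₀),
          SurfaceRep.IsSubsurfaceGroup 0 3 H ∨ SurfaceRep.IsSubsurfaceGroup 1 1 H →
            SurfaceRep.IsReducible (ρ.comp H.subtype))) := by
  refine ⟨fun hX => ⟨fun h H _ => h.comp _, fun h => ?_⟩,
    fun hX => ⟨fun h H _ => h.comp _, fun h => ?_⟩⟩
  · refine SurfaceRep.isReducible_of_subsurfaces hX fun g r hχ hl e he s hs q => ?_
    exact SurfaceRep.isReducible_of_levelOne hχ hl _
      (fun Φ hΦ => SurfaceRep.isReducible_restrictTo_comp ρ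
        (fun H hH => h H (SurfaceRep.isLevelOneSubsurfaceGroup_sphere hH)) he hs q hΦ)
      (fun Φ hΦ => SurfaceRep.isReducible_restrictTo_comp ρ
        (fun H hH => h H (SurfaceRep.isLevelOneSubsurfaceGroup_torus hH)) he hs q hΦ)
  · refine SurfaceRep.isReducible_of_subsurfaces hX fun g r hχ hl e he s hs q => ?_
    exact SurfaceRep.isReducible_of_levelZero hχ hl _
      (fun Φ hΦ => SurfaceRep.isReducible_restrictTo_comp ρ (fun H hH => h H (Or.inl hH)) he hs q hΦ)
      (fun Φ hΦ => SurfaceRep.isReducible_restrictTo_comp ρ (fun H hH => h H (Or.inr hH)) he hs q hΦ)
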